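/- **Setting.** Let $k=p/q$ with $p,q$ coprime positive integers, let $\omega,a,b\in\mathbb C$, and put $\alpha=k^2(\tfrac14-a^2)$, $\beta=k^2(\tfrac14-b^2)$. On the algebra $C^\infty(\Omega)$ of smooth complex-valued functions on $\Omega=\{(r,\theta): r>0,\ \sin k\theta\ne0,\ \cos k\theta\neq 0\}$ consider the quantum TTW Hamiltonian and its separating symmetry $$H=\partial_r^2+\tfrac1r\partial_r+\tfrac1{r^2}\partial_\theta^2-\omega^2r^2+\tfrac1{r^2}\Big(\tfrac{\alpha}{\sin^2k\theta}+\tfrac{\beta}{\cos^2k\theta}\Big),\qquad L_2=\partial_\theta^2+\tfrac{\alpha}{\sin^2k\theta}+\tfrac{\beta}{\cos^2k\theta}.$$ Put $x=\cos 2k\theta$, so that $(1-x^2)\partial_x=-\frac{\sin 2k\theta}{2k}\partial_\theta$, and $\varrho=r^2$, so that $\partial_\varrho=\frac1{2r}\partial_r$. For indeterminates $\mu,E$ (commuting with everything) define the Jacobi and Laguerre raising and lowering operators $$J^{\pm}_\nu=(1\pm\nu)(1-x^2)\partial_x-\tfrac12\nu(\nu\pm1)x-\tfrac12(a^2-b^2),\qquad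 K^{\pm}_\nu=(1\pm\nu)\partial_\varrho-\tfrac E4-\tfrac{\nu(\nu\pm1)}{2\varrho},$$ $$\Xi_\pm=\Xi_\pm(\mu,E)=K^\pm_{k\mu\pm2(p-1)}\cdots K^\pm_{k\mu\pm2}K^\pm_{k\mu}\;J^\pm_{\mu\pm2(q-1)}\cdots J^\pm_{\mu\pm2}J^\pm_\mu .$$ (With $\nu=2n+a+b+1$ and $G=(\sin k\theta)^{a+1/2}(\cos k\theta)^{b+1/2}$ one has $J^+_\nu=G\,[(2n+a+b+2)(1-x^2)\partial_x-(n+a+b+1)((2n+a+b+2)x+a-b)]\,G^{-1}$ and $J^-_\nu=G\,[-(2n+a+b)(1-x^2)\partial_x-n((2n+a+b)x-(a-b))]\,G^{-1}$.) Let $\Xi=\Xi_++\Xi_-$ and $\tilde\Xi=(\Xi_+-\Xi_-)/\mu$. Let $L_3$ and $L_4$ be the operators obtained from $\Xi$ and $\tilde\Xi$ by replacing $\mu^2$ by $-L_2/k^2$ and $E$ by $H$, these being written to the right of the coefficients; this makes sense by (ii). Put $R=-4k^2qL_3-4k^2q^2L_4$. Write $[A,B]=AB-BA$, $\{A,B\}=AB+BA$,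 and $\{A,B,C\}$ for the sum of the six products in all orders. Write $(z)_j=z(z+1)\cdots(z+j-1)$. For numbers $\mu,E$, call $\psi\in C^\infty(\Omega)$ a $(\mu,E)$-eigenfunction if $L_2\psi=-k^2\mu^2\psi$ and $H\psi=E\psi$. For $n,u\in\mathbb C$ put $\mu_n=2n+a+b+1$, $E_u=-2\omega[2u+1+(a+b+1)k]$, and $$\xi_n(u)=(-1)^p4^q\omega^{2p}(n+1)_q(n+a+1)_q(n+b+1)_q(n+a+b+1)_q(-u+kn)_p(u+k[n+a+b+1]+1)_p,$$ $$\eta_n(u)=(-1)^p4^q\omega^{2p}(-n)_q(-n-a)_q(-n-b)_q(-n-a-b)_q(u-kn+1)_p(-u-k[n+a+b+1])_p.$$ **Theorem.** There are polynomials $P^{(+)},P^{(-)}$ in five variables with complex coefficients, depending only on $p,q$, such that for all $\omega,a,b\in\mathbb C$ the following hold. (i) Let $\omega\ne0$ and, for $n,m\in\mathbb C$, $$\Psi_{n,m}=\omega^{k\mu_n/2}e^{-\omega r^2/2}r^{k\mu_n}L_m^{k\mu_n}(\omega r^2)\,|\sin k\theta|^{a+1/2}|\cos k\theta|^{b+1/2}P_n^{a,b}(\cos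 2k\theta),$$ with the associated Laguerre function $L^A_m(z)=\frac{\Gamma(m+A+1)}{\Gamma(m+1)\Gamma(A+1)}\,{}_1F_1(-m;A+1;z)$ and the Jacobi function $P^{a,b}_n(x)=\frac{\Gamma(n+a+1)}{\Gamma(n+1)\Gamma(a+1)}\,{}_2F_1(-n,n+a+b+1;a+1;\frac{1-x}2)$ (regularized series, $1/\Gamma=0$ at the poles of $\Gamma$; if $\Gamma(n+a+1)$ or $\Gamma(m+k\mu_n+1)$ is infinite, $\Psi_{n,m}$ is taken to be $0$). Then $\Psi_{n,m}\in C^\infty(\Omega)$ is a $(\mu_n,E_u)$-eigenfunction for $u=m+kn$, and, with $\Xi_\pm$ evaluated at $(\mu_n,E_u)$, $$\Xi_+\Psi_{n,m}=(-2)^q(-1)^p\omega^p(n+1)_q(n+a+b+1)_q\Psi_{n+q,m-p},$$ $$\Xi_-\Psi_{n,m}=(-2)^q\omega^p(-n-a)_q(-n-b)_q(u-kn+1)_p(-u-k[n+a+b+1])_p\Psi_{n-q,m+p};$$ the first whenever $\Gamma(n+a+1)$ and $\Gamma(m+k\mu_n+1)$ are finite, the second whenever the corresponding factors for $(n-q,m+p)$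 are finite. (ii) $\Xi_++\Xi_-$ is even in $\mu$ and $\Xi_+-\Xi_-$ is odd in $\mu$. (iii) For all $\mu,E\in\mathbb C$ and every $(\mu,E)$-eigenfunction $\psi$: $\Xi_\pm(\mu,E)\psi$ is a $(\mu\pm2q,E)$-eigenfunction; $L_3\psi=\Xi_+(\mu,E)\psi+\Xi_-(\mu,E)\psi$; $\mu L_4\psi=\Xi_+(\mu,E)\psi-\Xi_-(\mu,E)\psi$; and $$\Xi_-(\mu+2q,E)\Xi_+(\mu,E)\psi+\Xi_+(\mu-2q,E)\Xi_-(\mu,E)\psi=P^{(+)}(H^2,L_2,\omega^2,a,b)\psi,$$ $$\Xi_-(\mu+2q,E)\Xi_+(\mu,E)\psi-\Xi_+(\mu-2q,E)\Xi_-(\mu,E)\psi=\mu P^{(-)}(H^2,L_2,\omega^2,a,b)\psi.$$ (iv) For all $n,u\in\mathbb C$: $P^{(+)}(E_u^2,-k^2\mu_n^2,\omega^2,a,b)=\xi_n(u)+\eta_n(u)$ and $\mu_nP^{(-)}(E_u^2,-k^2\mu_n^2,\omega^2,a,b)=\xi_n(u)-\eta_n(u)$. (v) $L_3$ and $L_4$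 are differential operators of finite order with smooth coefficients, and $[H,L_2]=[H,L_3]=[H,L_4]=0$. (vi) With $P^{(\pm)}=P^{(\pm)}(H^2,L_2,\omega^2,a,b)$, the operators $H,L_2,L_4$ generate a closed algebra with the structure equations $$[L_2,L_4]=R,\qquad [L_2,R]=-8k^2q^2\{L_2,L_4\}-16k^4q^4L_4,\qquad [L_4,R]=8k^2q^2L_4^2+8k^2qP^{(-)},$$ $$\frac{3}{8k^2q^2}R^2=-22k^2q^2L_4^2-\{L_2,L_4,L_4\}-4k^2qP^{(-)}+12k^2P^{(+)}.$$ (vii) There is a differential operator $L_5$, of order strictly lower than that of $L_4$, with $[H,L_5]=0$, $[L_2,L_5]=L_4$ and $$L_5\Big(\frac{L_2}{k^2}+q^2\Big)=\frac1{4qk^2}\big(L_3-qL_4+Q(H)\big),$$ so that on every $(\mu,E)$-eigenfunction with $\mu\notin\{0,q,-q\}$ $$L_5=-\frac1{4qk^2}\Big(\frac{\Xi_+}{(\mu+q)\mu}+\frac{\Xi_-}{(\mu-q)\mu}+\frac{\beta_n}{\mu^2-q^2}\Big),\qquad \beta_n=Q(E).$$ Here $Q(E)=-2\,T_p(E)\,S_q$,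 where, with $c(t)=\frac14(-a-b+t)(a+b+t)(a-b+t)(-a+b+t)$, $$T_p(E)=-\frac E4\prod_{\ell=1}^{(p-1)/2}\Big(\frac{E^2}{16}-\omega^2\ell^2\Big)\ (p\text{ odd}),\qquad T_p(E)=\prod_{\ell=1}^{p/2}\Big(\frac{E^2}{16}-\omega^2(\ell-\tfrac12)^2\Big)\ (p\text{ even}),$$ $$S_q=-\frac{a^2-b^2}2\prod_{s=1}^{(q-1)/2}c(2s)\ (q\text{ odd}),\qquad S_q=\prod_{s=1}^{q/2}c(2s-1)\ (q\text{ even}).$$ In particular, for $p,q$ both odd, $Q(E)=-\frac{E(a^2-b^2)}4\prod_{\ell=1}^{(p-1)/2}\big(\frac{E^2}{16}-\omega^2\ell^2\big)\prod_{s=1}^{(q-1)/2}c(2s)$. -/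

import Mathlib

noncomputable section

namespace TTW

/-! ### Smooth functions on the configuration space and differential operators -/

/-- The configuration space in polar coordinates `(r, θ)`: `r > 0`, away from the singular rays
of the potential. -/
def domain (k : ℝ) : Set (ℝ × ℝ) :=
  {x | 0 < x.1 ∧ Real.sin (k * x.2) ≠ 0 ∧ Real.cos (k * x.2) ≠ 0}

theorem isOpen_domain (k : ℝ) : IsOpen (domain k) := by
  have h1 : IsOpen {x : ℝ × ℝ | 0 < x.1} := isOpen_lt continuous_const continuous_fst
  have h2 : IsOpen {x : ℝ × ℝ | Real.sin (k * x.2) ≠ 0} :=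
    isOpen_ne_fun (by fun_prop) continuous_const
  have h3 : IsOpen {x : ℝ × ℝ | Real.cos (k * x.2) ≠ 0} :=
    isOpen_ne_fun (by fun_prop) continuous_const
  exact h1.inter (h2.inter h3)

/-- Extension by zero of a function on the configuration space. -/
def extendZero {k : ℝ} (f : domain k → ℂ) : ℝ × ℝ → ℂ := Function.extend Subtype.val f 0

theorem extendZero_apply {k : ℝ} (f : domain k → ℂ) {x : ℝ × ℝ} (hx : x ∈ domain k) :
    extendZero f x = f ⟨x, hx⟩ :=
  Subtype.val_injective.extend_apply f 0 ⟨x, hx⟩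

/-- The algebra `C^∞` of smooth complex-valued functions on the configuration space. -/
def Smooth (k : ℝ) : Subalgebra ℂ (domain k → ℂ) where
  carrier := {f | ContDiffOn ℝ ((⊤ : ℕ∞) : WithTop ℕ∞) (extendZero f) (domain k)}
  mul_mem' {f g} hf hg := (ContDiffOn.mul hf hg).congr fun x hx => by
    simp [extendZero_apply _ hx]
  add_mem' {f g} hf hg := (ContDiffOn.add hf hg).congr fun x hx => by
    simp [extendZero_apply _ hx]
  algebraMap_mem' c := (contDiffOn_const (c := c)).congr fun x hx => by
    simp [extendZero_apply _ hx, Pi.algebraMap_apply]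

instance (k : ℝ) : CommRing (Smooth k) := Subalgebra.toCommRing _

instance (k : ℝ) : Module ℂ (Smooth k) := Subalgebra.module' _

/-- The restriction of a function that is smooth on the configuration space. -/
def Smooth.restrict {k : ℝ} (g : ℝ × ℝ → ℂ) (hg : ContDiffOn ℝ ((⊤ : ℕ∞) : WithTop ℕ∞) g (domain k)) : Smooth k :=
  ⟨fun x => g x, hg.congr fun x hx => by rw [extendZero_apply _ hx]⟩

/-- Linear operators on `C^∞`, with composition as multiplication. -/
abbrev Op (k : ℝ) : Type := Module.End ℂ (Smooth k)

instance (k : ℝ) : Ring (Op k) := Module.End.instRing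

instance (k : ℝ) : Algebra ℂ (Op k) := Module.End.instAlgebra ℂ ℂ (Smooth k)

/-- The partial derivative in the direction `v`. -/
def partialD (k : ℝ) (v : ℝ × ℝ) : Op k where
  toFun f := Smooth.restrict (fun x => fderiv ℝ (extendZero f.1) x v)
    ((ContDiffOn.fderiv_of_isOpen f.2 (isOpen_domain k) (m := ((⊤ : ℕ∞) : WithTop ℕ∞))
      (by simp)).clm_apply contDiffOn_const)
  map_add' f g := by
    apply Subtype.ext
    funext x
    have hd : ∀ h : Smooth k, DifferentiableAt ℝ (extendZero h.1) x := fun h =>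
      (ContDiffOn.contDiffAt h.2 ((isOpen_domain k).mem_nhds x.2)).differentiableAt (by simp)
    have he : extendZero ((f + g : Smooth k) : domain k → ℂ) =ᶠ[nhds x.1]
        extendZero f.1 + extendZero g.1 := by
      filter_upwards [(isOpen_domain k).mem_nhds x.2] with y hy
      simp [extendZero_apply _ hy]
    have h2 : fderiv ℝ (extendZero ((f + g : Smooth k) : domain k → ℂ)) x
        = fderiv ℝ (extendZero f.1) x + fderiv ℝ (extendZero g.1) x :=
      he.fderiv_eq.trans (fderiv_add (hd f) (hd g))
    exact congrArg (fun T : ℝ × ℝ →L[ℝ] ℂ => T v) h2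
  map_smul' c f := by
    apply Subtype.ext
    funext x
    have hd : ∀ h : Smooth k, DifferentiableAt ℝ (extendZero h.1) x := fun h =>
      (ContDiffOn.contDiffAt h.2 ((isOpen_domain k).mem_nhds x.2)).differentiableAt (by simp)
    have he : extendZero ((c • f : Smooth k) : domain k → ℂ) =ᶠ[nhds x.1]
        c • extendZero f.1 := by
      filter_upwards [(isOpen_domain k).mem_nhds x.2] with y hy
      simp [extendZero_apply _ hy]
    have h2 : fderiv ℝ (extendZero ((c • f : Smooth k) : domain k → ℂ)) x
        = c • fderiv ℝ (extendZero f.1) x :=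
      he.fderiv_eq.trans (fderiv_const_smul (hd f) c)
    exact congrArg (fun T : ℝ × ℝ →L[ℝ] ℂ => T v) h2

/-- `∂_r`. -/
def dr (k : ℝ) : Op k := partialD k (1, 0)

/-- `∂_θ`. -/
def dθ (k : ℝ) : Op k := partialD k (0, 1)

/-- Multiplication by a smooth function. -/
def mulOp {k : ℝ} (c : Smooth k) : Op k := LinearMap.mulLeft ℂ c

/-- `T` is a differential operator of order at most `N` with smooth coefficients. -/
def OrderLE {k : ℝ} (N : ℕ) (T : Op k) : Prop :=
  ∃ c : ℕ → ℕ → Smooth k,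
    T = ∑ i ∈ Finset.range (N + 1), ∑ j ∈ Finset.range (N + 1 - i),
      mulOp (c i j) * dr k ^ i * dθ k ^ j

/-- `T` is a (finite-order) differential operator. -/
def IsDiffOp {k : ℝ} (T : Op k) : Prop := ∃ N, OrderLE N T

/-- Multiplication by `1 / r`. -/
def invR (k : ℝ) : Op k := mulOp <| Smooth.restrict (fun x => ((x.1 : ℂ))⁻¹) <| by
  refine ContDiffOn.inv (Complex.ofRealCLM.contDiff.comp contDiff_fst).contDiffOn fun x hx => ?_
  exact_mod_cast hx.1.ne'

/-- Multiplication by `r ^ 2`. -/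
def rSq (k : ℝ) : Op k := mulOp <| Smooth.restrict (fun x => (x.1 : ℂ) ^ 2)
  ((Complex.ofRealCLM.contDiff.comp contDiff_fst).pow 2).contDiffOn

/-- Multiplication by `1 / sin² (kθ)`. -/
def invSinSq (k : ℝ) : Op k :=
  mulOp <| Smooth.restrict (fun x => ((Real.sin (k * x.2) : ℂ) ^ 2)⁻¹) <| by
    refine ContDiffOn.inv ((Complex.ofRealCLM.contDiff.comp
      (Real.contDiff_sin.comp (contDiff_const.mul contDiff_snd))).pow 2).contDiffOn fun x hx => ?_
    exact pow_ne_zero 2 (Complex.ofReal_ne_zero.2 hx.2.1)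

/-- Multiplication by `1 / cos² (kθ)`. -/
def invCosSq (k : ℝ) : Op k :=
  mulOp <| Smooth.restrict (fun x => ((Real.cos (k * x.2) : ℂ) ^ 2)⁻¹) <| by
    refine ContDiffOn.inv ((Complex.ofRealCLM.contDiff.comp
      (Real.contDiff_cos.comp (contDiff_const.mul contDiff_snd))).pow 2).contDiffOn fun x hx => ?_
    exact pow_ne_zero 2 (Complex.ofReal_ne_zero.2 hx.2.2)

/-- Multiplication by `cos (2kθ)`. -/
def cosTwo (k : ℝ) : Op k := mulOp <| Smooth.restrict (fun x => (Real.cos (2 * k * x.2) : ℂ))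
  (Complex.ofRealCLM.contDiff.comp
    (Real.contDiff_cos.comp (contDiff_const.mul contDiff_snd))).contDiffOn

/-- Multiplication by `sin (2kθ)`. -/
def sinTwo (k : ℝ) : Op k := mulOp <| Smooth.restrict (fun x => (Real.sin (2 * k * x.2) : ℂ))
  (Complex.ofRealCLM.contDiff.comp
    (Real.contDiff_sin.comp (contDiff_const.mul contDiff_snd))).contDiffOn

/-! ### The Hamiltonian and the separating symmetry -/

/-- The coupling constant `k² (1/4 - a²)`; `α` is obtained from `a` and `β` from `b`. -/
def coupling (k : ℝ) (a : ℂ) : ℂ := (k : ℂ) ^ 2 * (1 / 4 - a ^ 2)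

/-- `L₂ = ∂_θ² + α / sin² (kθ) + β / cos² (kθ)`. -/
def L2 (k : ℝ) (a b : ℂ) : Op k :=
  dθ k ^ 2 + coupling k a • invSinSq k + coupling k b • invCosSq k

/-- The TTW Hamiltonian
`H = ∂_r² + (1/r) ∂_r + (1/r²) ∂_θ² - ω² r² + (1/r²) (α / sin² (kθ) + β / cos² (kθ))`. -/
def H (k : ℝ) (ω a b : ℂ) : Op k :=
  dr k ^ 2 + invR k * dr k + invR k ^ 2 * dθ k ^ 2 - ω ^ 2 • rSq k
    + invR k ^ 2 * (coupling k a • invSinSq k + coupling k b • invCosSq k)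

/-! ### Raising and lowering operators

The spectral parameters `μ` and `E` are first treated as central indeterminates. -/

/-- Polynomials in two central indeterminates `μ` (inner) and `E` (outer) whose coefficients are
operators. -/
abbrev OpPoly (k : ℝ) : Type := Polynomial (Polynomial (Op k))

instance (k : ℝ) : Ring (OpPoly k) := Polynomial.ring

instance (k : ℝ) : Module ℂ (OpPoly k) := Polynomial.module

/-- The indeterminate `μ`. -/
def muVar (k : ℝ) : OpPoly k := Polynomial.C Polynomial.X

/-- The indeterminate `E`. -/
def eVar (k : ℝ) : OpPoly k := Polynomial.X

/-- An operator, as a constant polynomial. -/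
def constOp {k : ℝ} (T : Op k) : OpPoly k := Polynomial.C (Polynomial.C T)

/-- `(1 - x²) ∂_x` for `x = cos (2kθ)`, that is `-(sin (2kθ) / (2k)) ∂_θ`. -/
def dX (k : ℝ) : Op k := -((2 * (k : ℂ))⁻¹ • (sinTwo k * dθ k))

/-- `∂_R` for `R = r²`, that is `(1 / (2r)) ∂_r`. -/
def dR (k : ℝ) : Op k := (1 / 2 : ℂ) • (invR k * dr k)

/-- The Jacobi raising operator. With `ν = 2n + a + b + 1` this is `G J⁺ G⁻¹`, where
`J⁺ = (2n+a+b+2)(1-x²)∂_x + (n+a+b+1)(-(2n+a+b+2)x - (a-b))` and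
`G = (sin kθ)^(a+1/2) (cos kθ)^(b+1/2)` is the factor by which the wave function differs from its
Jacobi part. -/
def jPlus (k : ℝ) (a b : ℂ) (ν : OpPoly k) : OpPoly k :=
  (ν + 1) * constOp (dX k) - (1 / 2 : ℂ) • (ν * (ν + 1) * constOp (cosTwo k))
    - ((a ^ 2 - b ^ 2) / 2) • (1 : OpPoly k)

/-- The Jacobi lowering operator. With `ν = 2n + a + b + 1` this is `G J⁻ G⁻¹`, where
`J⁻ = -(2n+a+b)(1-x²)∂_x - n((2n+a+b)x - (a-b))`. -/
def jMinus (k : ℝ) (a b : ℂ) (ν : OpPoly k) : OpPoly k :=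
  (1 - ν) * constOp (dX k) + (1 / 2 : ℂ) • (ν * (1 - ν) * constOp (cosTwo k))
    - ((a ^ 2 - b ^ 2) / 2) • (1 : OpPoly k)

/-- The Laguerre operator `K⁺ = (ν + 1) ∂_R - E/4 - ν (ν + 1) / (2R)`. -/
def kPlus (k : ℝ) (ν : OpPoly k) : OpPoly k :=
  (ν + 1) * constOp (dR k) - (1 / 4 : ℂ) • eVar k
    - (1 / 2 : ℂ) • (ν * (ν + 1) * constOp (invR k ^ 2))

/-- The Laguerre operator `K⁻ = (-ν + 1) ∂_R - E/4 + ν (1 - ν) / (2R)`. -/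
def kMinus (k : ℝ) (ν : OpPoly k) : OpPoly k :=
  (1 - ν) * constOp (dR k) - (1 / 4 : ℂ) • eVar k
    + (1 / 2 : ℂ) • (ν * (1 - ν) * constOp (invR k ^ 2))

/-- `k = p / q`. -/
def ratio (p q : ℕ) : ℝ := (p : ℝ) / (q : ℝ)

/-- `Ξ₊ = K⁺(kμ + 2(p-1)) ⋯ K⁺(kμ) J⁺(μ + 2(q-1)) ⋯ J⁺(μ)`. -/
def xiPlus (p q : ℕ) (a b : ℂ) : OpPoly (ratio p q) :=
  ((List.range p).reverse.map fun j =>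
      kPlus (ratio p q) ((ratio p q : ℂ) • muVar _ + 2 * (j : OpPoly (ratio p q)))).prod
    * ((List.range q).reverse.map fun s =>
      jPlus (ratio p q) a b (muVar _ + 2 * (s : OpPoly (ratio p q)))).prod

/-- `Ξ₋ = K⁻(kμ - 2(p-1)) ⋯ K⁻(kμ) J⁻(μ - 2(q-1)) ⋯ J⁻(μ)`. -/
def xiMinus (p q : ℕ) (a b : ℂ) : OpPoly (ratio p q) :=
  ((List.range p).reverse.map fun j =>
      kMinus (ratio p q) ((ratio p q : ℂ) • muVar _ - 2 * (j : OpPoly (ratio p q)))).prod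
    * ((List.range q).reverse.map fun s =>
      jMinus (ratio p q) a b (muVar _ - 2 * (s : OpPoly (ratio p q)))).prod

/-- The operator obtained by giving the indeterminates `μ`, `E` numerical values. -/
def atValue {k : ℝ} (F : OpPoly k) (μ E : ℂ) : Op k :=
  F.sum fun j G => G.sum fun i T => (μ ^ i * E ^ j) • T

/-- The coefficient of `μ ^ i E ^ j`. -/
def coeffOp {k : ℝ} (F : OpPoly k) (i j : ℕ) : Op k := (F.coeff j).coeff i

/-- The basis independent operator of a polynomial `F` in `μ`, `E`. If `F` is even in `μ`, then `E`
is replaced by `H` and `μ²` by `-L₂ / k²`, to the right of the coefficients. If `F` is odd in `μ`,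
this is done with the even polynomial `F / μ`. (Here `i / 2` is the integer quotient.) -/
def quantize {k : ℝ} (ω a b : ℂ) (F : OpPoly k) : Op k :=
  F.sum fun j G => G.sum fun i T =>
    T * (-(((k : ℂ) ^ 2)⁻¹ • L2 k a b)) ^ (i / 2) * H k ω a b ^ j

/-- `L₃ = Ξ = Ξ₊ + Ξ₋`. -/
def L3 (p q : ℕ) (ω a b : ℂ) : Op (ratio p q) :=
  quantize ω a b (xiPlus p q a b + xiMinus p q a b)

/-- `L₄ = Ξ̃ = (Ξ₊ - Ξ₋) / μ`. -/
def L4 (p q : ℕ) (ω a b : ℂ) : Op (ratio p q) :=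
  quantize ω a b (xiPlus p q a b - xiMinus p q a b)

/-- `R = -4k²q L₃ - 4k²q² L₄`. -/
def R (p q : ℕ) (ω a b : ℂ) : Op (ratio p q) :=
  -((4 * (ratio p q : ℂ) ^ 2 * q) • L3 p q ω a b)
    - (4 * (ratio p q : ℂ) ^ 2 * q ^ 2) • L4 p q ω a b

/-- The symmetrizer `{A, B}`. -/
def symm2 {k : ℝ} (A B : Op k) : Op k := A * B + B * A

/-- The symmetrizer `{A, B, C}`, the sum over all six orderings. -/
def symm3 {k : ℝ} (A B C : Op k) : Op k :=
  A * B * C + A * C * B + B * A * C + B * C * A + C * A * B + C * B * A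

/-! ### The structure polynomials -/

/-- The rising factorial `(z)_j`. -/
def poch (j : ℕ) (z : ℂ) : ℂ := (ascPochhammer ℂ j).eval z

/-- `μ = 2n + a + b + 1`. -/
def muVal (a b n : ℂ) : ℂ := 2 * n + a + b + 1

/-- `E = -2ω (2u + 1 + (a + b + 1) k)`, where `u = m + nk`. -/
def energy (k : ℝ) (ω a b u : ℂ) : ℂ := -2 * ω * (2 * u + 1 + (a + b + 1) * k)

/-- The scalar `ξ_n` by which `Ξ₋ Ξ₊` acts. -/
def xiScalar (p q : ℕ) (ω a b n u : ℂ) : ℂ :=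
  (-1) ^ p * 4 ^ q * ω ^ (2 * p) * poch q (n + 1) * poch q (n + a + 1) * poch q (n + b + 1)
    * poch q (n + a + b + 1) * poch p (-u + ratio p q * n)
    * poch p (u + ratio p q * (n + a + b + 1) + 1)

/-- The scalar `η_n` by which `Ξ₊ Ξ₋` acts. -/
def etaScalar (p q : ℕ) (ω a b n u : ℂ) : ℂ :=
  (-1) ^ p * 4 ^ q * ω ^ (2 * p) * poch q (-n) * poch q (-n - a) * poch q (-n - b)
    * poch q (-n - a - b) * poch p (u - ratio p q * n + 1)
    * poch p (-u - ratio p q * (n + a + b + 1))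

/-- `P(A, B, w, a, b)` for operators `A`, `B` and numbers `w`, `a`, `b`. -/
def evalAtOps {k : ℝ} (P : MvPolynomial (Fin 5) ℂ) (A B : Op k) (w a b : ℂ) : Op k :=
  ∑ s ∈ P.support, (P.coeff s * w ^ s 2 * a ^ s 3 * b ^ s 4) • (A ^ s 0 * B ^ s 1)

/-- The Laguerre factor of `Q`, a polynomial in the energy. -/
def betaRadial (p : ℕ) (ω : ℂ) : Polynomial ℂ :=
  if Odd p then
    Polynomial.C (-1 / 4) * Polynomial.X * ∏ l ∈ Finset.Icc 1 ((p - 1) / 2),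
      (Polynomial.C (1 / 16) * Polynomial.X ^ 2 - Polynomial.C (ω ^ 2 * (l : ℂ) ^ 2))
  else
    ∏ l ∈ Finset.Icc 1 (p / 2),
      (Polynomial.C (1 / 16) * Polynomial.X ^ 2 - Polynomial.C (ω ^ 2 * ((l : ℂ) - 1 / 2) ^ 2))

/-- The product `(1/4) (-a-b+t) (a+b+t) (a-b+t) (-a+b+t)`. -/
def quarterProd (a b t : ℂ) : ℂ :=
  1 / 4 * (-a - b + t) * (a + b + t) * (a - b + t) * (-a + b + t)

/-- The Jacobi factor of `Q`. -/
def betaAngular (q : ℕ) (a b : ℂ) : ℂ :=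
  if Odd q then
    -((a ^ 2 - b ^ 2) / 2) * ∏ s ∈ Finset.Icc 1 ((q - 1) / 2), quarterProd a b (2 * s)
  else
    ∏ s ∈ Finset.Icc 1 (q / 2), quarterProd a b (2 * s - 1)

/-- The polynomial `Q`. For `p`, `q` both odd, `Q(E)` is
`-(E (a²-b²) / 4) ∏ (E²/16 - ω² l²) ∏ (1/4)(-a-b+2s)(a+b+2s)(a-b+2s)(-a+b+2s)`,
with `1 ≤ l ≤ (p-1)/2` and `1 ≤ s ≤ (q-1)/2`. -/
def betaPoly (p q : ℕ) (ω a b : ℂ) : Polynomial ℂ :=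
  Polynomial.C (-2 * betaAngular q a b) * betaRadial p ω

/-! ### The formal eigenbasis -/

/-- The associated Laguerre function
`L_m^A(z) = (Γ(m+A+1) / (Γ(m+1) Γ(A+1))) ₁F₁(-m; A+1; z)`. -/
def laguerreFn (m A z : ℂ) : ℂ :=
  Complex.Gamma (m + A + 1) / Complex.Gamma (m + 1) * Complex.regularizedHGFun {-m} {A + 1} z

/-- The Jacobi function
`P_n^(a,b)(x) = (Γ(n+a+1) / (Γ(n+1) Γ(a+1))) ₂F₁(-n, n+a+b+1; a+1; (1-x)/2)`. -/
def jacobiFn (n a b x : ℂ) : ℂ :=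
  Complex.Gamma (n + a + 1) / Complex.Gamma (n + 1)
    * Complex.regularizedGaussHGFun (-n) (n + a + b + 1) (a + 1) ((1 - x) / 2)

/-- The formal eigenfunction `Ψ_{n,m}` at `(r, θ)`, with the power `ω^(kμ/2)` included. -/
def psiFn (k : ℝ) (ω a b n m : ℂ) (x : ℝ × ℝ) : ℂ :=
  ω ^ (k * muVal a b n / 2) * Complex.exp (-(ω / 2) * (x.1 : ℂ) ^ 2)
    * (x.1 : ℂ) ^ (k * muVal a b n) * laguerreFn m (k * muVal a b n) (ω * (x.1 : ℂ) ^ 2)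
    * ((|Real.sin (k * x.2)| : ℝ) : ℂ) ^ (a + 1 / 2) * ((|Real.cos (k * x.2)| : ℝ) : ℂ) ^ (b + 1 / 2)
    * jacobiFn n a b (Real.cos (2 * k * x.2))

/-- The normalizing factors `Γ(n+a+1)` and `Γ(m+kμ+1)` of `Ψ_{n,m}` are finite. -/
def Admissible (k : ℝ) (a b n m : ℂ) : Prop :=
  ∀ j : ℕ, n + a + 1 + j ≠ 0 ∧ m + k * muVal a b n + 1 + j ≠ 0

/-- `ψ` is a joint formal eigenfunction: `L₂ ψ = -k²μ² ψ` and `H ψ = E ψ`. -/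
def IsJointEigen {k : ℝ} (ω a b μ E : ℂ) (ψ : Smooth k) : Prop :=
  L2 k a b ψ = (-((k : ℂ) ^ 2 * μ ^ 2)) • ψ ∧ H k ω a b ψ = E • ψ

end TTW

end

/-!
The proof rests on two factorization ladders. In terms of `x = cos 2kθ` and `r²`, the operator `L₂`
and, modulo `L₂`, the Hamiltonian become second order operators `G` of one variable depending on a
parameter `s = (ν + 1) / 2`, and the Jacobi and Laguerre operators `J` satisfy
`G (s + 1) J s = J s G s` and `J (-s) J s = c s - 4 s² G s` with a scalar `c s` (`IsLadder`). The
lowering operators are the raising operators at `-ν`, so that `Ξ₋` is `Ξ₊` at `-μ`. Hence chains of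
ladder operators map joint eigenfunctions to joint eigenfunctions, a chain followed by the opposite
chain acts as the product of the scalars (`IsLadder.factor_chain`), and a chain that is symmetric
under `s ↦ -s` is itself a scalar (`IsLadder.self_chain`). Since `k q = p`, both chains of `Ξ₊` shift
`μ` by the same amount `2q`.

Only the commutation relations of the separated operators enter; they are collected in
`LadderModel`. "On a joint eigenfunction" is made algebraic: `eigIdeal m` is the left ideal of
operator polynomials in `μ` and `E` generated by `L₂ + k² m²` and `H - E`. Every operator polynomial in
it annihilates each actual eigenfunction (`IsJointEigen.atHom_eq_zero`), and conversely an operator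
free of `μ` and `E` that lies in the ideal of the generic eigenvalue `m = μ` vanishes
(`constHom_eq_zero`): operator polynomials act on pairs `(u, v)`, read as `u + μ v`, with `μ²` and `E`
acting on the right as `-k⁻² L₂` and `H`, and the ideal annihilates the pair `(1, 0)`
(`pair_eq_zero`). The components of a pair also separate even and odd powers of `μ`. Therefore the
structure equations need to be verified only on the generic eigenfunction, where `L₃ = Ξ₊ + Ξ₋`,
`μ L₄ = Ξ₊ - Ξ₋` and `Ξ₋ Ξ₊`, `Ξ₊ Ξ₋` are scalars `S(μ)`, `S(-μ)`; this is done in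
`LadderModel.Quantization`. The polynomials `P⁽⁺⁾` and `P⁽⁻⁾` are `S(μ) + S(-μ)` and
`(S(μ) - S(-μ)) / μ`, written in terms of `μ²`.

At `μ = q` the operator `Ξ₋` is a symmetric chain, so that `L₃ - q L₄ = 2 Ξ₋` is the scalar `-Q(E)`
there (`xi_self`, `aeval_betaPoly`). Thus `L₃ - q L₄ + Q(H)` lies in the ideal of `μ = q`, and the
action on pairs yields a right factor `L₂ + k² q²` (`exists_factor`); the other factor is a multiple
of `L₅`. Its commutators follow by cancelling `L₂ + k² q²`, which is possible because the symbol of a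
differential operator is multiplicative. Assigning weight one to `μ` and computing symbols shows that
`L₃` and `L₄` have orders at most `2 (p + q)` and `2 (p + q) - 1`, so that `L₅` has order at most
`2 (p + q) - 2`; the symbol of `L₄` at the differential of `θ` is proportional to `sin 2pθ`, so the
order of `L₄` is not smaller than stated (`not_orderLE_L4`).

For the explicit eigenfunctions, the ladder relations are contiguous relations of hypergeometric
series with the regularized coefficients, which hold for all complex parameters
(`jacobiReg_raise`, `laguerreReg_raise`, `laguerreReg_lower`). The differential equations follow from
them by the factorization `J (-s) J s` (`angularOp_angFn`, `radialOp_radFn`). The `Γ`-factors of the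
normalization are restored last, and only there are the poles of `Γ` excluded.
-/

noncomputable section

namespace TTW

/-! ### Derivations and multiplications on smooth functions -/

section Basic

variable {k : ℝ}

theorem Smooth.ext' {f g : Smooth k} (h : ∀ x, f.1 x = g.1 x) : f = g :=
  Subtype.ext (funext h)

theorem differentiableAt_extendZero (f : Smooth k) (x : domain k) :
    DifferentiableAt ℝ (extendZero f.1) x :=
  (ContDiffOn.contDiffAt f.2 ((isOpen_domain k).mem_nhds x.2)).differentiableAt (by simp)

theorem eventuallyEq_extendZero (x : domain k) {f : domain k → ℂ} {g : ℝ × ℝ → ℂ}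
    (h : ∀ y, f y = g y) : extendZero f =ᶠ[nhds x.1] g := by
  filter_upwards [(isOpen_domain k).mem_nhds x.2] with y hy
  rw [extendZero_apply _ hy, h]

theorem partialD_apply (v : ℝ × ℝ) (f : Smooth k) (x : domain k) :
    (partialD k v f).1 x = fderiv ℝ (extendZero f.1) x v := rfl

theorem partialD_mul (v : ℝ × ℝ) (f g : Smooth k) :
    partialD k v (f * g) = partialD k v f * g + f * partialD k v g := by
  apply Smooth.ext'
  intro x
  have he : extendZero ((f * g : Smooth k) : domain k → ℂ) =ᶠ[nhds x.1]
      extendZero f.1 * extendZero g.1 := by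
    filter_upwards [(isOpen_domain k).mem_nhds x.2] with y hy
    simp [extendZero_apply _ hy]
  change fderiv ℝ (extendZero ((f * g : Smooth k) : domain k → ℂ)) x v
    = fderiv ℝ (extendZero f.1) x v * g.1 x + f.1 x * fderiv ℝ (extendZero g.1) x v
  rw [he.fderiv_eq, fderiv_mul (differentiableAt_extendZero f x) (differentiableAt_extendZero g x)]
  simp only [add_apply, smul_apply, smul_eq_mul, extendZero_apply _ x.2]
  ring

/-- Partial derivatives can be read off from any extension of the function. -/
theorem partialD_eq_of_hasFDerivAt {v : ℝ × ℝ} {f : Smooth k} {g : ℝ × ℝ → ℂ} {x : domain k}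
    {L : ℝ × ℝ →L[ℝ] ℂ} (h : ∀ y, f.1 y = g y) (hg : HasFDerivAt g L x) :
    (partialD k v f).1 x = L v := by
  rw [partialD_apply, (eventuallyEq_extendZero x h).fderiv_eq, hg.fderiv]

/-- Symmetry of second derivatives. -/
theorem partialD_comm (v w : ℝ × ℝ) : partialD k v * partialD k w = partialD k w * partialD k v := by
  apply LinearMap.ext
  intro f
  apply Smooth.ext'
  intro x
  have hc : ContDiffAt ℝ ((⊤ : ℕ∞) : WithTop ℕ∞) (extendZero f.1) x :=
    ContDiffOn.contDiffAt f.2 ((isOpen_domain k).mem_nhds x.2)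
  have hd : DifferentiableAt ℝ (fderiv ℝ (extendZero f.1)) x :=
    (hc.fderiv_right (m := 1) (by exact WithTop.coe_le_coe.2 le_top)).differentiableAt (by simp)
  have key : ∀ u z : ℝ × ℝ, (partialD k u (partialD k z f)).1 x
      = fderiv ℝ (fderiv ℝ (extendZero f.1)) x u z := fun u z =>
    partialD_eq_of_hasFDerivAt (g := fun y => fderiv ℝ (extendZero f.1) y z)
      (fun _ => rfl) (hd.hasFDerivAt.clm_apply (hasFDerivAt_const z _)) |>.trans (by simp)
  have hs : IsSymmSndFDerivAt ℝ (extendZero f.1) x :=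
    hc.isSymmSndFDerivAt (by
      rw [minSmoothness_of_isRCLikeNormedField]
      exact WithTop.coe_le_coe.2 le_top)
  exact (key v w).trans ((hs v w).trans (key w v).symm)

theorem mulOp_apply (c f : Smooth k) : mulOp c f = c * f := rfl

theorem mulOp_mul (c c' : Smooth k) : mulOp (c * c') = mulOp c * mulOp c' := by
  ext1 f; simp only [Module.End.mul_apply, mulOp_apply, mul_assoc]

theorem mulOp_add (c c' : Smooth k) : mulOp (c + c') = mulOp c + mulOp c' := by
  ext1 f; simp only [LinearMap.add_apply, mulOp_apply, add_mul]

theorem mulOp_one : mulOp (1 : Smooth k) = 1 := by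
  ext1 f; simp only [Module.End.one_apply, mulOp_apply, one_mul]

theorem mulOp_smul (t : ℂ) (c : Smooth k) : mulOp (t • c) = t • mulOp c := by
  ext1 f; simp only [LinearMap.smul_apply, mulOp_apply, smul_mul_assoc]

/-- Multiplication operators, as an algebra homomorphism. -/
def mulHom (k : ℝ) : Smooth k →ₐ[ℂ] Op k := Algebra.lmul ℂ (Smooth k)

theorem mulOp_injective : Function.Injective (mulOp (k := k)) := by
  intro c c' h
  have := congrArg (fun T : Op k => T 1) h
  simpa [mulOp_apply] using this

theorem partialD_mul_mulOp (v : ℝ × ℝ) (c : Smooth k) :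
    partialD k v * mulOp c = mulOp c * partialD k v + mulOp (partialD k v c) := by
  ext1 f
  simp only [Module.End.mul_apply, LinearMap.add_apply, mulOp_apply, partialD_mul, add_comm]

/-! ### The coordinate functions -/

/-- The function `1 / r`. -/
def fInvR (k : ℝ) : Smooth k := invR k 1
/-- The function `r²`. -/
def fRSq (k : ℝ) : Smooth k := rSq k 1
/-- The function `1 / sin² (kθ)`. -/
def fInvSinSq (k : ℝ) : Smooth k := invSinSq k 1
/-- The function `1 / cos² (kθ)`. -/
def fInvCosSq (k : ℝ) : Smooth k := invCosSq k 1
/-- The function `cos (2kθ)`. -/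
def fCos (k : ℝ) : Smooth k := cosTwo k 1
/-- The function `sin (2kθ)`. -/
def fSin (k : ℝ) : Smooth k := sinTwo k 1

theorem fInvR_apply (x : domain k) : (fInvR k).1 x = ((x.1.1 : ℂ))⁻¹ :=
  mul_one (((x.1.1 : ℂ))⁻¹)
theorem fRSq_apply (x : domain k) : (fRSq k).1 x = (x.1.1 : ℂ) ^ 2 :=
  mul_one ((x.1.1 : ℂ) ^ 2)
theorem fInvSinSq_apply (x : domain k) :
    (fInvSinSq k).1 x = ((Real.sin (k * x.1.2) : ℂ) ^ 2)⁻¹ := mul_one _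
theorem fInvCosSq_apply (x : domain k) :
    (fInvCosSq k).1 x = ((Real.cos (k * x.1.2) : ℂ) ^ 2)⁻¹ := mul_one _
theorem fCos_apply (x : domain k) : (fCos k).1 x = (Real.cos (2 * k * x.1.2) : ℂ) := mul_one _
theorem fSin_apply (x : domain k) : (fSin k).1 x = (Real.sin (2 * k * x.1.2) : ℂ) := mul_one _

theorem mulOp_apply_one (c : Smooth k) : mulOp (mulOp c 1) = mulOp c := by
  rw [mulOp_apply, mul_one]

theorem invR_eq : invR k = mulOp (fInvR k) := (mulOp_apply_one _).symm
theorem rSq_eq : rSq k = mulOp (fRSq k) := (mulOp_apply_one _).symm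
theorem invSinSq_eq : invSinSq k = mulOp (fInvSinSq k) := (mulOp_apply_one _).symm
theorem invCosSq_eq : invCosSq k = mulOp (fInvCosSq k) := (mulOp_apply_one _).symm
theorem cosTwo_eq : cosTwo k = mulOp (fCos k) := (mulOp_apply_one _).symm
theorem sinTwo_eq : sinTwo k = mulOp (fSin k) := (mulOp_apply_one _).symm

/-- The partial derivatives of a function of `r` alone. -/
theorem partialD_of_radial {f : Smooth k} {g : ℝ → ℂ} {g' : ℂ} {x : domain k} (v : ℝ × ℝ)
    (h : ∀ y : domain k, f.1 y = g y.1.1) (hg : HasDerivAt g g' x.1.1) :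
    (partialD k v f).1 x = v.1 * g' := by
  have := hg.hasFDerivAt.comp x.1 (hasFDerivAt_fst (𝕜 := ℝ) (E := ℝ) (F := ℝ))
  rw [partialD_eq_of_hasFDerivAt (g := fun y => g y.1) h this]
  simp

/-- The partial derivatives of a function of `θ` alone. -/
theorem partialD_of_angular {f : Smooth k} {g : ℝ → ℂ} {g' : ℂ} {x : domain k} (v : ℝ × ℝ)
    (h : ∀ y : domain k, f.1 y = g y.1.2) (hg : HasDerivAt g g' x.1.2) :
    (partialD k v f).1 x = v.2 * g' := by
  have := hg.hasFDerivAt.comp x.1 (hasFDerivAt_snd (𝕜 := ℝ) (E := ℝ) (F := ℝ))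
  rw [partialD_eq_of_hasFDerivAt (g := fun y => g y.2) h this]
  simp

theorem dr_of_radial {f : Smooth k} {g : ℝ → ℂ} {g' : ℂ} {x : domain k}
    (h : ∀ y : domain k, f.1 y = g y.1.1) (hg : HasDerivAt g g' x.1.1) :
    (dr k f).1 x = g' := by
  simpa [dr] using partialD_of_radial (1, 0) h hg

theorem dθ_of_angular {f : Smooth k} {g : ℝ → ℂ} {g' : ℂ} {x : domain k}
    (h : ∀ y : domain k, f.1 y = g y.1.2) (hg : HasDerivAt g g' x.1.2) :
    (dθ k f).1 x = g' := by
  simpa [dθ] using partialD_of_angular (0, 1) h hg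

theorem dr_fInvR : dr k (fInvR k) = -(fInvR k) ^ 2 := by
  apply Smooth.ext'
  intro x
  have hx : (x.1.1 : ℂ) ≠ 0 := by exact_mod_cast x.2.1.ne'
  rw [dr_of_radial (g := fun r => (r : ℂ)⁻¹) fInvR_apply
    ((hasDerivAt_id x.1.1).ofReal_comp.fun_inv hx)]
  change _ = -((fInvR k).1 x ^ 2)
  rw [fInvR_apply]
  simp [div_eq_mul_inv]

theorem fInvR_sq_mul : fInvR k ^ 2 * fRSq k = 1 := by
  apply Smooth.ext'
  intro x
  have hx : (x.1.1 : ℂ) ≠ 0 := by exact_mod_cast x.2.1.ne'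
  change (fInvR k).1 x ^ 2 * (fRSq k).1 x = 1
  rw [fInvR_apply, fRSq_apply]
  field_simp

theorem dθ_fInvR : dθ k (fInvR k) = 0 := by
  apply Smooth.ext'
  intro x
  have hx : (x.1.1 : ℂ) ≠ 0 := by exact_mod_cast x.2.1.ne'
  have := partialD_of_radial (0, 1) (g := fun r => (r : ℂ)⁻¹) fInvR_apply
    ((hasDerivAt_id x.1.1).ofReal_comp.fun_inv hx)
  simpa [dr, dθ] using this

theorem dθ_fRSq : dθ k (fRSq k) = 0 := by
  apply Smooth.ext'
  intro x
  have := partialD_of_radial (0, 1) (g := fun r => (r : ℂ) ^ 2) fRSq_apply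
    ((hasDerivAt_id x.1.1).ofReal_comp.fun_pow 2)
  simpa [dr, dθ] using this

theorem dr_eq_zero_of_angular {f : Smooth k} {g : ℝ → ℂ}
    (h : ∀ y : domain k, f.1 y = g y.1.2) (hg : ∀ x : domain k, DifferentiableAt ℝ g x.1.2) :
    dr k f = 0 := by
  apply Smooth.ext'
  intro x
  have := partialD_of_angular (1, 0) h (hg x).hasDerivAt
  simpa [dr, dθ] using this

theorem hasDerivAt_sin_mul (k θ : ℝ) :
    HasDerivAt (fun t : ℝ => (Real.sin (k * t) : ℂ)) ((k : ℂ) * Real.cos (k * θ)) θ := by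
  have h := ((hasDerivAt_id θ).const_mul k).sin.ofReal_comp
  simpa [mul_comm] using h

theorem hasDerivAt_cos_mul (k θ : ℝ) :
    HasDerivAt (fun t : ℝ => (Real.cos (k * t) : ℂ)) (-((k : ℂ) * Real.sin (k * θ))) θ := by
  have h := ((hasDerivAt_id θ).const_mul k).cos.ofReal_comp
  simpa [mul_comm] using h

theorem dr_fCos : dr k (fCos k) = 0 :=
  dr_eq_zero_of_angular (g := fun t => (Real.cos (2 * k * t) : ℂ)) fCos_apply
    fun x => (hasDerivAt_cos_mul (2 * k) x.1.2).differentiableAt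

theorem dr_fSin : dr k (fSin k) = 0 :=
  dr_eq_zero_of_angular (g := fun t => (Real.sin (2 * k * t) : ℂ)) fSin_apply
    fun x => (hasDerivAt_sin_mul (2 * k) x.1.2).differentiableAt

theorem dr_fInvSinSq : dr k (fInvSinSq k) = 0 :=
  dr_eq_zero_of_angular (g := fun t => ((Real.sin (k * t) : ℂ) ^ 2)⁻¹) fInvSinSq_apply
    fun x => ((hasDerivAt_sin_mul k x.1.2).differentiableAt.pow 2).inv
      (pow_ne_zero 2 (Complex.ofReal_ne_zero.2 x.2.2.1))

theorem dr_fInvCosSq : dr k (fInvCosSq k) = 0 :=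
  dr_eq_zero_of_angular (g := fun t => ((Real.cos (k * t) : ℂ) ^ 2)⁻¹) fInvCosSq_apply
    fun x => ((hasDerivAt_cos_mul k x.1.2).differentiableAt.pow 2).inv
      (pow_ne_zero 2 (Complex.ofReal_ne_zero.2 x.2.2.2))

theorem dθ_fCos : dθ k (fCos k) = -((2 * (k : ℂ)) • fSin k) := by
  apply Smooth.ext'
  intro x
  rw [dθ_of_angular (g := fun t => (Real.cos (2 * k * t) : ℂ)) fCos_apply
    (hasDerivAt_cos_mul (2 * k) x.1.2)]
  change _ = -((2 * (k : ℂ)) * (fSin k).1 x)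
  rw [fSin_apply]
  push_cast
  rfl

theorem dθ_fSin : dθ k (fSin k) = (2 * (k : ℂ)) • fCos k := by
  apply Smooth.ext'
  intro x
  rw [dθ_of_angular (g := fun t => (Real.sin (2 * k * t) : ℂ)) fSin_apply
    (hasDerivAt_sin_mul (2 * k) x.1.2)]
  change _ = (2 * (k : ℂ)) * (fCos k).1 x
  rw [fCos_apply]
  push_cast
  rfl

theorem fSin_sq : fSin k ^ 2 = 1 - fCos k ^ 2 := by
  apply Smooth.ext'
  intro x
  change (fSin k).1 x ^ 2 = 1 - (fCos k).1 x ^ 2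
  rw [fSin_apply, fCos_apply]
  push_cast
  linear_combination Complex.sin_sq_add_cos_sq (2 * k * x.1.2 : ℂ)

theorem fInvSinSq_mul : fInvSinSq k * (1 - fCos k) = 2 := by
  apply Smooth.ext'
  intro x
  have h : (Real.sin (k * x.1.2) : ℂ) ≠ 0 := Complex.ofReal_ne_zero.2 x.2.2.1
  change (fInvSinSq k).1 x * (1 - (fCos k).1 x) = 2
  rw [fInvSinSq_apply, fCos_apply, mul_assoc 2 k, Real.cos_two_mul, inv_mul_eq_iff_eq_mul₀
    (pow_ne_zero 2 h)]
  push_cast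
  linear_combination (-2) * Complex.sin_sq_add_cos_sq (k * x.1.2 : ℂ)

theorem fInvCosSq_mul : fInvCosSq k * (1 + fCos k) = 2 := by
  apply Smooth.ext'
  intro x
  have h : (Real.cos (k * x.1.2) : ℂ) ≠ 0 := Complex.ofReal_ne_zero.2 x.2.2.2
  change (fInvCosSq k).1 x * (1 + (fCos k).1 x) = 2
  rw [fInvCosSq_apply, fCos_apply, mul_assoc 2 k, Real.cos_two_mul, inv_mul_eq_iff_eq_mul₀
    (pow_ne_zero 2 h)]
  push_cast
  ring

end Basic

end TTW

end

noncomputable section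

namespace TTW

/-! ### Ladder identities in an abstract ring -/

section Ladder

variable {U B : Type*} [CommRing U] [Ring B] [Algebra U B]

/-- The raising operator of Jacobi type, with `ν + 1 = 2s`. -/
def jacobiUp (d x : B) (c s : U) : B := (2 * s) • d - (s * (2 * s - 1)) • x - c • (1 : B)

/-- The raising operator of Laguerre type, with `ν + 1 = 2s` and `g = E / 4`. -/
def laguerreUp (D y : B) (g s : U) : B := (2 * s) • D - (s * (2 * s - 1)) • y - g • (1 : B)

/-- The angular second order operator; `n = ν² / 4`. For `d = (1 - x²) ∂_x` it is, up to a constant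
factor, `1 - x²` times the eigenvalue operator `L₂ + k² ν²`. -/
def angularOp (d x : B) (c v n : U) : B :=
  d * d + x * d - c • x + v • (1 : B) + n • (1 - x * x)

/-- The radial second order operator; `n = ν² / 4` and `o = ω² / 4`. -/
def radialOp (D y : B) (g o n : U) : B :=
  D * D + y * D - g • y - o • (1 : B) - n • (y * y)

variable {d x D y : B}

/-- The raising operator shifts `ν` by `2`, that is `s` by `1`: with `s = (ν + 1) / 2` the argument
`ν² / 4` of the second order operator is `s² - s + 1 / 4` before and `s² + s + 1 / 4` after. The
commutation relation is that of `d = (1 - x²) ∂_x` with `x`. -/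
theorem angularOp_mul_jacobiUp (hd : d * x = x * d + 1 - x * x) (c v s e : U)
    (he : 4 * e = 1) :
    angularOp d x c v (s ^ 2 + s + e) * jacobiUp d x c s
      = jacobiUp d x c s * angularOp d x c v (s ^ 2 - s + e) := by
  have hd' : ∀ t : B, d * (x * t) = x * (d * t) + t - x * (x * t) := fun t => by
    rw [← mul_assoc, hd]; noncomm_ring
  simp only [angularOp, jacobiUp, mul_add, add_mul, mul_sub, sub_mul, smul_mul_assoc,
    mul_smul_comm, mul_assoc, hd, hd', mul_one, one_mul, smul_add, smul_sub, smul_smul]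
  match_scalars <;> first | ring1 | linear_combination s * he | linear_combination -s * he

/-- Lowering after raising, `ν ↦ ν + 2 ↦ ν`; the lowering operator at `ν + 2` is the raising operator
with parameter `-s`. -/
theorem jacobiUp_mul_jacobiUp (hd : d * x = x * d + 1 - x * x) (c v s e : U) (he : 4 * e = 1) :
    jacobiUp d x c (-s) * jacobiUp d x c s
      = (4 * s ^ 4 + (4 * v - 1) * s ^ 2 + c ^ 2) • (1 : B)
        - (4 * s ^ 2) • angularOp d x c v (s ^ 2 - s + e) := by
  have hd' : ∀ t : B, d * (x * t) = x * (d * t) + t - x * (x * t) := fun t => by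
    rw [← mul_assoc, hd]; noncomm_ring
  simp only [angularOp, jacobiUp, mul_add, mul_sub, sub_mul, smul_mul_assoc,
    mul_smul_comm, mul_assoc, hd, mul_one, one_mul, smul_add, smul_sub, smul_smul]
  match_scalars <;> first | ring1 | linear_combination s ^ 2 * he | linear_combination -s ^ 2 * he

/-- The radial counterpart of `angularOp_mul_jacobiUp`; the commutation relation is that of `∂_R`
with `y = 1 / R`. -/
theorem radialOp_mul_laguerreUp (hD : D * y = y * D - y * y) (g o s e : U)
    (he : 4 * e = 1) :
    radialOp D y g o (s ^ 2 + s + e) * laguerreUp D y g s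
      = laguerreUp D y g s * radialOp D y g o (s ^ 2 - s + e) := by
  have hD' : ∀ t : B, D * (y * t) = y * (D * t) - y * (y * t) := fun t => by
    rw [← mul_assoc, hD]; noncomm_ring
  simp only [radialOp, laguerreUp, mul_add, add_mul, mul_sub, sub_mul, smul_mul_assoc,
    mul_smul_comm, mul_assoc, hD, hD', mul_one, one_mul, smul_add, smul_sub, smul_smul]
  match_scalars <;> first | ring1 | linear_combination s * he | linear_combination -s * he

/-- The radial counterpart of `jacobiUp_mul_jacobiUp`. -/
theorem laguerreUp_mul_laguerreUp (hD : D * y = y * D - y * y) (g o s e : U) (he : 4 * e = 1) :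
    laguerreUp D y g (-s) * laguerreUp D y g s
      = (g ^ 2 - 4 * s ^ 2 * o) • (1 : B)
        - (4 * s ^ 2) • radialOp D y g o (s ^ 2 - s + e) := by
  have hD' : ∀ t : B, D * (y * t) = y * (D * t) - y * (y * t) := fun t => by
    rw [← mul_assoc, hD]; noncomm_ring
  simp only [radialOp, laguerreUp, mul_add, mul_sub, sub_mul, smul_mul_assoc,
    mul_smul_comm, mul_assoc, hD, mul_one, one_mul, smul_add, smul_sub, smul_smul]
  match_scalars <;> first | ring1 | linear_combination s ^ 2 * he | linear_combination -s ^ 2 * he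

end Ladder

end TTW

end

noncomputable section

namespace TTW

/-! ### Chains of raising operators -/

section Chain

variable {U B : Type*} [CommRing U] [Ring B]

/-- The product `J (s + n - 1) ⋯ J (s + 1) J s`. -/
def upChain (J : U → B) : ℕ → U → B
  | 0, _ => 1
  | n + 1, s => J (s + n) * upChain J n s

@[simp] theorem upChain_zero (J : U → B) (s : U) : upChain J 0 s = 1 := rfl

theorem upChain_succ (J : U → B) (n : ℕ) (s : U) :
    upChain J (n + 1) s = J (s + n) * upChain J n s := rfl

theorem upChain_succ' (J : U → B) (n : ℕ) (s : U) :
    upChain J (n + 1) s = upChain J n (s + 1) * J s := by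
  induction n with
  | zero => simp [upChain_succ]
  | succ n ih =>
    rw [upChain_succ, ih, upChain_succ, ← mul_assoc]
    congr 3
    push_cast
    ring

theorem upChain_mem {J : U → B} {S : Subring B} (hJ : ∀ s, J s ∈ S) (n : ℕ) (s : U) :
    upChain J n s ∈ S := by
  induction n with
  | zero => exact S.one_mem
  | succ n ih => exact S.mul_mem (hJ _) ih

theorem commute_upChain {J : U → B} {T : B} (hJ : ∀ s, Commute T (J s)) (n : ℕ) (s : U) :
    Commute T (upChain J n s) := by
  induction n with
  | zero => exact Commute.one_right T
  | succ n ih => exact (hJ _).mul_right ih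

variable [Algebra U B] (J G : U → B) (c : U → U)

/-- A factorization ladder: `J s` intertwines `G s` with `G (s + 1)`, and `J (-s) J s` is the
scalar `c s` up to a multiple of `G s`. -/
structure IsLadder : Prop where
  intertwine : ∀ s, G (s + 1) * J s = J s * G s
  factor : ∀ s, J (-s) * J s = c s • (1 : B) - (4 * s ^ 2) • G s

variable {J G c}

theorem IsLadder.intertwine_chain (h : IsLadder J G c) (n : ℕ) (s : U) :
    G (s + n) * upChain J n s = upChain J n s * G s := by
  induction n with
  | zero => simp
  | succ n ih =>
    rw [upChain_succ, mul_assoc, ← ih, ← mul_assoc, ← mul_assoc, ← h.intertwine]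
    congr 3
    push_cast
    ring

theorem smul_mem_of_algebraMap_mem {S : Subring B} (hU : ∀ u : U, algebraMap U B u ∈ S) (u : U)
    {F : B} (hF : F ∈ S) : u • F ∈ S := by
  rw [Algebra.smul_def]
  exact S.mul_mem (hU u) hF

/-- A chain of raising operators followed by the opposite chain acts on the kernel of `G s` as a
scalar: the product telescopes from its middle outwards. -/
theorem IsLadder.factor_chain (h : IsLadder J G c) {S : Subring B}
    (hU : ∀ u : U, algebraMap U B u ∈ S) (hJ : ∀ s, J s ∈ S) (n : ℕ) (s : U) :
    ∃ X ∈ S, upChain J n (-(s + n - 1)) * upChain J n s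
      = (∏ j ∈ Finset.range n, c (s + j)) • (1 : B) + X * G s := by
  induction n with
  | zero => exact ⟨0, S.zero_mem, by simp⟩
  | succ n ih =>
    obtain ⟨X, hX, hXe⟩ := ih
    refine ⟨c (s + n) • X - upChain J n (-(s + n - 1)) * ((4 * (s + n) ^ 2) • upChain J n s),
      S.sub_mem (smul_mem_of_algebraMap_mem hU _ hX) (S.mul_mem (upChain_mem hJ _ _)
        (smul_mem_of_algebraMap_mem hU _ (upChain_mem hJ _ _))), ?_⟩
    have e1 : upChain J (n + 1) (-(s + (n + 1 : ℕ) - 1))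
        = upChain J n (-(s + n - 1)) * J (-(s + n)) := by
      rw [upChain_succ']
      congr 2 <;> push_cast <;> ring
    calc upChain J (n + 1) (-(s + (n + 1 : ℕ) - 1)) * upChain J (n + 1) s
        = upChain J n (-(s + n - 1)) * (J (-(s + n)) * J (s + n)) * upChain J n s := by
          rw [e1, upChain_succ]; noncomm_ring
      _ = c (s + n) • (upChain J n (-(s + n - 1)) * upChain J n s)
          - upChain J n (-(s + n - 1)) * ((4 * (s + n) ^ 2) • (G (s + n) * upChain J n s)) := by
          rw [h.factor]
          simp only [mul_sub, sub_mul, mul_smul_comm, smul_mul_assoc, mul_one, mul_assoc]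
      _ = _ := by
          rw [hXe, h.intertwine_chain, Finset.prod_range_succ, mul_comm _ (c (s + n))]
          simp only [smul_add, sub_mul, smul_mul_assoc, mul_assoc, mul_smul]
          abel

/-- The value of a chain of `n` raising operators that is symmetric under `s ↦ -s`, where `z` is the
value of the middle factor `J 0` of a chain of odd length and `h = 1 / 2`. -/
def selfScalar (c : U → U) (z h : U) : ℕ → U
  | 0 => 1
  | 1 => z
  | n + 2 => c (-(h * (n + 1))) * selfScalar c z h n

/-- A chain that starts at `s = (1 - n) / 2` is symmetric under `s ↦ -s`, and therefore acts on the
kernel of `G s` as a scalar: its outermost factors are `J (-s)` and `J s`. -/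
theorem IsLadder.self_chain (h : IsLadder J G c) {S : Subring B}
    (hU : ∀ u : U, algebraMap U B u ∈ S) (hJ : ∀ s, J s ∈ S) {η z : U} (hη : 2 * η = 1)
    (hz : J 0 = z • (1 : B)) (n : ℕ) :
    ∃ X ∈ S, upChain J n (η * (1 - n)) = selfScalar c z η n • (1 : B) + X * G (η * (1 - n)) := by
  induction n using Nat.strong_induction_on with
  | _ n ih =>
    match n with
    | 0 => exact ⟨0, S.zero_mem, by simp [selfScalar]⟩
    | 1 => exact ⟨0, S.zero_mem, by simp [selfScalar, upChain_succ, hz]⟩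
    | n + 2 =>
      obtain ⟨X, hX, hXe⟩ := ih n (by omega)
      set s : U := η * (1 - (n + 2 : ℕ)) with hs
      have e1 : s + 1 = η * (1 - n) := by
        rw [hs]; push_cast; linear_combination -hη
      have e2 : s + (n + 1 : ℕ) = -s := by
        rw [hs]; push_cast; linear_combination (-1 - n) * hη
      have e3 : s = -(η * (n + 1)) := by rw [hs]; push_cast; ring
      refine ⟨J (-s) * X * J s - selfScalar c z η n • ((4 * s ^ 2) • (1 : B)),
        S.sub_mem (S.mul_mem (S.mul_mem (hJ _) hX) (hJ _)) (smul_mem_of_algebraMap_mem hU _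
          (smul_mem_of_algebraMap_mem hU _ S.one_mem)), ?_⟩
      calc upChain J (n + 2) s
          = J (-s) * upChain J n (s + 1) * J s := by
            rw [upChain_succ, upChain_succ', e2, mul_assoc]
        _ = selfScalar c z η n • (J (-s) * J s) + J (-s) * X * (G (s + 1) * J s) := by
            rw [e1, hXe]
            simp only [mul_add, add_mul, mul_smul_comm, smul_mul_assoc, mul_one, mul_assoc]
        _ = _ := by
            rw [h.factor, h.intertwine, selfScalar, ← e3, mul_comm (c s)]
            simp only [smul_sub, sub_mul, smul_mul_assoc, mul_assoc, one_mul, mul_smul]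
            abel

end Chain

section TwoLadders

variable {U B : Type*} [CommRing U] [Ring B] [Algebra U B] {J G K N : U → B} {c e : U → U}
  {S : Subring B}

/-- Two commuting ladders: the product of both chains with the opposite chains. -/
theorem IsLadder.factor_two_chains (hJ : IsLadder J G c) (hK : IsLadder K N e)
    (hU : ∀ u : U, algebraMap U B u ∈ S) (hJS : ∀ s, J s ∈ S) (hKS : ∀ s, K s ∈ S)
    (hJK : ∀ s t, Commute (J s) (K t)) (hJN : ∀ s t, Commute (N t) (J s)) (m n : ℕ) (s t : U) :
    ∃ X ∈ S, ∃ Y ∈ S, upChain K n (-(t + n - 1)) * upChain J m (-(s + m - 1))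
        * (upChain K n t * upChain J m s)
      = ((∏ j ∈ Finset.range n, e (t + j)) * ∏ j ∈ Finset.range m, c (s + j)) • (1 : B)
        + X * G s + Y * N t := by
  obtain ⟨X, hX, hXe⟩ := hJ.factor_chain hU hJS m s
  obtain ⟨Y, hY, hYe⟩ := hK.factor_chain hU hKS n t
  have hc : Commute (upChain J m (-(s + m - 1))) (upChain K n t) :=
    commute_upChain (fun t => (commute_upChain (fun s => (hJK s t).symm) _ _).symm) _ _
  have hN : Commute (N t) (upChain J m (-(s + m - 1)) * upChain J m s) :=
    (commute_upChain (fun s => hJN s t) _ _).mul_right (commute_upChain (fun s => hJN s t) _ _)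
  refine ⟨(∏ j ∈ Finset.range n, e (t + j)) • X, smul_mem_of_algebraMap_mem hU _ hX,
    Y * (upChain J m (-(s + m - 1)) * upChain J m s),
    S.mul_mem hY (S.mul_mem (upChain_mem hJS _ _) (upChain_mem hJS _ _)), ?_⟩
  calc _ = (upChain K n (-(t + n - 1)) * upChain K n t)
        * (upChain J m (-(s + m - 1)) * upChain J m s) := by
        rw [mul_assoc, ← mul_assoc (upChain J m _) (upChain K n _), hc.eq]
        simp only [mul_assoc]
    _ = (∏ j ∈ Finset.range n, e (t + j)) • (upChain J m (-(s + m - 1)) * upChain J m s)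
        + Y * (N t * (upChain J m (-(s + m - 1)) * upChain J m s)) := by
        rw [hYe, add_mul, smul_mul_assoc, one_mul, mul_assoc]
    _ = _ := by
        rw [hN.eq]
        nth_rewrite 1 [hXe]
        simp only [smul_add, mul_smul, smul_mul_assoc, mul_assoc]

/-- Two commuting ladders: the product of both symmetric chains. -/
theorem IsLadder.self_two_chains (hJ : IsLadder J G c) (hK : IsLadder K N e)
    (hU : ∀ u : U, algebraMap U B u ∈ S) (hJS : ∀ s, J s ∈ S) (hKS : ∀ s, K s ∈ S)
    (hJN : ∀ s t, Commute (N t) (J s)) {η z w : U} (hη : 2 * η = 1)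
    (hz : J 0 = z • (1 : B)) (hw : K 0 = w • (1 : B)) (m n : ℕ) :
    ∃ X ∈ S, ∃ Y ∈ S, upChain K n (η * (1 - n)) * upChain J m (η * (1 - m))
      = (selfScalar e w η n * selfScalar c z η m) • (1 : B)
        + X * G (η * (1 - m)) + Y * N (η * (1 - n)) := by
  obtain ⟨X, hX, hXe⟩ := hJ.self_chain hU hJS hη hz m
  obtain ⟨Y, hY, hYe⟩ := hK.self_chain hU hKS hη hw n
  have hN : Commute (N (η * (1 - n))) (upChain J m (η * (1 - m))) :=
    commute_upChain (fun s => hJN s _) _ _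
  refine ⟨selfScalar e w η n • X, smul_mem_of_algebraMap_mem hU _ hX,
    Y * upChain J m (η * (1 - m)), S.mul_mem hY (upChain_mem hJS _ _), ?_⟩
  calc _ = selfScalar e w η n • upChain J m (η * (1 - m))
        + Y * (N (η * (1 - n)) * upChain J m (η * (1 - m))) := by
        rw [hYe, add_mul, smul_mul_assoc, one_mul, mul_assoc]
    _ = _ := by
        rw [hN.eq]
        nth_rewrite 1 [hXe]
        rw [smul_add, mul_smul, smul_mul_assoc, mul_assoc]

end TwoLadders

end TTW

end

noncomputable section

namespace TTW

/-! ### Operator polynomials as an algebra over the polynomials in `μ` and `E` -/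

section Central

theorem commute_map_polynomial {R S : Type*} [Semiring R] [Semiring S] (f : R →+* S)
    (hf : ∀ r s, Commute (f r) s) (p : Polynomial R) (q : Polynomial S) :
    Commute (p.map f) q := by
  ext n
  rw [Polynomial.coeff_mul, Polynomial.coeff_mul, ← Finset.Nat.sum_antidiagonal_swap]
  refine Finset.sum_congr rfl fun x _ => ?_
  simp only [Prod.fst_swap, Prod.snd_swap, Polynomial.coeff_map]
  exact hf _ _

/-- Complex polynomials in the central indeterminates `μ` (inner) and `E` (outer). -/
abbrev Cen : Type := Polynomial (Polynomial ℂ)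

variable {k : ℝ}

/-- Scalar polynomials as operator polynomials. -/
def cenHom (k : ℝ) : Cen →+* OpPoly k :=
  Polynomial.mapRingHom (Polynomial.mapRingHom (algebraMap ℂ (Op k)))

theorem commute_mapOp (p : Polynomial ℂ) (q : Polynomial (Op k)) :
    Commute (Polynomial.mapRingHom (algebraMap ℂ (Op k)) p) q :=
  commute_map_polynomial (algebraMap ℂ (Op k)) (fun c T => Algebra.commutes c T) p q

theorem commute_cenHom (u : Cen) (F : OpPoly k) : Commute (cenHom k u) F :=
  commute_map_polynomial (Polynomial.mapRingHom (algebraMap ℂ (Op k))) commute_mapOp u F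

/-- Scalar polynomials act by multiplication; they are central. -/
instance instAlgebraCen (k : ℝ) : Algebra Cen (OpPoly k) :=
  (cenHom k).toAlgebra' commute_cenHom

theorem algebraMap_cen (u : Cen) : algebraMap Cen (OpPoly k) u = cenHom k u := rfl

/-- A complex number as a scalar polynomial. -/
def cU (c : ℂ) : Cen := Polynomial.C (Polynomial.C c)

/-- Complex numbers as scalar polynomials. -/
def cUHom : ℂ →+* Cen := Polynomial.C.comp Polynomial.C

theorem cU_eq (c : ℂ) : cU c = cUHom c := rfl

/-- The indeterminate `μ` among the scalar polynomials. -/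
def muU : Cen := Polynomial.C Polynomial.X

/-- The indeterminate `E` among the scalar polynomials. -/
def eU : Cen := Polynomial.X

theorem cenHom_muU : cenHom k muU = muVar k := by
  simp [cenHom, muU, muVar]

theorem cenHom_eU : cenHom k eU = eVar k := by
  simp [cenHom, eU, eVar]

/-- Operators as constant operator polynomials. -/
def constHom (k : ℝ) : Op k →+* OpPoly k := Polynomial.C.comp Polynomial.C

theorem constOp_eq (T : Op k) : constOp T = constHom k T := rfl

/-- The scalar action of `ℂ` through `Cen` is the original one. -/
theorem cU_smul (c : ℂ) (F : OpPoly k) : cU c • F = c • F := by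
  rw [Algebra.smul_def, algebraMap_cen]
  ext i j
  simp [cenHom, cU]

theorem constHom_smul (c : ℂ) (T : Op k) : constHom k (c • T) = cU c • constHom k T := by
  rw [cU_smul]
  ext i j
  simp only [constHom, RingHom.comp_apply, Polynomial.coeff_C, Polynomial.coeff_smul]
  split_ifs
  · simp only [Polynomial.coeff_C]
    split_ifs <;> simp
  · simp

end Central

end TTW

end

noncomputable section

namespace TTW

/-! ### The basic operators and their commutation relations -/

section Relations

variable {k : ℝ}

theorem dr_mul_mulOp (c : Smooth k) : dr k * mulOp c = mulOp c * dr k + mulOp (dr k c) :=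
  partialD_mul_mulOp (1, 0) c

theorem dθ_mul_mulOp (c : Smooth k) : dθ k * mulOp c = mulOp c * dθ k + mulOp (dθ k c) :=
  partialD_mul_mulOp (0, 1) c

theorem mulOp_zero : mulOp (0 : Smooth k) = 0 := map_zero (mulHom k)

theorem mulOp_neg (c : Smooth k) : mulOp (-c) = -mulOp c := map_neg (mulHom k) c

theorem mulOp_sub (c c' : Smooth k) : mulOp (c - c') = mulOp c - mulOp c' := map_sub (mulHom k) c c'

theorem mulOp_pow (c : Smooth k) (n : ℕ) : mulOp (c ^ n) = mulOp c ^ n := map_pow (mulHom k) c n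

theorem commute_mulOp (c c' : Smooth k) : Commute (mulOp c) (mulOp c') := by
  rw [Commute, SemiconjBy, ← mulOp_mul, ← mulOp_mul, mul_comm]

theorem commute_dr_dθ : Commute (dr k) (dθ k) := partialD_comm _ _

theorem commute_dr_mulOp {c : Smooth k} (h : dr k c = 0) : Commute (dr k) (mulOp c) := by
  rw [Commute, SemiconjBy, dr_mul_mulOp, h, mulOp_zero, add_zero]

theorem commute_dθ_mulOp {c : Smooth k} (h : dθ k c = 0) : Commute (dθ k) (mulOp c) := by
  rw [Commute, SemiconjBy, dθ_mul_mulOp, h, mulOp_zero, add_zero]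

/-- An operator in the angular variable: it commutes with `∂_r` and with functions of `r`. -/
def IsAngular (T : Op k) : Prop :=
  Commute T (dr k) ∧ Commute T (invR k) ∧ Commute T (rSq k)

theorem IsAngular.mul {S T : Op k} (hS : IsAngular S) (hT : IsAngular T) : IsAngular (S * T) :=
  ⟨hS.1.mul_left hT.1, hS.2.1.mul_left hT.2.1, hS.2.2.mul_left hT.2.2⟩

theorem IsAngular.add {S T : Op k} (hS : IsAngular S) (hT : IsAngular T) : IsAngular (S + T) :=
  ⟨hS.1.add_left hT.1, hS.2.1.add_left hT.2.1, hS.2.2.add_left hT.2.2⟩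

theorem IsAngular.smul {T : Op k} (c : ℂ) (hT : IsAngular T) : IsAngular (c • T) :=
  ⟨hT.1.smul_left c, hT.2.1.smul_left c, hT.2.2.smul_left c⟩

theorem IsAngular.neg {T : Op k} (hT : IsAngular T) : IsAngular (-T) :=
  ⟨hT.1.neg_left, hT.2.1.neg_left, hT.2.2.neg_left⟩

theorem isAngular_mulOp {c : Smooth k} (h : dr k c = 0) : IsAngular (mulOp c) :=
  ⟨(commute_dr_mulOp h).symm, by rw [invR_eq]; exact commute_mulOp _ _,
    by rw [rSq_eq]; exact commute_mulOp _ _⟩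

theorem isAngular_dθ : IsAngular (dθ k) :=
  ⟨commute_dr_dθ.symm, by rw [invR_eq]; exact commute_dθ_mulOp dθ_fInvR,
    by rw [rSq_eq]; exact commute_dθ_mulOp dθ_fRSq⟩

theorem isAngular_cosTwo : IsAngular (cosTwo k) := cosTwo_eq ▸ isAngular_mulOp dr_fCos

theorem isAngular_dX : IsAngular (dX k) :=
  (((sinTwo_eq ▸ isAngular_mulOp dr_fSin : IsAngular (sinTwo k)).mul isAngular_dθ).smul _).neg

theorem isAngular_L2 (a b : ℂ) : IsAngular (L2 k a b) := by
  unfold L2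
  rw [pow_two]
  exact ((isAngular_dθ.mul isAngular_dθ).add
    ((invSinSq_eq ▸ isAngular_mulOp dr_fInvSinSq : IsAngular (invSinSq k)).smul _)).add
    ((invCosSq_eq ▸ isAngular_mulOp dr_fInvCosSq : IsAngular (invCosSq k)).smul _)

theorem IsAngular.commute_dR {T : Op k} (h : IsAngular T) : Commute T (dR k) :=
  (h.2.1.mul_right h.1).smul_right _

theorem commute_H_L2 (ω a b : ℂ) : Commute (H k ω a b) (L2 k a b) := by
  have h := isAngular_L2 (k := k) a b
  have e : H k ω a b = dr k ^ 2 + invR k * dr k - ω ^ 2 • rSq k + invR k ^ 2 * L2 k a b := by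
    unfold H L2
    noncomm_ring
  rw [e]
  exact (((((h.1.pow_right 2).add_right (h.2.1.mul_right h.1)).sub_right
    (h.2.2.smul_right _)).add_right ((h.2.1.pow_right 2).mul_right (Commute.refl _)))).symm

theorem dr_mul_invR : dr k * invR k = invR k * dr k - invR k * invR k := by
  rw [invR_eq, dr_mul_mulOp, dr_fInvR, mulOp_neg, mulOp_pow, pow_two, sub_eq_add_neg]

theorem rSq_mul_invR_sq : rSq k * (invR k * invR k) = 1 := by
  rw [invR_eq, rSq_eq, ← mulOp_mul, ← mulOp_mul, ← mulOp_one, ← fInvR_sq_mul]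
  congr 1
  ring

theorem dR_mul_invR_sq : dR k * invR k ^ 2
    = invR k ^ 2 * dR k - invR k ^ 2 * invR k ^ 2 := by
  have h := dr_mul_invR (k := k)
  have h' : ∀ t : Op k, dr k * (invR k * t) = invR k * (dr k * t) - invR k * (invR k * t) :=
    fun t => by rw [← mul_assoc, h]; noncomm_ring
  simp only [dR, pow_two, smul_mul_assoc, mul_smul_comm, mul_assoc, h, h', mul_sub]
  module

theorem radial_part_eq : dr k ^ 2 + invR k * dr k
    = (4 : ℂ) • (rSq k * (dR k * dR k + invR k ^ 2 * dR k)) := by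
  have h := dr_mul_invR (k := k)
  have h' : ∀ t : Op k, dr k * (invR k * t) = invR k * (dr k * t) - invR k * (invR k * t) :=
    fun t => by rw [← mul_assoc, h]; noncomm_ring
  have hq : ∀ t : Op k, rSq k * (invR k * (invR k * t)) = t := fun t => by
    rw [← mul_assoc (invR k), ← mul_assoc, rSq_mul_invR_sq, one_mul]
  simp only [dR, pow_two, smul_mul_assoc, mul_smul_comm, mul_assoc, h', mul_sub, mul_add, smul_add,
    smul_sub, hq, smul_smul]
  module

/-- `H` in terms of `∂_R` and `L₂`. -/
theorem H_eq (ω a b : ℂ) : H k ω a b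
    = (4 : ℂ) • (rSq k * (dR k * dR k + invR k ^ 2 * dR k - (ω ^ 2 / 4) • (1 : Op k)))
      + invR k ^ 2 * L2 k a b := by
  have e : H k ω a b = (dr k ^ 2 + invR k * dr k) - ω ^ 2 • rSq k + invR k ^ 2 * L2 k a b := by
    unfold H L2
    noncomm_ring
  rw [e, radial_part_eq, mul_sub, smul_sub, mul_smul_comm, mul_one, smul_smul]
  congr 4
  ring

theorem sinTwo_mul_self : sinTwo k * sinTwo k = 1 - cosTwo k * cosTwo k := by
  rw [sinTwo_eq, cosTwo_eq, ← mulOp_mul, ← mulOp_mul, ← mulOp_one, ← mulOp_sub]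
  congr 1
  linear_combination fSin_sq (k := k)

theorem dθ_mul_cosTwo : dθ k * cosTwo k = cosTwo k * dθ k - (2 * (k : ℂ)) • sinTwo k := by
  rw [cosTwo_eq, sinTwo_eq, dθ_mul_mulOp, dθ_fCos, mulOp_neg, mulOp_smul, sub_eq_add_neg]

theorem dθ_mul_sinTwo : dθ k * sinTwo k = sinTwo k * dθ k + (2 * (k : ℂ)) • cosTwo k := by
  rw [cosTwo_eq, sinTwo_eq, dθ_mul_mulOp, dθ_fSin, mulOp_smul]

theorem sinTwo_mul_cosTwo : sinTwo k * cosTwo k = cosTwo k * sinTwo k := by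
  rw [cosTwo_eq, sinTwo_eq]
  exact commute_mulOp _ _

theorem dX_mul_cosTwo (hk : k ≠ 0) :
    dX k * cosTwo k = cosTwo k * dX k + 1 - cosTwo k * cosTwo k := by
  have hk' : (k : ℂ) ≠ 0 := Complex.ofReal_ne_zero.2 hk
  rw [add_sub_assoc, ← sinTwo_mul_self]
  simp only [dX, neg_mul, smul_mul_assoc, mul_assoc, dθ_mul_cosTwo, mul_sub, mul_smul_comm,
    mul_neg, smul_sub, smul_smul]
  rw [← mul_assoc (sinTwo k), ← mul_assoc (cosTwo k), sinTwo_mul_cosTwo]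
  match_scalars <;> field_simp

/-- Multiplication by `1 / sin² (2kθ)`. -/
def wOp (k : ℝ) : Op k := mulOp ((1 / 4 : ℂ) • (fInvSinSq k * fInvCosSq k))

theorem fInv_prod : (fInvSinSq k * fInvCosSq k) * (1 - fCos k ^ 2) = 4 := by
  linear_combination (fInvCosSq k * (1 + fCos k)) * fInvSinSq_mul (k := k)
    + 2 * fInvCosSq_mul (k := k)

theorem wOp_mul : wOp k * (1 - cosTwo k * cosTwo k) = 1 := by
  rw [wOp, cosTwo_eq, ← mulOp_mul, ← mulOp_one, ← mulOp_sub, ← mulOp_mul]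
  congr 1
  rw [smul_mul_assoc, ← pow_two, fInv_prod]
  apply Smooth.ext'
  intro x
  change (1 / 4 : ℂ) * (4 : ℂ) = 1
  norm_num

theorem one_sub_mul_wOp : (1 - cosTwo k * cosTwo k) * wOp k = 1 := by
  have h : Commute (wOp k) (1 - cosTwo k * cosTwo k) := by
    rw [wOp, cosTwo_eq]
    exact (Commute.one_right _).sub_right ((commute_mulOp _ (fCos k)).mul_right (commute_mulOp _ (fCos k)))
  rw [← h.eq, wOp_mul]

theorem wOp_mul_one_sub : wOp k * (1 - cosTwo k) = (1 / 2 : ℂ) • invCosSq k := by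
  rw [wOp, cosTwo_eq, invCosSq_eq, ← mulOp_one, ← mulOp_sub, ← mulOp_mul, ← mulOp_smul]
  congr 1
  have : fInvSinSq k * fInvCosSq k * (1 - fCos k) = (2 : ℂ) • fInvCosSq k := by
    rw [ofNat_smul_eq_nsmul ℂ 2, nsmul_eq_mul]
    push_cast
    linear_combination fInvCosSq k * fInvSinSq_mul (k := k)
  rw [smul_mul_assoc, this, smul_smul]
  norm_num

theorem wOp_mul_one_add : wOp k * (1 + cosTwo k) = (1 / 2 : ℂ) • invSinSq k := by
  rw [wOp, cosTwo_eq, invSinSq_eq, ← mulOp_one, ← mulOp_add, ← mulOp_mul, ← mulOp_smul]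
  congr 1
  have : fInvSinSq k * fInvCosSq k * (1 + fCos k) = (2 : ℂ) • fInvSinSq k := by
    rw [ofNat_smul_eq_nsmul ℂ 2, nsmul_eq_mul]
    push_cast
    linear_combination fInvSinSq k * fInvCosSq_mul (k := k)
  rw [smul_mul_assoc, this, smul_smul]
  norm_num

theorem dX_sq_add (hk : k ≠ 0) : (4 * (k : ℂ) ^ 2) • (dX k * dX k + cosTwo k * dX k)
    = (1 - cosTwo k * cosTwo k) * dθ k ^ 2 := by
  have hk' : (k : ℂ) ≠ 0 := Complex.ofReal_ne_zero.2 hk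
  have h' : ∀ t : Op k, dθ k * (sinTwo k * t)
      = sinTwo k * (dθ k * t) + (2 * (k : ℂ)) • (cosTwo k * t) :=
    fun t => by rw [← mul_assoc, dθ_mul_sinTwo, add_mul, smul_mul_assoc, mul_assoc]
  have h2 : sinTwo k * (cosTwo k * dθ k) = cosTwo k * (sinTwo k * dθ k) := by
    rw [← mul_assoc, sinTwo_mul_cosTwo, mul_assoc]
  rw [← sinTwo_mul_self]
  simp only [dX, pow_two, neg_mul, mul_neg, neg_neg, smul_mul_assoc, mul_smul_comm, mul_assoc, h',
    mul_add, smul_add, smul_smul, h2, smul_neg]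
  match_scalars <;> field_simp <;> ring

/-- `L₂` in terms of `x = cos 2kθ` and `(1 - x²) ∂_x`. -/
theorem L2_eq (hk : k ≠ 0) (a b : ℂ) : L2 k a b
    = (4 * (k : ℂ) ^ 2) • (wOp k * (dX k * dX k + cosTwo k * dX k
      - ((a ^ 2 - b ^ 2) / 2) • cosTwo k + ((1 / 2 - a ^ 2 - b ^ 2) / 2) • (1 : Op k))) := by
  have e1 : dθ k ^ 2 = (4 * (k : ℂ) ^ 2) • (wOp k * (dX k * dX k + cosTwo k * dX k)) := by
    rw [← mul_smul_comm, dX_sq_add hk, ← mul_assoc, wOp_mul, one_mul]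
  have e2 : invSinSq k = (2 : ℂ) • (wOp k + wOp k * cosTwo k) := by
    rw [← mul_one_add, wOp_mul_one_add, smul_smul]; norm_num
  have e3 : invCosSq k = (2 : ℂ) • (wOp k - wOp k * cosTwo k) := by
    rw [← mul_one_sub, wOp_mul_one_sub, smul_smul]; norm_num
  rw [L2, e1, e2, e3, coupling, coupling]
  simp only [mul_add, mul_sub, mul_smul_comm, mul_one]
  module

end Relations

end TTW

end

noncomputable section

namespace TTW

/-! ### Differential operators and their symbols -/

section DiffOp

variable {k : ℝ}

theorem orderLE_monomial (f : Smooth k) {i j N : ℕ} (h : i + j ≤ N) :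
    OrderLE N (mulOp f * dr k ^ i * dθ k ^ j) := by
  refine ⟨fun i' j' => if i' = i ∧ j' = j then f else 0, ?_⟩
  rw [Finset.sum_eq_single i, Finset.sum_eq_single j]
  · simp
  · intro j' _ hj'
    simp [hj', mulOp_zero]
  · intro hj
    exact absurd (Finset.mem_range.2 (by omega)) hj
  · intro i' _ hi'
    exact Finset.sum_eq_zero fun j' _ => by simp [hi', mulOp_zero]
  · intro hi
    exact absurd (Finset.mem_range.2 (by omega)) hi

theorem OrderLE.add {N : ℕ} {S T : Op k} (hS : OrderLE N S) (hT : OrderLE N T) :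
    OrderLE N (S + T) := by
  obtain ⟨c, rfl⟩ := hS
  obtain ⟨c', rfl⟩ := hT
  refine ⟨fun i j => c i j + c' i j, ?_⟩
  simp only [mulOp_add, add_mul, Finset.sum_add_distrib]

theorem orderLE_zero (N : ℕ) : OrderLE N (0 : Op k) :=
  ⟨fun _ _ => 0, by simp [mulOp_zero]⟩

theorem OrderLE.induction {N : ℕ} {P : Op k → Prop} {T : Op k} (hT : OrderLE N T)
    (zero : P 0) (add : ∀ S T, P S → P T → P (S + T))
    (mono : ∀ (f : Smooth k) (i j : ℕ), i + j ≤ N → P (mulOp f * dr k ^ i * dθ k ^ j)) : P T := by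
  obtain ⟨c, rfl⟩ := hT
  refine Finset.sum_induction _ P add zero fun i hi =>
    Finset.sum_induction _ P add zero fun j hj => mono _ _ _ ?_
  rw [Finset.mem_range] at hi hj
  omega

theorem OrderLE.mono {M N : ℕ} {T : Op k} (hT : OrderLE M T) (h : M ≤ N) : OrderLE N T :=
  hT.induction (orderLE_zero N) (fun _ _ => OrderLE.add)
    fun f _ _ hij => orderLE_monomial f (hij.trans h)

theorem OrderLE.mulOp_mul {N : ℕ} {T : Op k} (f : Smooth k) (hT : OrderLE N T) :
    OrderLE N (mulOp f * T) := by
  refine hT.induction (P := fun T => OrderLE N (mulOp f * T)) ?_ (fun S T hS hT => ?_) fun g i j hij => ?_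
  · rw [mul_zero]; exact orderLE_zero N
  · rw [mul_add]; exact hS.add hT
  · rw [mul_assoc, ← mul_assoc, ← TTW.mulOp_mul, ← mul_assoc]
    exact orderLE_monomial _ hij

theorem OrderLE.dr_mul {N : ℕ} {T : Op k} (hT : OrderLE N T) : OrderLE (N + 1) (dr k * T) := by
  refine hT.induction (P := fun T => OrderLE (N + 1) (dr k * T)) ?_ (fun S T hS hT => ?_) fun g i j hij => ?_
  · rw [mul_zero]; exact orderLE_zero _
  · rw [mul_add]; exact hS.add hT
  · have : dr k * (mulOp g * dr k ^ i * dθ k ^ j) = mulOp g * dr k ^ (i + 1) * dθ k ^ j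
        + mulOp (dr k g) * dr k ^ i * dθ k ^ j := by
      rw [← mul_assoc, ← mul_assoc, dr_mul_mulOp, add_mul, add_mul, pow_succ', mul_assoc (mulOp g)]
    rw [this]
    exact (orderLE_monomial _ (by omega)).add (orderLE_monomial _ (by omega))

theorem OrderLE.dθ_mul {N : ℕ} {T : Op k} (hT : OrderLE N T) : OrderLE (N + 1) (dθ k * T) := by
  refine hT.induction (P := fun T => OrderLE (N + 1) (dθ k * T)) ?_ (fun S T hS hT => ?_) fun g i j hij => ?_
  · rw [mul_zero]; exact orderLE_zero _
  · rw [mul_add]; exact hS.add hT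
  · have : dθ k * (mulOp g * dr k ^ i * dθ k ^ j) = mulOp g * dr k ^ i * dθ k ^ (j + 1)
        + mulOp (dθ k g) * dr k ^ i * dθ k ^ j := by
      rw [← mul_assoc, ← mul_assoc, dθ_mul_mulOp, add_mul, add_mul, pow_succ', mul_assoc (mulOp g),
        (commute_dr_dθ.pow_left i).symm.eq]
      simp only [mul_assoc]
    rw [this]
    exact (orderLE_monomial _ (by omega)).add (orderLE_monomial _ (by omega))

theorem OrderLE.mul {M N : ℕ} {S T : Op k} (hS : OrderLE M S) (hT : OrderLE N T) :
    OrderLE (M + N) (S * T) := by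
  have hθ : ∀ j, OrderLE (j + N) (dθ k ^ j * T) := fun j => by
    induction j with
    | zero => simpa using hT
    | succ j ih =>
      rw [pow_succ', mul_assoc]
      exact ih.dθ_mul.mono (by omega)
  have hr : ∀ i j, OrderLE (i + j + N) (dr k ^ i * (dθ k ^ j * T)) := fun i j => by
    induction i with
    | zero => simpa using hθ j
    | succ i ih =>
      rw [pow_succ', mul_assoc]
      exact ih.dr_mul.mono (by omega)
  refine hS.induction (P := fun S => OrderLE (M + N) (S * T)) ?_ (fun S S' hS hS' => ?_) fun g i j hij => ?_
  · rw [zero_mul]; exact orderLE_zero _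
  · rw [add_mul]; exact hS.add hS'
  · rw [mul_assoc, mul_assoc]
    exact ((hr i j).mulOp_mul g).mono (by omega)

theorem orderLE_mulOp (f : Smooth k) : OrderLE 0 (mulOp f) := by
  simpa using orderLE_monomial f (i := 0) (j := 0) (N := 0) (by simp)

theorem orderLE_dr : OrderLE 1 (dr k) := by
  simpa [mulOp_one] using orderLE_monomial (1 : Smooth k) (i := 1) (j := 0) (N := 1) (by simp)

theorem orderLE_dθ : OrderLE 1 (dθ k) := by
  simpa [mulOp_one] using orderLE_monomial (1 : Smooth k) (i := 0) (j := 1) (N := 1) (by simp)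

theorem orderLE_one : OrderLE 0 (1 : Op k) := mulOp_one (k := k) ▸ orderLE_mulOp 1

theorem OrderLE.smul {N : ℕ} {T : Op k} (c : ℂ) (hT : OrderLE N T) : OrderLE N (c • T) := by
  have : c • T = mulOp (c • 1) * T := by rw [mulOp_smul, mulOp_one, smul_mul_assoc, one_mul]
  rw [this]
  exact hT.mulOp_mul _

theorem OrderLE.neg {N : ℕ} {T : Op k} (hT : OrderLE N T) : OrderLE N (-T) := by
  simpa using hT.smul (-1)

variable (k) in
/-- The ring of differential operators of finite order. -/
def diffOps : Subring (Op k) where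
  carrier := {T | IsDiffOp T}
  mul_mem' := fun ⟨_, hS⟩ ⟨_, hT⟩ => ⟨_, hS.mul hT⟩
  one_mem' := ⟨0, orderLE_one⟩
  add_mem' := fun ⟨M, hS⟩ ⟨N, hT⟩ =>
    ⟨max M N, (hS.mono (le_max_left M N)).add (hT.mono (le_max_right M N))⟩
  zero_mem' := ⟨0, orderLE_zero 0⟩
  neg_mem' := fun ⟨_, hS⟩ => ⟨_, hS.neg⟩

theorem OrderLE.mem {N : ℕ} {T : Op k} (hT : OrderLE N T) : T ∈ diffOps k := ⟨N, hT⟩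

theorem smul_mem_diffOps (c : ℂ) {T : Op k} (hT : T ∈ diffOps k) : c • T ∈ diffOps k :=
  ⟨_, hT.choose_spec.smul c⟩

/-- The commutator of an operator with multiplication by `f`. -/
def adf (f : Smooth k) (T : Op k) : Op k := T * mulOp f - mulOp f * T

/-- `T` is of order at most `n` in the sense that `n + 1` commutators with `f` vanish, and its
symbol of degree `n`, evaluated at the differential of `f`, is `s`: the `n`-fold commutator with
`f` is multiplication by `n! s`. -/
def HasSymbol (f : Smooth k) : ℕ → Op k → Smooth k → Prop
  | 0, T, s => T = mulOp s
  | n + 1, T, s => HasSymbol f n (adf f T) (((n + 1 : ℕ) : ℂ) • s)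

theorem adf_add (f : Smooth k) (S T : Op k) : adf f (S + T) = adf f S + adf f T := by
  unfold adf; noncomm_ring

theorem adf_mul (f : Smooth k) (S T : Op k) : adf f (S * T) = adf f S * T + S * adf f T := by
  unfold adf; noncomm_ring

theorem adf_mulOp (f g : Smooth k) : adf f (mulOp g) = 0 := by
  unfold adf
  rw [(commute_mulOp g f).eq, sub_self]

theorem HasSymbol.add {f : Smooth k} {n : ℕ} {S T : Op k} {s t : Smooth k}
    (hS : HasSymbol f n S s) (hT : HasSymbol f n T t) : HasSymbol f n (S + T) (s + t) := by
  induction n generalizing S T s t with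
  | zero => rw [HasSymbol] at *; rw [hS, hT, mulOp_add]
  | succ n ih => rw [HasSymbol] at *; rw [adf_add, smul_add]; exact ih hS hT

theorem hasSymbol_zero (f : Smooth k) (n : ℕ) : HasSymbol f n (0 : Op k) 0 := by
  induction n with
  | zero => rw [HasSymbol, mulOp_zero]
  | succ n ih => rw [HasSymbol, smul_zero]; simpa [adf] using ih

/-- An operator of order at most `n` has vanishing symbol of degree `n + 1`. -/
theorem HasSymbol.succ {f : Smooth k} {n : ℕ} {T : Op k} {s : Smooth k}
    (hT : HasSymbol f n T s) : HasSymbol f (n + 1) T 0 := by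
  induction n generalizing T s with
  | zero =>
    rw [HasSymbol] at hT
    rw [HasSymbol, HasSymbol, hT, adf_mulOp, smul_zero, mulOp_zero]
  | succ n ih =>
    rw [HasSymbol, smul_zero]
    exact ih hT

theorem HasSymbol.unique {f : Smooth k} {n : ℕ} {T : Op k} {s t : Smooth k}
    (hs : HasSymbol f n T s) (ht : HasSymbol f n T t) : s = t := by
  induction n generalizing T s t with
  | zero => exact mulOp_injective (hs.symm.trans ht)
  | succ n ih =>
    exact smul_right_injective (Smooth k) (Nat.cast_ne_zero.2 n.succ_ne_zero : ((n + 1 : ℕ) : ℂ) ≠ 0)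
      (ih hs ht)

/-- The symbol is multiplicative. -/
theorem HasSymbol.mul {f : Smooth k} {m n : ℕ} {S T : Op k} {s t : Smooth k}
    (hS : HasSymbol f m S s) (hT : HasSymbol f n T t) : HasSymbol f (m + n) (S * T) (s * t) := by
  induction h : m + n generalizing m n S T s t with
  | zero =>
    obtain ⟨rfl, rfl⟩ : m = 0 ∧ n = 0 := by omega
    rw [HasSymbol] at *
    rw [hS, hT, mulOp_mul]
  | succ l ih =>
    rw [HasSymbol, adf_mul]
    have e : ((l + 1 : ℕ) : ℂ) • (s * t) = ((m : ℂ) • s) * t + s * ((n : ℂ) • t) := by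
      rw [smul_mul_assoc, mul_smul_comm, ← add_smul, ← h]
      push_cast
      rfl
    rw [e]
    refine HasSymbol.add ?_ ?_
    · match m, hS with
      | 0, hS =>
        rw [HasSymbol] at hS
        rw [hS, adf_mulOp, zero_mul, Nat.cast_zero, zero_smul, zero_mul]
        exact hasSymbol_zero f l
      | m + 1, hS => exact ih hS hT (by omega)
    · match n, hT with
      | 0, hT =>
        rw [HasSymbol] at hT
        rw [hT, adf_mulOp, mul_zero, Nat.cast_zero, zero_smul, mul_zero]
        exact hasSymbol_zero f l
      | n + 1, hT => exact ih hS hT (by omega)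

theorem hasSymbol_mulOp (f g : Smooth k) : HasSymbol f 0 (mulOp g) g := rfl

theorem hasSymbol_partialD (f : Smooth k) (v : ℝ × ℝ) :
    HasSymbol f 1 (partialD k v) (partialD k v f) := by
  rw [HasSymbol, HasSymbol, adf, partialD_mul_mulOp, add_sub_cancel_left]
  simp

theorem hasSymbol_dr (f : Smooth k) : HasSymbol f 1 (dr k) (dr k f) := hasSymbol_partialD f _

theorem hasSymbol_dθ (f : Smooth k) : HasSymbol f 1 (dθ k) (dθ k f) := hasSymbol_partialD f _

theorem hasSymbol_one (f : Smooth k) : HasSymbol f 0 (1 : Op k) 1 :=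
  mulOp_one.symm

theorem HasSymbol.pow {f : Smooth k} {m : ℕ} {S : Op k} {s : Smooth k}
    (hS : HasSymbol f m S s) (n : ℕ) : HasSymbol f (n * m) (S ^ n) (s ^ n) := by
  induction n with
  | zero => rw [zero_mul, pow_zero, pow_zero]; exact hasSymbol_one f
  | succ n ih => rw [pow_succ, pow_succ, Nat.succ_mul]; exact ih.mul hS

theorem HasSymbol.smul {f : Smooth k} {n : ℕ} {S : Op k} {s : Smooth k}
    (hS : HasSymbol f n S s) (c : ℂ) : HasSymbol f n (c • S) (c • s) := by
  have h := (hasSymbol_mulOp f (c • 1)).mul hS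
  rwa [zero_add, mulOp_smul, mulOp_one, smul_mul_assoc, one_mul, smul_mul_assoc, one_mul] at h

theorem HasSymbol.mono {f : Smooth k} {m n : ℕ} {S : Op k} {s : Smooth k}
    (hS : HasSymbol f m S s) (h : m < n) : HasSymbol f n S 0 := by
  induction n, h using Nat.le_induction with
  | base => exact hS.succ
  | succ n _ ih => exact ih.succ

theorem hasSymbol_monomial (f g : Smooth k) (i j : ℕ) :
    HasSymbol f (i + j) (mulOp g * dr k ^ i * dθ k ^ j) (g * dr k f ^ i * dθ k f ^ j) := by
  have h := ((hasSymbol_mulOp f g).mul ((hasSymbol_dr f).pow i)).mul ((hasSymbol_dθ f).pow j)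
  simpa using h

theorem OrderLE.exists_hasSymbol {N : ℕ} {T : Op k} (hT : OrderLE N T) (f : Smooth k) :
    ∃ s, HasSymbol f N T s := by
  refine hT.induction (P := fun T => ∃ s, HasSymbol f N T s) ⟨0, hasSymbol_zero f N⟩
    (fun S T ⟨s, hs⟩ ⟨t, ht⟩ => ⟨_, hs.add ht⟩) fun g i j hij => ?_
  rcases hij.eq_or_lt with h | h
  · exact ⟨_, h ▸ hasSymbol_monomial f g i j⟩
  · exact ⟨_, (hasSymbol_monomial f g i j).mono h⟩

theorem OrderLE.hasSymbol_zero {M N : ℕ} {T : Op k} (hT : OrderLE M T) (h : M < N) (f : Smooth k) :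
    HasSymbol f N T 0 :=
  (hT.exists_hasSymbol f).choose_spec.mono h

theorem HasSymbol.sum {ι : Type*} {f : Smooth k} {n : ℕ} (A : Finset ι) {T : ι → Op k}
    {s : ι → Smooth k} (h : ∀ i ∈ A, HasSymbol f n (T i) (s i)) :
    HasSymbol f n (∑ i ∈ A, T i) (∑ i ∈ A, s i) := by
  classical
  induction A using Finset.induction_on with
  | empty => exact TTW.hasSymbol_zero f n
  | insert i A hi ih =>
    rw [Finset.sum_insert hi, Finset.sum_insert hi]
    exact (h i (Finset.mem_insert_self i A)).add
      (ih fun j hj => h j (Finset.mem_insert_of_mem hj))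

/-- The function `s r + θ`, used as a phase function: the symbol of a differential operator is
evaluated at its differential. -/
def fLin (k : ℝ) (s : ℂ) : Smooth k := Smooth.restrict (fun x => s * (x.1 : ℂ) + (x.2 : ℂ))
  (((contDiff_const.mul (Complex.ofRealCLM.contDiff.comp contDiff_fst)).add
    (Complex.ofRealCLM.contDiff.comp contDiff_snd)).contDiffOn)

theorem partialD_fLin (s : ℂ) (v : ℝ × ℝ) (x : domain k) :
    (partialD k v (fLin k s)).1 x = s * v.1 + v.2 := by
  have h1 : HasFDerivAt (fun y : ℝ × ℝ => (y.1 : ℂ))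
      (Complex.ofRealCLM.comp (ContinuousLinearMap.fst ℝ ℝ ℝ)) x.1 :=
    (Complex.ofRealCLM.comp (ContinuousLinearMap.fst ℝ ℝ ℝ)).hasFDerivAt
  have h2 : HasFDerivAt (fun y : ℝ × ℝ => (y.2 : ℂ))
      (Complex.ofRealCLM.comp (ContinuousLinearMap.snd ℝ ℝ ℝ)) x.1 :=
    (Complex.ofRealCLM.comp (ContinuousLinearMap.snd ℝ ℝ ℝ)).hasFDerivAt
  rw [partialD_eq_of_hasFDerivAt (g := fun y : ℝ × ℝ => s * (y.1 : ℂ) + (y.2 : ℂ))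
    (fun _ => rfl) ((h1.const_mul s).add h2)]
  simp

theorem dr_fLin (s : ℂ) : dr k (fLin k s) = s • 1 := by
  apply Smooth.ext'
  intro x
  rw [dr, partialD_fLin]
  change _ = s * 1
  simp

theorem dθ_fLin (s : ℂ) : dθ k (fLin k s) = 1 := by
  apply Smooth.ext'
  intro x
  rw [dθ, partialD_fLin]
  change _ = 1
  simp

/-- The symbol of a differential operator in normal form is the polynomial in `s` formed by its top
coefficients. -/
theorem hasSymbol_top {M : ℕ} (c : ℕ → ℕ → Smooth k) (s : ℂ) :
    HasSymbol (fLin k s) M (∑ i ∈ Finset.range (M + 1), ∑ j ∈ Finset.range (M + 1 - i),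
      mulOp (c i j) * dr k ^ i * dθ k ^ j) (∑ i ∈ Finset.range (M + 1), s ^ i • c i (M - i)) := by
  refine HasSymbol.sum _ fun i hi => ?_
  rw [Finset.mem_range] at hi
  have e : s ^ i • c i (M - i) = ∑ j ∈ Finset.range (M + 1 - i),
      if j = M - i then s ^ i • c i (M - i) else 0 := by
    rw [Finset.sum_ite_eq' (Finset.range (M + 1 - i)) (M - i) (fun _ => s ^ i • c i (M - i)),
      if_pos (Finset.mem_range.2 (by omega))]
  rw [e]
  refine HasSymbol.sum _ fun j hj => ?_
  rw [Finset.mem_range] at hj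
  have hm := hasSymbol_monomial (fLin k s) (c i j) i j
  split_ifs with h
  · rw [dr_fLin, dθ_fLin, smul_pow, one_pow, one_pow, mul_one, mul_smul_comm, mul_one, h,
      Nat.add_sub_cancel' (by omega)] at hm
    rwa [h]
  · exact hm.mono (by omega)

/-- The functions `s r + θ` separate the top order coefficients. -/
theorem coeff_eq_zero_of_hasSymbol {M : ℕ} {c : ℕ → Smooth k}
    (h : ∀ s : ℂ, ∑ i ∈ Finset.range (M + 1), s ^ i • c i = 0) {i : ℕ} (hi : i ≤ M) : c i = 0 := by
  apply Smooth.ext'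
  intro x
  let P : Polynomial ℂ := ∑ i ∈ Finset.range (M + 1), Polynomial.C ((c i).1 x) * Polynomial.X ^ i
  have hP : P = 0 := by
    apply Polynomial.funext
    intro s
    have := congrArg (fun f : Smooth k => f.1 x) (h s)
    simp only [AddSubmonoidClass.coe_finsetSum, Finset.sum_apply] at this
    simp only [P, Polynomial.eval_finsetSum, Polynomial.eval_mul, Polynomial.eval_C,
      Polynomial.eval_pow, Polynomial.eval_X, Polynomial.eval_zero]
    refine Eq.trans (Finset.sum_congr rfl fun i _ => ?_) this
    exact mul_comm _ _
  have hc : P.coeff i = (c i).1 x := by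
    simp only [P, Polynomial.finsetSum_coeff, Polynomial.coeff_C_mul_X_pow]
    rw [Finset.sum_ite_eq, if_pos (Finset.mem_range.2 (by omega))]
  rw [← hc, hP]
  rfl

theorem orderLE_invSinSq : OrderLE 0 (invSinSq k) := by
  rw [invSinSq_eq]
  exact orderLE_mulOp _

theorem orderLE_invCosSq : OrderLE 0 (invCosSq k) := by
  rw [invCosSq_eq]
  exact orderLE_mulOp _

theorem hasSymbol_L2_add (a b c : ℂ) (s : ℂ) :
    HasSymbol (fLin k s) 2 (L2 k a b + c • (1 : Op k)) 1 := by
  have h1 := (hasSymbol_dθ (fLin k s)).pow 2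
  rw [dθ_fLin, one_pow, mul_one] at h1
  have h2 : OrderLE 0 (coupling k a • invSinSq k + coupling k b • invCosSq k + c • (1 : Op k)) :=
    ((orderLE_invSinSq.smul _).add (orderLE_invCosSq.smul _)).add (orderLE_one.smul c)
  have h := h1.add (h2.hasSymbol_zero (N := 2) Nat.zero_lt_two (fLin k s))
  rw [add_zero] at h
  have e : L2 k a b + c • (1 : Op k)
      = dθ k ^ 2 + (coupling k a • invSinSq k + coupling k b • invCosSq k + c • (1 : Op k)) := by
    rw [L2, add_assoc, add_assoc, add_assoc]
  rw [e]
  exact h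

/-- If `T (L₂ + c)` has order less than `M + 2`, the coefficients of order `M` of `T` vanish, because
the symbol of `L₂ + c` is `1` for the phase functions `s r + θ`. -/
theorem coeff_eq_zero_of_mul {M : ℕ} {a b c : ℂ} {C : ℕ → ℕ → Smooth k} {T : Op k}
    (hT : T = ∑ i ∈ Finset.range (M + 1), ∑ j ∈ Finset.range (M + 1 - i),
      mulOp (C i j) * dr k ^ i * dθ k ^ j)
    (h : ∀ s, HasSymbol (fLin k s) (M + 2) (T * (L2 k a b + c • 1)) 0) {i : ℕ} (hi : i ≤ M) :
    C i (M - i) = 0 := by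
  refine coeff_eq_zero_of_hasSymbol (c := fun i => C i (M - i)) (fun s => ?_) hi
  have h1 := (hT ▸ hasSymbol_top C s).mul (hasSymbol_L2_add a b c s)
  rw [mul_one] at h1
  exact h1.unique (h s)

/-- Right multiplication by `L₂ + c` raises the order by exactly two: as long as the order of `T`
exceeds `N`, its top coefficients vanish. -/
theorem OrderLE.of_mul_L2 {M N : ℕ} {a b c : ℂ} {T : Op k} (hT : OrderLE M T)
    (h : OrderLE (N + 2) (T * (L2 k a b + c • 1))) : OrderLE N T := by
  induction M generalizing T with
  | zero => exact hT.mono (Nat.zero_le N)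
  | succ M ih =>
    rcases Nat.lt_or_ge N (M + 1) with hN | hN
    · obtain ⟨C, hC⟩ := hT
      refine ih ⟨C, ?_⟩ h
      have h0 := fun i hi => coeff_eq_zero_of_mul (i := i) hC
        (fun s => h.hasSymbol_zero (by omega) _) hi
      rw [hC, Finset.sum_range_succ _ (M + 1)]
      have e0 : ∑ j ∈ Finset.range (M + 1 + 1 - (M + 1)),
          mulOp (C (M + 1) j) * dr k ^ (M + 1) * dθ k ^ j = 0 := by
        rw [show M + 1 + 1 - (M + 1) = 0 + 1 by omega, Finset.sum_range_succ, Finset.sum_range_zero]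
        have := h0 (M + 1) le_rfl
        rw [Nat.sub_self] at this
        rw [this, mulOp_zero]
        simp
      rw [e0, add_zero]
      refine Finset.sum_congr rfl fun i hi => ?_
      rw [Finset.mem_range] at hi
      rw [show M + 1 + 1 - i = (M + 1 - i) + 1 by omega, Finset.sum_range_succ, h0 i (by omega),
        mulOp_zero]
      simp
    · exact hT.mono hN

/-- Right multiplication by `L₂ + c` is injective on differential operators. -/
theorem eq_zero_of_mul_L2 {a b c : ℂ} {T : Op k} (hT : T ∈ diffOps k)
    (h : T * (L2 k a b + c • 1) = 0) : T = 0 := by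
  obtain ⟨M, hM⟩ := hT
  obtain ⟨C, hC⟩ := hM.of_mul_L2 (N := 0) (h ▸ orderLE_zero _)
  have h0 := coeff_eq_zero_of_mul (i := 0) hC (fun s => h ▸ hasSymbol_zero _ _) le_rfl
  rw [Nat.sub_self] at h0
  rw [hC]
  simp [h0, mulOp_zero]

end DiffOp

end TTW

end

noncomputable section

namespace TTW

/-! ### An abstract model of the separated operators -/

section ScalarConstants

variable {U : Type*} [CommRing U] [Algebra ℂ U]

/-- A complex number as a scalar. -/
abbrev cst (U : Type*) [CommRing U] [Algebra ℂ U] (c : ℂ) : U := algebraMap ℂ U c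

theorem four_mul_cst : 4 * cst U (1 / 4) = 1 := by
  rw [← map_ofNat (algebraMap ℂ U) 4, ← map_mul, ← map_one (algebraMap ℂ U)]
  norm_num

theorem two_mul_cst : 2 * cst U (1 / 2) = 1 := by
  rw [← map_ofNat (algebraMap ℂ U) 2, ← map_mul, ← map_one (algebraMap ℂ U)]
  norm_num

/-- The ladder parameter `s = (ν + 1) / 2` for `ν = m`. -/
def half (m : U) : U := cst U (1 / 2) * (m + 1)

theorem half_sq (m : U) : half m ^ 2 - half m + cst U (1 / 4) = cst U (1 / 4) * m ^ 2 := by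
  have h : cst U (1 / 2) ^ 2 = cst U (1 / 4) := by rw [cst, cst, ← map_pow]; norm_num
  have h2 := two_mul_cst (U := U)
  have h5 : 2 * cst U (1 / 4) = cst U (1 / 2) := by rw [← h]; linear_combination cst U (1 / 2) * h2
  unfold half
  linear_combination (m + 1) ^ 2 * h + (m + 1) * h5

/-- The scalar `J⁻_{ν+2} J⁺_ν`, where `ν + 1 = 2s`. -/
def jScal (a b : ℂ) (s : U) : U :=
  4 * s ^ 4 + (4 * cst U ((1 / 2 - a ^ 2 - b ^ 2) / 2) - 1) * s ^ 2 + cst U ((a ^ 2 - b ^ 2) / 2) ^ 2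

/-- The scalar `K⁻_{ν+2} K⁺_ν`, where `ν + 1 = 2s` and `e = E`. -/
def kScal (ω : ℂ) (e s : U) : U := (cst U (1 / 4) * e) ^ 2 - 4 * s ^ 2 * cst U (ω ^ 2 / 4)

end ScalarConstants

/-- The relations between the separated operators on which the ladder method rests: operators
`d = (1 - x²) ∂_x`, `x`, `D = ∂_R`, `y = 1 / R` in a ring `A`, the symmetry `L` and the Hamiltonian
`h` expressed through them, and a ring `B` of operator polynomials over `A` in the two central
parameters `μ` and `E` of a commutative ring `U`. Here `ϱ` is the inverse of `y`, `w` is the inverse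
of `1 - x²`, and the subring `S` singles out the operators that may be used as coefficients of left
ideals. -/
structure LadderModel (U A B : Type*) [CommRing U] [Algebra ℂ U] [Ring A] [Algebra ℂ A] [Ring B]
    [Algebra U B] where
  (E : U)
  (φ : A →+* B)
  (φ_smul : ∀ (c : ℂ) (T : A), φ (c • T) = cst U c • φ T)
  (κ ω a b : ℂ)
  (κ_ne : κ ≠ 0)
  (d x D y ϱ w L h : A)
  (d_mul_x : d * x = x * d + 1 - x * x)
  (D_mul_y : D * y = y * D - y * y)
  (comm_d_D : Commute d D)
  (comm_d_y : Commute d y)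
  (comm_x_D : Commute x D)
  (comm_x_y : Commute x y)
  (comm_L_D : Commute L D)
  (comm_L_y : Commute L y)
  (one_sub_mul_L : (1 - x * x) * L = (4 * κ ^ 2) • (d * d + x * d - ((a ^ 2 - b ^ 2) / 2) • x
      + ((1 / 2 - a ^ 2 - b ^ 2) / 2) • (1 : A)))
  (w_mul : w * (1 - x * x) = 1)
  (ϱ_mul : ϱ * y = 1)
  (mul_ϱ : y * ϱ = 1)
  (h_eq : h = (4 : ℂ) • (ϱ * (D * D + y * D - (ω ^ 2 / 4) • (1 : A))) + y * L)
  (S : Subring B)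
  (scalar_mem : ∀ u : U, algebraMap U B u ∈ S)
  (d_mem : φ d ∈ S)
  (x_mem : φ x ∈ S)
  (D_mem : φ D ∈ S)
  (y_mem : φ y ∈ S)
  (ϱ_mem : φ ϱ ∈ S)
  (w_mem : φ w ∈ S)
  (L_mem : φ L ∈ S)
  (h_mem : φ h ∈ S)

theorem commute_smul_right {U B : Type*} [CommRing U] [Ring B] [Algebra U B] {F F' : B} (u : U)
    (h : Commute F F') : Commute F (u • F') := by
  rw [Commute, SemiconjBy, mul_smul_comm, smul_mul_assoc, h.eq]

namespace LadderModel

variable {U A B : Type*} [CommRing U] [Algebra ℂ U] [Ring A] [Algebra ℂ A] [Ring B] [Algebra U B]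
  (M : LadderModel U A B)

/-- The Jacobi raising operator `J⁺_ν` with `ν + 1 = 2s`. -/
def jLad (s : U) : B := jacobiUp (M.φ M.d) (M.φ M.x) (cst U ((M.a ^ 2 - M.b ^ 2) / 2)) s

/-- The Laguerre raising operator `K⁺_ν` with `ν + 1 = 2s`. -/
def kLad (s : U) : B := laguerreUp (M.φ M.D) (M.φ M.y) (cst U (1 / 4) * M.E) s

/-- The angular operator that annihilates the eigenfunctions of `L₂` with `μ + 1 = 2s`. -/
def gOp (s : U) : B :=
  angularOp (M.φ M.d) (M.φ M.x) (cst U ((M.a ^ 2 - M.b ^ 2) / 2))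
    (cst U ((1 / 2 - M.a ^ 2 - M.b ^ 2) / 2)) (s ^ 2 - s + cst U (1 / 4))

/-- The radial operator that annihilates the joint eigenfunctions with `k μ + 1 = 2s`. -/
def nOp (s : U) : B :=
  radialOp (M.φ M.D) (M.φ M.y) (cst U (1 / 4) * M.E) (cst U (M.ω ^ 2 / 4)) (s ^ 2 - s + cst U (1 / 4))

theorem isLadder_jLad : IsLadder M.jLad M.gOp (jScal M.a M.b) := by
  have hd : M.φ M.d * M.φ M.x = M.φ M.x * M.φ M.d + 1 - M.φ M.x * M.φ M.x := by
    rw [← map_mul, M.d_mul_x, map_sub, map_add, map_mul, map_mul, map_one]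
  refine ⟨fun s => ?_, fun s => jacobiUp_mul_jacobiUp hd _ _ _ _ four_mul_cst⟩
  rw [jLad, gOp, gOp, ← angularOp_mul_jacobiUp hd _ _ _ _ four_mul_cst]
  congr 2
  ring

theorem isLadder_kLad : IsLadder M.kLad M.nOp (kScal M.ω M.E) := by
  have hd : M.φ M.D * M.φ M.y = M.φ M.y * M.φ M.D - M.φ M.y * M.φ M.y := by
    rw [← map_mul, M.D_mul_y, map_sub, map_mul, map_mul]
  refine ⟨fun s => ?_, fun s => laguerreUp_mul_laguerreUp hd _ _ _ _ four_mul_cst⟩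
  rw [kLad, nOp, nOp, ← radialOp_mul_laguerreUp hd _ _ _ _ four_mul_cst]
  congr 2
  ring

variable {M}

theorem commute_jLad {F : B} (h1 : Commute F (M.φ M.d)) (h2 : Commute F (M.φ M.x)) (s : U) :
    Commute F (M.jLad s) :=
  ((commute_smul_right _ h1).sub_right (commute_smul_right _ h2)).sub_right
    (commute_smul_right _ (Commute.one_right F))

theorem commute_kLad {F : B} (h1 : Commute F (M.φ M.D)) (h2 : Commute F (M.φ M.y)) (s : U) :
    Commute F (M.kLad s) :=
  ((commute_smul_right _ h1).sub_right (commute_smul_right _ h2)).sub_right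
    (commute_smul_right _ (Commute.one_right F))

theorem commute_nOp {F : B} (h1 : Commute F (M.φ M.D)) (h2 : Commute F (M.φ M.y)) (s : U) :
    Commute F (M.nOp s) :=
  ((((h1.mul_right h1).add_right (h2.mul_right h1)).sub_right (commute_smul_right _ h2)).sub_right
    (commute_smul_right _ (Commute.one_right F))).sub_right (commute_smul_right _ (h2.mul_right h2))

variable (M)

theorem commute_jLad_kLad (s t : U) : Commute (M.jLad s) (M.kLad t) :=
  (commute_jLad (commute_kLad (M.comm_d_D.map M.φ) (M.comm_d_y.map M.φ) t).symm
    (commute_kLad (M.comm_x_D.map M.φ) (M.comm_x_y.map M.φ) t).symm s).symm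

theorem commute_nOp_jLad (s t : U) : Commute (M.nOp t) (M.jLad s) :=
  commute_jLad (commute_nOp (M.comm_d_D.map M.φ) (M.comm_d_y.map M.φ) t).symm
    (commute_nOp (M.comm_x_D.map M.φ) (M.comm_x_y.map M.φ) t).symm s

theorem commute_L_kLad (s : U) : Commute (M.φ M.L) (M.kLad s) :=
  commute_kLad (M.comm_L_D.map M.φ) (M.comm_L_y.map M.φ) s

theorem smul_mem {F : B} (u : U) (hF : F ∈ M.S) : u • F ∈ M.S :=
  smul_mem_of_algebraMap_mem M.scalar_mem u hF

theorem jLad_mem (s : U) : M.jLad s ∈ M.S :=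
  M.S.sub_mem (M.S.sub_mem (M.smul_mem _ M.d_mem) (M.smul_mem _ M.x_mem))
    (M.smul_mem _ M.S.one_mem)

theorem kLad_mem (s : U) : M.kLad s ∈ M.S :=
  M.S.sub_mem (M.S.sub_mem (M.smul_mem _ M.D_mem) (M.smul_mem _ M.y_mem))
    (M.smul_mem _ M.S.one_mem)

/-! ### The left ideal of a joint eigenfunction -/

/-- `L₂ + k² m²`. -/
def angEq (m : U) : B := M.φ M.L + (cst U (M.κ ^ 2) * m ^ 2) • (1 : B)

/-- `H - E`. -/
def enEq : B := M.φ M.h - M.E • (1 : B)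

/-- The left ideal generated by `L₂ + k² m²` and `H - E`: the operator polynomials that annihilate
a generic joint eigenfunction with `μ = m`. -/
def eigIdeal (m : U) : Submodule M.S B := Submodule.span M.S {M.angEq m, M.enEq}

variable {M} {m : U}

theorem mem_eigIdeal {F : B} : F ∈ M.eigIdeal m ↔
    ∃ X ∈ M.S, ∃ Y ∈ M.S, F = X * M.angEq m + Y * M.enEq := by
  rw [eigIdeal, Submodule.mem_span_pair]
  constructor
  · rintro ⟨X, Y, h⟩
    exact ⟨X, X.2, Y, Y.2, h.symm⟩
  · rintro ⟨X, hX, Y, hY, h⟩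
    exact ⟨⟨X, hX⟩, ⟨Y, hY⟩, h.symm⟩

theorem mul_mem_eigIdeal {X F : B} (hX : X ∈ M.S) (hF : F ∈ M.eigIdeal m) :
    X * F ∈ M.eigIdeal m :=
  (M.eigIdeal m).smul_mem ⟨X, hX⟩ hF

theorem smul_mem_eigIdeal {F : B} (u : U) (hF : F ∈ M.eigIdeal m) : u • F ∈ M.eigIdeal m := by
  rw [Algebra.smul_def]
  exact mul_mem_eigIdeal (M.scalar_mem u) hF

variable (M) (m)

theorem angEq_mem : M.angEq m ∈ M.eigIdeal m := Submodule.subset_span (by simp)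

theorem enEq_mem : M.enEq ∈ M.eigIdeal m := Submodule.subset_span (by simp)

theorem eigIdeal_neg : M.eigIdeal (-m) = M.eigIdeal m := by
  rw [eigIdeal, eigIdeal, angEq, angEq, neg_sq]

/-- The angular operator and the eigenvalue equation of `L₂` differ by the invertible factor
`1 - x²`; see also `angEq_eq`. -/
theorem gOp_eq : M.gOp (half m)
    = cst U ((4 * M.κ ^ 2)⁻¹) • (M.φ (1 - M.x * M.x) * M.angEq m) := by
  have hκ := M.κ_ne
  have e2 : cst U ((4 * M.κ ^ 2)⁻¹) * cst U (4 * M.κ ^ 2) = 1 := by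
    rw [← map_mul, inv_mul_cancel₀ (by simpa using hκ), map_one]
  have e3 : cst U ((4 * M.κ ^ 2)⁻¹) * (cst U (M.κ ^ 2) * m ^ 2) = cst U (1 / 4) * m ^ 2 := by
    rw [← mul_assoc, ← map_mul]
    congr 2
    field_simp
  rw [angEq, mul_add, ← map_mul, M.one_sub_mul_L, M.φ_smul, mul_smul_comm, mul_one, smul_add,
    smul_smul, smul_smul, e2, e3, one_smul, gOp, half_sq, angularOp]
  simp only [map_add, map_sub, map_mul, M.φ_smul, map_one]

theorem angEq_eq : M.angEq m = cst U (4 * M.κ ^ 2) • (M.φ M.w * M.gOp (half m)) := by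
  have hκ := M.κ_ne
  have e2 : cst U (4 * M.κ ^ 2) * cst U ((4 * M.κ ^ 2)⁻¹) = 1 := by
    rw [← map_mul, mul_inv_cancel₀ (by simpa using hκ), map_one]
  rw [gOp_eq, mul_smul_comm, smul_smul, e2, one_smul, ← mul_assoc, ← map_mul, M.w_mul, map_one,
    one_mul]

/-- The energy equation is the radial equation with `ν = k m`, modulo the eigenvalue equation
of `L₂`. -/
theorem enEq_eq : M.enEq = cst U 4 • (M.φ M.ϱ * M.nOp (half (cst U M.κ * m)))
      + M.φ M.y * M.angEq m := by
  have e2 : cst U 4 * cst U (1 / 4) = 1 := by rw [← map_mul]; norm_num [map_one]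
  have e3 : cst U (M.κ ^ 2) = cst U M.κ ^ 2 := map_pow _ _ _
  have e4 : cst U 4 * (cst U (1 / 4) * M.E) = M.E := by rw [← mul_assoc, e2, one_mul]
  have e5 : cst U 4 * (cst U (1 / 4) * (cst U M.κ * m) ^ 2) = cst U M.κ ^ 2 * m ^ 2 := by
    linear_combination (cst U M.κ ^ 2 * m ^ 2) * e2
  have e6 : M.φ M.ϱ * M.φ M.y = 1 := by rw [← map_mul, M.ϱ_mul, map_one]
  have e7 : M.φ M.ϱ * (M.φ M.y * M.φ M.y) = M.φ M.y := by rw [← mul_assoc, e6, one_mul]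
  rw [enEq, M.h_eq, angEq, nOp, half_sq, radialOp]
  simp only [mul_sub, mul_add, map_add, map_mul, map_sub, M.φ_smul, mul_smul_comm, mul_one,
    smul_sub, smul_add, smul_smul, e3, e4, e5, e6, e7]
  abel

variable {m}

theorem gOp_mem : M.gOp (half m) ∈ M.eigIdeal m := by
  rw [gOp_eq, map_sub, map_one, map_mul]
  exact smul_mem_eigIdeal _ (mul_mem_eigIdeal
    (M.S.sub_mem M.S.one_mem (M.S.mul_mem M.x_mem M.x_mem)) (M.angEq_mem m))

theorem nOp_mem : M.nOp (half (cst U M.κ * m)) ∈ M.eigIdeal m := by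
  have e2 : cst U (1 / 4) * cst U 4 = 1 := by rw [← map_mul]; norm_num
  have e1 : M.φ M.y * M.φ M.ϱ = 1 := by rw [← map_mul, M.mul_ϱ, map_one]
  have e : M.nOp (half (cst U M.κ * m))
      = cst U (1 / 4) • (M.φ M.y * (M.enEq - M.φ M.y * M.angEq m)) := by
    rw [M.enEq_eq m, add_sub_cancel_right, mul_smul_comm, ← mul_assoc, e1, one_mul, smul_smul, e2,
      one_smul]
  rw [e]
  exact smul_mem_eigIdeal _ (mul_mem_eigIdeal M.y_mem (sub_mem (M.enEq_mem m)
    (mul_mem_eigIdeal M.y_mem (M.angEq_mem m))))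

end LadderModel

end TTW

end

noncomputable section

namespace TTW

namespace LadderModel

/-! ### The joint raising and lowering operators -/

variable {U A B : Type*} [CommRing U] [Algebra ℂ U] [Ring A] [Algebra ℂ A] [Ring B] [Algebra U B]
  (M : LadderModel U A B) (p q : ℕ)

/-- The operator `Ξ₊` at `μ = m`; then `Ξ₋` at `μ = m` is `Ξ₊` at `-m`. -/
def xi (m : U) : B := upChain M.kLad p (half (cst U M.κ * m)) * upChain M.jLad q (half m)

/-- The scalar by which `Ξ₋ Ξ₊` acts. -/
def xiScal (m : U) : U :=
  (∏ j ∈ Finset.range p, kScal M.ω M.E (half (cst U M.κ * m) + j))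
    * ∏ j ∈ Finset.range q, jScal M.a M.b (half m + j)

/-- Modulo the left ideal of a joint eigenfunction `ψ` with `μ = m₀`, the operator polynomial `Φ`
satisfies the eigenvalue equations with `μ = m`; thus `Φ ψ` is a joint eigenfunction. -/
def IsEig (m₀ m : U) (Φ : B) : Prop :=
  M.angEq m * Φ ∈ M.eigIdeal m₀ ∧ M.enEq * Φ ∈ M.eigIdeal m₀

theorem isEig_one (m : U) : M.IsEig m m 1 :=
  ⟨by rw [mul_one]; exact M.angEq_mem m, by rw [mul_one]; exact M.enEq_mem m⟩

theorem half_add (m : U) (n : ℕ) : half (m + 2 * n) = half m + n := by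
  unfold half
  linear_combination (n : U) * two_mul_cst (U := U)

theorem upJ_mem (n : ℕ) (s : U) : upChain M.jLad n s ∈ M.S := upChain_mem M.jLad_mem n s

theorem upK_mem (n : ℕ) (s : U) : upChain M.kLad n s ∈ M.S := upChain_mem M.kLad_mem n s

theorem xi_mem (m : U) : M.xi p q m ∈ M.S := M.S.mul_mem (M.upK_mem _ _) (M.upJ_mem _ _)

variable {p q}

theorem cst_mul_natCast (hκ : M.κ * q = p) : cst U M.κ * (q : U) = p := by
  rw [← map_natCast (algebraMap ℂ U) q, ← map_mul, hκ, map_natCast]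

theorem half_mul_add (hκ : M.κ * q = p) (m : U) :
    half (cst U M.κ * (m + 2 * q)) = half (cst U M.κ * m) + p := by
  rw [← half_add]
  congr 1
  linear_combination 2 * M.cst_mul_natCast hκ

/-- `Ξ₊` maps joint eigenfunctions to joint eigenfunctions, raising `μ` by `2q`. -/
theorem isEig_xi (hκ : M.κ * q = p) (m : U) : M.IsEig m (m + 2 * q) (M.xi p q m) := by
  -- the Laguerre chain commutes with `L₂`, and the Jacobi chain intertwines the angular operators
  have hang : M.angEq (m + 2 * q) * M.xi p q m ∈ M.eigIdeal m := by
    have hc : Commute (M.angEq (m + 2 * q)) (upChain M.kLad p (half (cst U M.κ * m))) :=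
      commute_upChain (fun s => (M.commute_L_kLad s).add_left
        (commute_smul_right _ (Commute.one_right _)).symm) _ _
    rw [xi, ← mul_assoc, hc.eq, mul_assoc]
    refine mul_mem_eigIdeal (M.upK_mem _ _) ?_
    rw [angEq_eq, half_add, smul_mul_assoc, mul_assoc, M.isLadder_jLad.intertwine_chain]
    exact smul_mem_eigIdeal _ (mul_mem_eigIdeal M.w_mem (mul_mem_eigIdeal (M.upJ_mem _ _)
      M.gOp_mem))
  refine ⟨hang, ?_⟩
  have hN : Commute (M.nOp (half (cst U M.κ * m))) (upChain M.jLad q (half m)) :=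
    commute_upChain (fun s => M.commute_nOp_jLad s _) _ _
  rw [M.enEq_eq (m + 2 * q), add_mul, smul_mul_assoc, mul_assoc, mul_assoc]
  refine add_mem (smul_mem_eigIdeal _ (mul_mem_eigIdeal M.ϱ_mem ?_))
    (mul_mem_eigIdeal M.y_mem hang)
  rw [M.half_mul_add hκ, xi, ← mul_assoc, M.isLadder_kLad.intertwine_chain, mul_assoc, hN.eq,
    ← mul_assoc]
  exact mul_mem_eigIdeal (M.S.mul_mem (M.upK_mem _ _) (M.upJ_mem _ _)) M.nOp_mem

/-- `Ξ₋` maps joint eigenfunctions to joint eigenfunctions, lowering `μ` by `2q`. -/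
theorem isEig_xi_neg (hκ : M.κ * q = p) (m : U) : M.IsEig m (m - 2 * q) (M.xi p q (-m)) := by
  obtain ⟨h1, h2⟩ := M.isEig_xi hκ (-m)
  rw [eigIdeal_neg] at h1 h2
  refine ⟨?_, h2⟩
  have : M.angEq (m - 2 * q) = M.angEq (-m + 2 * q) := by
    rw [angEq, angEq]
    congr 3
    ring
  rw [this]
  exact h1

/-- `Ξ₋ Ξ₊` is a scalar on joint eigenfunctions. -/
theorem xi_mul_xi (hκ : M.κ * q = p) (m : U) :
    M.xi p q (-m - 2 * q) * M.xi p q m - M.xiScal p q m • (1 : B) ∈ M.eigIdeal m := by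
  obtain ⟨X, hX, Y, hY, h⟩ := M.isLadder_jLad.factor_two_chains M.isLadder_kLad M.scalar_mem
    M.jLad_mem M.kLad_mem M.commute_jLad_kLad M.commute_nOp_jLad q p (half m)
    (half (cst U M.κ * m))
  have e1 : half (-m - 2 * q) = -(half m + q - 1) := by
    unfold half
    linear_combination (1 - (q : U)) * two_mul_cst (U := U)
  have e2 : half (cst U M.κ * (-m - 2 * q)) = -(half (cst U M.κ * m) + p - 1) := by
    have := M.cst_mul_natCast hκ
    unfold half
    linear_combination (1 - (p : U)) * two_mul_cst (U := U) - 2 * cst U (1 / 2) * this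
  rw [xi, e1, e2, xi, h, ← xiScal, add_assoc, add_sub_cancel_left]
  exact add_mem (mul_mem_eigIdeal hX M.gOp_mem) (mul_mem_eigIdeal hY M.nOp_mem)

/-- For `μ = q` the operator `Ξ₋` maps `μ` to `-q` and so does not change `μ²`. Its two chains are
symmetric about their middle, and it acts as a scalar on joint eigenfunctions. -/
theorem xi_self (hκ : M.κ * q = p) :
    M.xi p q (-(q : U)) - (selfScalar (kScal M.ω M.E) (-(cst U (1 / 4) * M.E)) (cst U (1 / 2)) p
      * selfScalar (jScal M.a M.b) (-cst U ((M.a ^ 2 - M.b ^ 2) / 2)) (cst U (1 / 2)) q) • (1 : B)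
      ∈ M.eigIdeal (q : U) := by
  -- at `s = 0` the derivative terms of the ladder operators vanish
  have hz : M.jLad 0 = (-cst U ((M.a ^ 2 - M.b ^ 2) / 2)) • (1 : B) := by
    simp [jLad, jacobiUp]
  have hw : M.kLad 0 = (-(cst U (1 / 4) * M.E)) • (1 : B) := by
    simp [kLad, laguerreUp]
  obtain ⟨X, hX, Y, hY, h⟩ := M.isLadder_jLad.self_two_chains M.isLadder_kLad M.scalar_mem
    M.jLad_mem M.kLad_mem M.commute_nOp_jLad two_mul_cst hz hw q p
  have e1 : half (-(q : U)) = cst U (1 / 2) * (1 - q) := by unfold half; ring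
  have e2 : half (cst U M.κ * -(q : U)) = cst U (1 / 2) * (1 - p) := by
    rw [mul_neg, M.cst_mul_natCast hκ]; unfold half; ring
  rw [← e1, ← e2] at h
  rw [xi, h, add_assoc, add_sub_cancel_left, ← M.eigIdeal_neg]
  exact add_mem (mul_mem_eigIdeal hX M.gOp_mem) (mul_mem_eigIdeal hY M.nOp_mem)

variable {M}

/-! ### Polynomials in the symmetries on eigenvectors -/

theorem pow_mul_sub_mem {m₀ : U} {T Φ : B} {u : U} (hT : T ∈ M.S)
    (h : T * Φ - u • Φ ∈ M.eigIdeal m₀) (n : ℕ) : T ^ n * Φ - u ^ n • Φ ∈ M.eigIdeal m₀ := by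
  induction n with
  | zero => simp
  | succ n ih =>
    have e : T ^ (n + 1) * Φ - u ^ (n + 1) • Φ
        = T * (T ^ n * Φ - u ^ n • Φ) + u ^ n • (T * Φ - u • Φ) := by
      rw [pow_succ', pow_succ, mul_sub, smul_sub, mul_smul_comm, smul_smul, mul_assoc]
      abel
    rw [e]
    exact add_mem (mul_mem_eigIdeal hT ih) (smul_mem_eigIdeal _ h)

theorem IsEig.L_mul {m₀ m : U} {Φ : B} (h : M.IsEig m₀ m Φ) :
    M.φ M.L * Φ - (-(cst U (M.κ ^ 2) * m ^ 2)) • Φ ∈ M.eigIdeal m₀ := by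
  have := h.1
  rwa [angEq, add_mul, smul_mul_assoc, one_mul, ← sub_neg_eq_add, ← neg_smul] at this

theorem IsEig.h_mul {m₀ m : U} {Φ : B} (h : M.IsEig m₀ m Φ) :
    M.φ M.h * Φ - M.E • Φ ∈ M.eigIdeal m₀ := by
  have := h.2
  rwa [enEq, sub_mul, smul_mul_assoc, one_mul] at this

/-- On an eigenvector, polynomials in `L₂` and `H` may be replaced by their values. -/
theorem IsEig.monomial {m₀ m : U} {Φ : B} (h : M.IsEig m₀ m Φ) {T : A} (hT : M.φ T ∈ M.S)
    (i j : ℕ) : M.φ (T * (-((M.κ ^ 2)⁻¹ • M.L)) ^ i * M.h ^ j) * Φ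
      - (m ^ (2 * i) * M.E ^ j) • (M.φ T * Φ) ∈ M.eigIdeal m₀ := by
  have hκ : cst U ((M.κ ^ 2)⁻¹) * cst U (M.κ ^ 2) = 1 := by
    rw [← map_mul, inv_mul_cancel₀ (pow_ne_zero 2 M.κ_ne), map_one]
  have hLS : M.φ (-((M.κ ^ 2)⁻¹ • M.L)) ∈ M.S := by
    rw [map_neg, M.φ_smul]
    exact M.S.neg_mem (M.smul_mem _ M.L_mem)
  have h1 : M.φ (-((M.κ ^ 2)⁻¹ • M.L)) * Φ - m ^ 2 • Φ ∈ M.eigIdeal m₀ := by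
    have e : M.φ (-((M.κ ^ 2)⁻¹ • M.L)) * Φ - m ^ 2 • Φ
        = (-cst U ((M.κ ^ 2)⁻¹)) • (M.φ M.L * Φ - (-(cst U (M.κ ^ 2) * m ^ 2)) • Φ) := by
      rw [map_neg, M.φ_smul, smul_sub, smul_smul, neg_mul, smul_mul_assoc, neg_smul, neg_mul_neg,
        ← mul_assoc, hκ, one_mul]
    rw [e]
    exact smul_mem_eigIdeal _ h.L_mul
  have h2 := pow_mul_sub_mem hLS h1 i
  have h3 := pow_mul_sub_mem M.h_mem h.h_mul j
  have e : M.φ (T * (-((M.κ ^ 2)⁻¹ • M.L)) ^ i * M.h ^ j) * Φ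
      - (m ^ (2 * i) * M.E ^ j) • (M.φ T * Φ)
      = M.φ T * (M.φ (-((M.κ ^ 2)⁻¹ • M.L)) ^ i * (M.φ M.h ^ j * Φ - M.E ^ j • Φ)
        + M.E ^ j • (M.φ (-((M.κ ^ 2)⁻¹ • M.L)) ^ i * Φ - (m ^ 2) ^ i • Φ)) := by
    simp only [map_mul, map_pow, mul_sub, mul_add, smul_sub, mul_smul_comm, smul_smul, mul_assoc,
      pow_mul, mul_comm ((m ^ 2) ^ i)]
    abel
  rw [e]
  exact mul_mem_eigIdeal hT (add_mem (mul_mem_eigIdeal (M.S.pow_mem hLS i) h3)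
    (smul_mem_eigIdeal _ h2))

end LadderModel

end TTW

end

noncomputable section

namespace TTW

namespace LadderModel

/-! ### The structure equations -/

variable {U A B : Type*} [CommRing U] [Algebra ℂ U] [Ring A] [Algebra ℂ A] [Ring B] [Algebra U B]

/-- The basis independent operators `L₃ = Ξ₊ + Ξ₋` and `L₄ = (Ξ₊ - Ξ₋) / μ`, and operators `P⁽⁺⁾`,
`P⁽⁻⁾` with the values `Ξ₋Ξ₊ + Ξ₊Ξ₋` and `(Ξ₋Ξ₊ - Ξ₊Ξ₋) / μ`, over a generic value of `μ`. Generic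
means that an operator that does not involve `μ` and `E` is determined by its class modulo the left
ideal, even after multiplication by `μ`; identities between such operators may then be verified on
the generic joint eigenfunction. -/
structure Quantization (M : LadderModel U A B) (p q : ℕ) where
  (μ : U)
  (ratio : M.κ * q = p)
  (L3 L4 Pp Pm : A)
  (L3_mem : M.φ L3 ∈ M.S)
  (L4_mem : M.φ L4 ∈ M.S)
  (L3_mul : ∀ (m₀ m : U) (Φ : B), M.IsEig m₀ m Φ →
    M.φ L3 * Φ - (M.xi p q m * Φ + M.xi p q (-m) * Φ) ∈ M.eigIdeal m₀)
  (L4_mul : ∀ (m₀ m : U) (Φ : B), M.IsEig m₀ m Φ →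
    m • (M.φ L4 * Φ) - (M.xi p q m * Φ - M.xi p q (-m) * Φ) ∈ M.eigIdeal m₀)
  (Pp_mem : M.φ Pp - (M.xiScal p q μ + M.xiScal p q (-μ)) • (1 : B) ∈ M.eigIdeal μ)
  (Pm_mem : μ • M.φ Pm - (M.xiScal p q μ - M.xiScal p q (-μ)) • (1 : B) ∈ M.eigIdeal μ)
  (eq_zero : ∀ T : A, M.φ T ∈ M.eigIdeal μ → T = 0)
  (eq_zero_of_mul : ∀ T : A, μ • M.φ T ∈ M.eigIdeal μ → T = 0)

namespace Quantization

variable {M : LadderModel U A B} {p q : ℕ} (Z : M.Quantization p q)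

theorem L3_sub : M.φ Z.L3 - (M.xi p q Z.μ + M.xi p q (-Z.μ)) ∈ M.eigIdeal Z.μ := by
  simpa using Z.L3_mul Z.μ Z.μ 1 (M.isEig_one Z.μ)

theorem L4_sub : Z.μ • M.φ Z.L4 - (M.xi p q Z.μ - M.xi p q (-Z.μ)) ∈ M.eigIdeal Z.μ := by
  simpa using Z.L4_mul Z.μ Z.μ 1 (M.isEig_one Z.μ)

theorem L_mul_up : M.φ M.L * M.xi p q Z.μ
    + (cst U (M.κ ^ 2) * (Z.μ + 2 * q) ^ 2) • M.xi p q Z.μ ∈ M.eigIdeal Z.μ := by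
  have h := (M.isEig_xi Z.ratio Z.μ).1
  rwa [angEq, add_mul, smul_mul_assoc, one_mul] at h

theorem L_mul_down : M.φ M.L * M.xi p q (-Z.μ)
    + (cst U (M.κ ^ 2) * (Z.μ - 2 * q) ^ 2) • M.xi p q (-Z.μ) ∈ M.eigIdeal Z.μ := by
  have h := (M.isEig_xi_neg Z.ratio Z.μ).1
  rwa [angEq, add_mul, smul_mul_assoc, one_mul] at h

theorem h_mul_up : M.φ M.h * M.xi p q Z.μ - M.E • M.xi p q Z.μ ∈ M.eigIdeal Z.μ :=
  (M.isEig_xi Z.ratio Z.μ).h_mul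

theorem h_mul_down : M.φ M.h * M.xi p q (-Z.μ) - M.E • M.xi p q (-Z.μ) ∈ M.eigIdeal Z.μ :=
  (M.isEig_xi_neg Z.ratio Z.μ).h_mul

theorem commute_h_L3 : M.h * Z.L3 - Z.L3 * M.h = 0 := by
  refine Z.eq_zero _ ?_
  have a0 := Z.L3_sub
  have f1 := Z.h_mul_up
  have f2 := Z.h_mul_down
  have f := M.enEq_mem Z.μ
  rw [enEq] at f
  -- the equations are combined so that their sum, expanded, is the commutator
  have key := sub_mem (add_mem (add_mem (mul_mem_eigIdeal M.h_mem a0) f1) f2)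
    (add_mem (mul_mem_eigIdeal Z.L3_mem f) (smul_mem_eigIdeal M.E a0))
  convert key using 1
  generalize M.xi p q Z.μ = X
  generalize M.xi p q (-Z.μ) = Y
  simp only [map_sub, map_mul, mul_sub, mul_add, mul_smul_comm, mul_one]
  module

theorem commute_h_L4 : M.h * Z.L4 - Z.L4 * M.h = 0 := by
  refine Z.eq_zero_of_mul _ ?_
  have a1 := Z.L4_sub
  have f1 := Z.h_mul_up
  have f2 := Z.h_mul_down
  have f := M.enEq_mem Z.μ
  rw [enEq] at f
  have key := sub_mem (sub_mem (add_mem (mul_mem_eigIdeal M.h_mem a1) f1) f2)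
    (add_mem (smul_mem_eigIdeal Z.μ (mul_mem_eigIdeal Z.L4_mem f)) (smul_mem_eigIdeal M.E a1))
  convert key using 1
  generalize M.xi p q Z.μ = X
  generalize M.xi p q (-Z.μ) = Y
  simp only [map_sub, map_mul, mul_sub, mul_smul_comm, mul_one]
  module

/-- `[L₂, L₄] = -4k²q L₃ - 4k²q² L₄`. -/
theorem L_L4 : M.L * Z.L4 - Z.L4 * M.L + (4 * M.κ ^ 2 * q) • Z.L3
    + (4 * M.κ ^ 2 * q ^ 2) • Z.L4 = 0 := by
  refine Z.eq_zero_of_mul _ ?_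
  have a0 := Z.L3_sub
  have a1 := Z.L4_sub
  have e1 := Z.L_mul_up
  have e2 := Z.L_mul_down
  have g := M.angEq_mem Z.μ
  rw [angEq] at g
  have key := add_mem (add_mem (add_mem (sub_mem (sub_mem (add_mem
    (mul_mem_eigIdeal M.L_mem a1) e1) e2)
    (smul_mem_eigIdeal Z.μ (mul_mem_eigIdeal Z.L4_mem g)))
    (smul_mem_eigIdeal (cst U (M.κ ^ 2) * Z.μ ^ 2) a1))
    (smul_mem_eigIdeal (4 * cst U (M.κ ^ 2) * q * Z.μ) a0))
    (smul_mem_eigIdeal (4 * cst U (M.κ ^ 2) * q ^ 2) a1)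
  convert key using 1
  generalize M.xi p q Z.μ = X
  generalize M.xi p q (-Z.μ) = Y
  simp only [map_add, map_sub, map_mul, mul_sub, mul_add, mul_smul_comm, mul_one, M.φ_smul, cst,
    map_pow, map_natCast, map_ofNat]
  module

/-- `[L₂, L₃] = 4q L₄ L₂ - 4k²q² L₃`. -/
theorem L_L3 : M.L * Z.L3 - Z.L3 * M.L - (4 * q : ℂ) • (Z.L4 * M.L)
    + (4 * M.κ ^ 2 * q ^ 2) • Z.L3 = 0 := by
  refine Z.eq_zero _ ?_
  have a0 := Z.L3_sub
  have a1 := Z.L4_sub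
  have e1 := Z.L_mul_up
  have e2 := Z.L_mul_down
  have g := M.angEq_mem Z.μ
  rw [angEq] at g
  have key := add_mem (add_mem (sub_mem (add_mem (sub_mem (add_mem (add_mem
    (mul_mem_eigIdeal M.L_mem a0) e1) e2)
    (mul_mem_eigIdeal Z.L3_mem g))
    (smul_mem_eigIdeal (cst U (M.κ ^ 2) * Z.μ ^ 2) a0))
    (smul_mem_eigIdeal (4 * q : U) (mul_mem_eigIdeal Z.L4_mem g)))
    (smul_mem_eigIdeal (4 * cst U (M.κ ^ 2) * q * Z.μ) a1))
    (smul_mem_eigIdeal (4 * cst U (M.κ ^ 2) * q ^ 2) a0)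
  convert key using 1
  generalize M.xi p q Z.μ = X
  generalize M.xi p q (-Z.μ) = Y
  simp only [map_add, map_sub, map_mul, mul_sub, mul_add, mul_smul_comm, mul_one, M.φ_smul, cst,
    map_pow, map_natCast, map_ofNat]
  module

/-- The value of `Ξ₋ Ξ₊` on the generic eigenfunction. -/
theorem down_up : M.xi p q (-(Z.μ + 2 * q)) * M.xi p q Z.μ - M.xiScal p q Z.μ • (1 : B)
    ∈ M.eigIdeal Z.μ := by
  rw [neg_add']
  exact M.xi_mul_xi Z.ratio Z.μ

/-- The value of `Ξ₊ Ξ₋` on the generic eigenfunction. -/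
theorem up_down : M.xi p q (Z.μ - 2 * q) * M.xi p q (-Z.μ) - M.xiScal p q (-Z.μ) • (1 : B)
    ∈ M.eigIdeal Z.μ := by
  have h := M.xi_mul_xi Z.ratio (-Z.μ)
  rwa [eigIdeal_neg, neg_neg] at h

/-- `[L₃, L₄] = 2q L₄² + 2P⁽⁻⁾`. -/
theorem L3_L4 : Z.L3 * Z.L4 - Z.L4 * Z.L3 - (2 * q : ℂ) • (Z.L4 * Z.L4) - (2 : ℂ) • Z.Pm = 0 := by
  refine Z.eq_zero_of_mul _ ?_
  have a0 := Z.L3_sub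
  have a1 := Z.L4_sub
  have b3 := Z.L3_mul _ _ _ (M.isEig_xi Z.ratio Z.μ)
  have b4 := Z.L4_mul _ _ _ (M.isEig_xi Z.ratio Z.μ)
  have b3' := Z.L3_mul _ _ _ (M.isEig_xi_neg Z.ratio Z.μ)
  have b4' := Z.L4_mul _ _ _ (M.isEig_xi_neg Z.ratio Z.μ)
  have c := Z.down_up
  have c' := Z.up_down
  have d := Z.Pm_mem
  have key := sub_mem (sub_mem (add_mem (sub_mem (sub_mem (sub_mem (add_mem (sub_mem (sub_mem
    (mul_mem_eigIdeal Z.L3_mem a1)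
    (smul_mem_eigIdeal Z.μ (mul_mem_eigIdeal Z.L4_mem a0)))
    (smul_mem_eigIdeal (2 * q : U) (mul_mem_eigIdeal Z.L4_mem a1))) b3) b3') b4) b4')
    (smul_mem_eigIdeal (2 : U) c)) (smul_mem_eigIdeal (2 : U) c')) (smul_mem_eigIdeal (2 : U) d)
  convert key using 1
  generalize M.xi p q (Z.μ + 2 * q) * M.xi p q Z.μ = YX
  generalize M.xi p q (-(Z.μ + 2 * q)) * M.xi p q Z.μ = ZX
  generalize M.xi p q (Z.μ - 2 * q) * M.xi p q (-Z.μ) = YY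
  generalize M.xi p q (-(Z.μ - 2 * q)) * M.xi p q (-Z.μ) = ZY
  generalize M.xi p q Z.μ = X
  generalize M.xi p q (-Z.μ) = Y
  simp only [map_sub, map_mul, mul_sub, mul_add, mul_smul_comm, M.φ_smul, cst, map_natCast,
    map_ofNat]
  module

/-- `(L₃ + q L₄)² = -q² L₄² - k⁻² L₄ L₂ L₄ + 2q P⁽⁻⁾ + 2P⁽⁺⁾`. -/
theorem L3_add_sq : (Z.L3 + (q : ℂ) • Z.L4) * (Z.L3 + (q : ℂ) • Z.L4)
    + ((q : ℂ) ^ 2) • (Z.L4 * Z.L4) + (M.κ ^ 2)⁻¹ • (Z.L4 * (M.L * Z.L4))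
    - (2 * q : ℂ) • Z.Pm - (2 : ℂ) • Z.Pp = 0 := by
  refine Z.eq_zero_of_mul _ ?_
  have a0 := Z.L3_sub
  have a1 := Z.L4_sub
  have b3 := Z.L3_mul _ _ _ (M.isEig_xi Z.ratio Z.μ)
  have b4 := Z.L4_mul _ _ _ (M.isEig_xi Z.ratio Z.μ)
  have b3' := Z.L3_mul _ _ _ (M.isEig_xi_neg Z.ratio Z.μ)
  have b4' := Z.L4_mul _ _ _ (M.isEig_xi_neg Z.ratio Z.μ)
  have c := Z.down_up
  have c' := Z.up_down
  have d := Z.Pm_mem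
  have d' := Z.Pp_mem
  have e1 := Z.L_mul_up
  have e2 := Z.L_mul_down
  have hκ : cst U ((M.κ ^ 2)⁻¹) * cst U (M.κ ^ 2) = 1 := by
    rw [← map_mul, inv_mul_cancel₀ (pow_ne_zero 2 M.κ_ne), map_one]
  have hS : M.φ Z.L3 + (q : U) • M.φ Z.L4 ∈ M.S := M.S.add_mem Z.L3_mem (M.smul_mem _ Z.L4_mem)
  -- `μ (L₃ + q L₄)` equals `(μ + q) Ξ₊ + (μ - q) Ξ₋` on the generic eigenfunction
  have k1 := mul_mem_eigIdeal hS (add_mem (smul_mem_eigIdeal Z.μ a0)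
    (smul_mem_eigIdeal (q : U) a1))
  have k2 := smul_mem_eigIdeal ((q : U) ^ 2) (mul_mem_eigIdeal Z.L4_mem a1)
  have k3 := smul_mem_eigIdeal (cst U ((M.κ ^ 2)⁻¹)) (mul_mem_eigIdeal Z.L4_mem
    (add_mem (mul_mem_eigIdeal M.L_mem a1) (sub_mem e1 e2)))
  have k4 := smul_mem_eigIdeal (Z.μ + q) (add_mem (sub_mem b3 b4)
    (smul_mem_eigIdeal (2 : U) c))
  have k5 := smul_mem_eigIdeal (Z.μ - q) (add_mem (add_mem b3' b4')
    (smul_mem_eigIdeal (2 : U) c'))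
  have key := sub_mem (sub_mem (add_mem (add_mem (add_mem (add_mem k1 k2) k3) k4) k5)
    (smul_mem_eigIdeal (2 * q : U) d)) (smul_mem_eigIdeal (2 * Z.μ) d')
  convert key using 1
  generalize M.xi p q (Z.μ + 2 * q) * M.xi p q Z.μ = YX
  generalize M.xi p q (-(Z.μ + 2 * q)) * M.xi p q Z.μ = ZX
  generalize M.xi p q (Z.μ - 2 * q) * M.xi p q (-Z.μ) = YY
  generalize M.xi p q (-(Z.μ - 2 * q)) * M.xi p q (-Z.μ) = ZY
  generalize M.xi p q Z.μ = X
  generalize M.xi p q (-Z.μ) = Y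
  have hκ1 : ∀ u : U, cst U ((M.κ ^ 2)⁻¹) * (cst U (M.κ ^ 2) * u) = u := fun u => by
    rw [← mul_assoc, hκ, one_mul]
  simp only [map_add, map_sub, map_mul, mul_sub, mul_add, add_mul, smul_mul_assoc, smul_sub,
    smul_add, smul_smul, mul_smul_comm, M.φ_smul, hκ1]
  simp only [cst, map_natCast, map_ofNat, map_pow]
  module

/-- The operator `R = [L₂, L₄]`. -/
def R : A := -((4 * M.κ ^ 2 * q) • Z.L3) - (4 * M.κ ^ 2 * q ^ 2) • Z.L4

theorem lie_L_L4 : M.L * Z.L4 - Z.L4 * M.L = Z.R := by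
  have h := Z.L_L4
  rw [R]
  linear_combination (norm := module) (1 : ℂ) • h

theorem lie_L_R : M.L * Z.R - Z.R * M.L = -((8 * M.κ ^ 2 * q ^ 2) • (M.L * Z.L4 + Z.L4 * M.L))
    - (16 * M.κ ^ 4 * q ^ 4) • Z.L4 := by
  have h1 := Z.L_L4
  have h2 := Z.L_L3
  simp only [R, mul_sub, mul_neg, mul_smul_comm, sub_mul, neg_mul, smul_mul_assoc]
  linear_combination (norm := module) (-(4 * M.κ ^ 2 * q)) • h2 + (4 * M.κ ^ 2 * q ^ 2) • h1

theorem lie_L4_R : Z.L4 * Z.R - Z.R * Z.L4 = (8 * M.κ ^ 2 * q ^ 2) • (Z.L4 * Z.L4)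
    + (8 * M.κ ^ 2 * q) • Z.Pm := by
  have h := Z.L3_L4
  simp only [R, mul_sub, mul_neg, mul_smul_comm, sub_mul, neg_mul, smul_mul_assoc]
  linear_combination (norm := module) (4 * M.κ ^ 2 * q) • h

/-- The quadratic relation is `L3_add_sq`, with `{L₂, L₄, L₄}` brought to the form `6 L₄ L₂ L₄` by
means of the commutators `[L₂, L₄]` and `[L₃, L₄]`. -/
theorem R_sq (hq : (q : ℂ) ≠ 0) : (3 / (8 * M.κ ^ 2 * q ^ 2)) • (Z.R * Z.R)
    = -((22 * M.κ ^ 2 * q ^ 2) • (Z.L4 * Z.L4))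
      - (M.L * Z.L4 * Z.L4 + M.L * Z.L4 * Z.L4 + Z.L4 * M.L * Z.L4 + Z.L4 * Z.L4 * M.L
        + Z.L4 * M.L * Z.L4 + Z.L4 * Z.L4 * M.L)
      - (4 * M.κ ^ 2 * q) • Z.Pm + (12 * M.κ ^ 2) • Z.Pp := by
  have hκ := M.κ_ne
  have h1 := congrArg (fun T => T * Z.L4) Z.L_L4
  have h2 := congrArg (fun T => Z.L4 * T) Z.L_L4
  have h3 := Z.L3_L4
  have h4 := Z.L3_add_sq
  have e : Z.R = (-(4 * M.κ ^ 2 * q)) • (Z.L3 + (q : ℂ) • Z.L4) := by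
    rw [R]; module
  have e2 : (3 / (8 * M.κ ^ 2 * q ^ 2)) • (Z.R * Z.R)
      = (6 * M.κ ^ 2) • ((Z.L3 + (q : ℂ) • Z.L4) * (Z.L3 + (q : ℂ) • Z.L4)) := by
    rw [e, smul_mul_assoc, mul_smul_comm, smul_smul, smul_smul]
    congr 1
    field_simp
    norm_num
  have e3 : (6 * M.κ ^ 2) • ((M.κ ^ 2)⁻¹ • (Z.L4 * (M.L * Z.L4)))
      = (6 : ℂ) • (Z.L4 * (M.L * Z.L4)) := by
    rw [smul_smul]
    congr 1
    field_simp
  generalize (Z.L3 + (q : ℂ) • Z.L4) * (Z.L3 + (q : ℂ) • Z.L4) = W at h4 e2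
  have h5 := congrArg (fun T => (6 * M.κ ^ 2) • T) h4
  simp only [smul_add, smul_sub, e3, smul_zero] at h5
  rw [← e2] at h5
  simp only [add_mul, sub_mul, smul_mul_assoc, zero_mul] at h1
  simp only [mul_add, mul_sub, mul_smul_comm, mul_zero] at h2
  simp only [mul_assoc] at h1 h2 h5 ⊢
  linear_combination (norm := module) h5 + (2 : ℂ) • h1 - (2 : ℂ) • h2 - (8 * M.κ ^ 2 * q) • h3

/-- On an eigenfunction a polynomial in `H` may be replaced by its value. -/
theorem aeval_h_sub_mem (m : U) (Q : Polynomial ℂ) :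
    M.φ (Polynomial.aeval M.h Q) - Polynomial.aeval M.E Q • (1 : B) ∈ M.eigIdeal m := by
  induction Q using Polynomial.induction_on' with
  | add P Q hP hQ =>
    have h := add_mem hP hQ
    convert h using 1
    rw [map_add, map_add, map_add, add_smul]
    abel
  | monomial n z =>
    have h := smul_mem_eigIdeal (cst U z) (pow_mul_sub_mem M.h_mem (M.isEig_one m).h_mul n)
    convert h using 1
    rw [Polynomial.aeval_monomial, Polynomial.aeval_monomial, ← Algebra.smul_def, M.φ_smul, map_pow,
      mul_smul, mul_one, smul_sub]

/-- On eigenvectors with `μ = q` the operator `L₃ - q L₄` is a function of the energy. -/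
theorem L3_sub_L4_self (Q : Polynomial ℂ)
    (hQ : Polynomial.aeval M.E Q = -2 * (selfScalar (kScal M.ω M.E) (-(cst U (1 / 4) * M.E))
      (cst U (1 / 2)) p * selfScalar (jScal M.a M.b) (-cst U ((M.a ^ 2 - M.b ^ 2) / 2))
      (cst U (1 / 2)) q)) :
    M.φ (Z.L3 - (q : ℂ) • Z.L4 + Polynomial.aeval M.h Q) ∈ M.eigIdeal (q : U) := by
  have h1 := M.isEig_one (q : U)
  have a0 := Z.L3_mul _ _ _ h1
  have a1 := Z.L4_mul _ _ _ h1
  have c := M.xi_self Z.ratio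
  have hQh := aeval_h_sub_mem (M := M) (q : U) Q
  have key := add_mem (add_mem (sub_mem a0 a1) hQh) (smul_mem_eigIdeal (2 : U) c)
  convert key using 1
  rw [hQ]
  simp only [map_add, map_sub, M.φ_smul, cst, map_natCast, mul_one]
  module

end Quantization

end LadderModel

end TTW

end

noncomputable section

namespace TTW

/-! ### Evaluation of operator polynomials -/

section Evaluation

open Polynomial

variable {A T : Type*} [Ring A] [Ring T] (f : A →+* T) (m e : T)
  (hm : ∀ a, Commute (f a) m) (he : ∀ a, Commute (f a) e) (hme : Commute m e)

include hm he hme in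
theorem commute_eval₂ (F : A[X]) : Commute (eval₂RingHom' f m hm F) e := by
  rw [show eval₂RingHom' f m hm F = F.eval₂ f m from rfl, eval₂_eq_sum, Polynomial.sum]
  exact Commute.sum_left _ _ _ fun i _ => (he _).mul_left (hme.pow_left i)

/-- Evaluation of polynomials in two indeterminates with noncommuting coefficients, at commuting
elements that commute with the coefficients. -/
def evalHom : A[X][X] →+* T :=
  eval₂RingHom' (eval₂RingHom' f m hm) e (commute_eval₂ f m e hm he hme)

theorem evalHom_eq_sum (F : A[X][X]) : evalHom f m e hm he hme F
    = F.sum fun j G => G.sum fun i a => f a * m ^ i * e ^ j := by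
  rw [show evalHom f m e hm he hme F = F.eval₂ (eval₂RingHom' f m hm) e from rfl, eval₂_eq_sum]
  refine Finset.sum_congr rfl fun j _ => ?_
  change (F.coeff j).eval₂ f m * e ^ j = _
  rw [eval₂_eq_sum, Polynomial.sum, Finset.sum_mul]
  rfl

@[simp] theorem evalHom_C_C (a : A) : evalHom f m e hm he hme (C (C a)) = f a := by
  change eval₂ _ _ (C (C a)) = _
  rw [eval₂_C]
  exact eval₂_C _ _

@[simp] theorem evalHom_C_X : evalHom f m e hm he hme (C X) = m := by
  change eval₂ _ _ (C X) = _
  rw [eval₂_C]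
  exact eval₂_X _ _

@[simp] theorem evalHom_X : evalHom f m e hm he hme X = e := by
  change eval₂ _ _ X = _
  exact eval₂_X _ _

theorem evalHom_mem (S : Subring T) (hmS : m ∈ S) (heS : e ∈ S) (F : A[X][X])
    (hF : ∀ i j, f ((F.coeff j).coeff i) ∈ S) : evalHom f m e hm he hme F ∈ S := by
  rw [evalHom_eq_sum]
  exact S.sum_mem fun j _ => S.sum_mem fun i _ =>
    S.mul_mem (S.mul_mem (hF i j) (S.pow_mem hmS i)) (S.pow_mem heS j)

/-- Homomorphisms on polynomials in two indeterminates agree if they agree on the coefficients and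
the indeterminates. -/
theorem hom_ext_two {g h : A[X][X] →+* T} (h1 : ∀ a, g (C (C a)) = h (C (C a)))
    (h2 : g (C X) = h (C X)) (h3 : g X = h X) : g = h := by
  refine ringHom_ext' (ringHom_ext' ?_ ?_) h3
  · ext a
    exact h1 a
  · exact h2

end Evaluation

end TTW

end

noncomputable section

namespace TTW

section Model

variable {k : ℝ}

/-! ### Operator polynomials with differential coefficients -/

variable (k) in
/-- The operator polynomials whose coefficients are differential operators. -/
def diffPolys : Subring (OpPoly k) where
  carrier := {F | ∀ i j, (F.coeff j).coeff i ∈ diffOps k}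
  mul_mem' := fun {F G} hF hG i j => by
    rw [Polynomial.coeff_mul, Polynomial.finsetSum_coeff]
    refine (diffOps k).sum_mem fun x _ => ?_
    rw [Polynomial.coeff_mul]
    exact (diffOps k).sum_mem fun y _ => (diffOps k).mul_mem (hF _ _) (hG _ _)
  one_mem' := fun i j => by
    rw [Polynomial.coeff_one]
    split_ifs
    · rw [Polynomial.coeff_one]
      split_ifs
      · exact (diffOps k).one_mem
      · exact (diffOps k).zero_mem
    · exact (diffOps k).zero_mem
  add_mem' := fun {F G} hF hG i j => by
    rw [Polynomial.coeff_add, Polynomial.coeff_add]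
    exact (diffOps k).add_mem (hF i j) (hG i j)
  zero_mem' := fun i j => (diffOps k).zero_mem
  neg_mem' := fun {F} hF i j => by
    rw [Polynomial.coeff_neg, Polynomial.coeff_neg]
    exact (diffOps k).neg_mem (hF i j)

theorem constHom_mem {T : Op k} (hT : T ∈ diffOps k) : constHom k T ∈ diffPolys k := by
  intro i j
  simp only [constHom, RingHom.comp_apply, Polynomial.coeff_C]
  split_ifs
  · rw [Polynomial.coeff_C]
    split_ifs
    · exact hT
    · exact (diffOps k).zero_mem
  · exact (diffOps k).zero_mem

theorem algebraMap_mem (u : Cen) : algebraMap Cen (OpPoly k) u ∈ diffPolys k := by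
  intro i j
  rw [algebraMap_cen, cenHom, Polynomial.coe_mapRingHom, Polynomial.coeff_map,
    Polynomial.coe_mapRingHom, Polynomial.coeff_map, Algebra.algebraMap_eq_smul_one]
  exact smul_mem_diffOps _ (diffOps k).one_mem

theorem mulOp_mem (f : Smooth k) : mulOp f ∈ diffOps k := (orderLE_mulOp f).mem

theorem invR_mem : invR k ∈ diffOps k := invR_eq (k := k) ▸ mulOp_mem _
theorem rSq_mem : rSq k ∈ diffOps k := rSq_eq (k := k) ▸ mulOp_mem _
theorem cosTwo_mem : cosTwo k ∈ diffOps k := cosTwo_eq (k := k) ▸ mulOp_mem _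
theorem sinTwo_mem : sinTwo k ∈ diffOps k := sinTwo_eq (k := k) ▸ mulOp_mem _
theorem dX_mem : dX k ∈ diffOps k :=
  (diffOps k).neg_mem (smul_mem_diffOps _ ((diffOps k).mul_mem sinTwo_mem orderLE_dθ.mem))
theorem dR_mem : dR k ∈ diffOps k :=
  smul_mem_diffOps _ ((diffOps k).mul_mem invR_mem orderLE_dr.mem)
theorem L2_mem (a b : ℂ) : L2 k a b ∈ diffOps k :=
  (diffOps k).add_mem ((diffOps k).add_mem ((diffOps k).pow_mem orderLE_dθ.mem 2)
    (smul_mem_diffOps _ orderLE_invSinSq.mem)) (smul_mem_diffOps _ orderLE_invCosSq.mem)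
theorem H_mem (ω a b : ℂ) : H k ω a b ∈ diffOps k := by
  rw [H_eq]
  exact (diffOps k).add_mem (smul_mem_diffOps _ ((diffOps k).mul_mem rSq_mem ((diffOps k).sub_mem
    ((diffOps k).add_mem ((diffOps k).mul_mem dR_mem dR_mem) ((diffOps k).mul_mem
    ((diffOps k).pow_mem invR_mem 2) dR_mem)) (smul_mem_diffOps _ (diffOps k).one_mem))))
    ((diffOps k).mul_mem ((diffOps k).pow_mem invR_mem 2) (L2_mem a b))


theorem cst_cen (c : ℂ) : cst Cen c = cU c := rfl

/-- The separated operators of the quantum TTW system form a ladder model. -/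
def opModel (k : ℝ) (hk : k ≠ 0) (ω a b : ℂ) : LadderModel Cen (Op k) (OpPoly k) where
  E := eU
  φ := constHom k
  φ_smul := constHom_smul
  κ := k
  ω := ω
  a := a
  b := b
  κ_ne := Complex.ofReal_ne_zero.2 hk
  d := dX k
  x := cosTwo k
  D := dR k
  y := invR k ^ 2
  ϱ := rSq k
  w := wOp k
  L := L2 k a b
  h := H k ω a b
  d_mul_x := dX_mul_cosTwo hk
  D_mul_y := dR_mul_invR_sq
  comm_d_D := isAngular_dX.commute_dR
  comm_d_y := isAngular_dX.2.1.pow_right 2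
  comm_x_D := isAngular_cosTwo.commute_dR
  comm_x_y := isAngular_cosTwo.2.1.pow_right 2
  comm_L_D := (isAngular_L2 a b).commute_dR
  comm_L_y := (isAngular_L2 a b).2.1.pow_right 2
  one_sub_mul_L := by
    rw [L2_eq hk, mul_smul_comm, ← mul_assoc, one_sub_mul_wOp, one_mul]
  w_mul := wOp_mul
  ϱ_mul := by rw [pow_two]; exact rSq_mul_invR_sq
  mul_ϱ := by
    have h := rSq_mul_invR_sq (k := k)
    rw [rSq_eq, invR_eq, ← mulOp_mul, ← mulOp_mul] at h
    rw [rSq_eq, invR_eq, pow_two, ← mulOp_mul, ← mulOp_mul, mul_comm, h]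
  h_eq := H_eq ω a b
  S := diffPolys k
  scalar_mem := algebraMap_mem
  d_mem := constHom_mem dX_mem
  x_mem := constHom_mem cosTwo_mem
  D_mem := constHom_mem dR_mem
  y_mem := constHom_mem ((diffOps k).pow_mem invR_mem 2)
  ϱ_mem := constHom_mem rSq_mem
  w_mem := constHom_mem (mulOp_mem _)
  L_mem := constHom_mem (L2_mem a b)
  h_mem := constHom_mem (H_mem ω a b)

end Model

end TTW

end

noncomputable section

namespace TTW

/-! ### The raising and lowering operators in the ladder model -/

section XiOperators

theorem prod_reverse_range {U B : Type*} [CommRing U] [Ring B] (J : U → B) (n : ℕ) (s : U) :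
    ((List.range n).reverse.map fun j : ℕ => J (s + j)).prod = upChain J n s := by
  induction n with
  | zero => rfl
  | succ n ih => rw [List.range_succ, List.reverse_append, List.map_append, List.prod_append, ih,
      upChain_succ]; simp

theorem map_bind_pure {α β γ : Type} (l : List α) (f : α → β) (g : β → γ) :
    (l >>= fun a => pure (f a)).map g = l.map fun a => g (f a) := by
  induction l with
  | nil => rfl
  | cons x l ih => simpa using ih

variable {k : ℝ} (hk : k ≠ 0) (ω a b : ℂ)

theorem cenHom_mul (u : Cen) (F : OpPoly k) : cenHom k u * F = u • F := (Algebra.smul_def u F).symm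

theorem two_mul_half (n : Cen) : 2 * half n = n + 1 := by
  unfold half; linear_combination (n + 1) * two_mul_cst (U := Cen)

theorem half_mul (n : Cen) : half n * (2 * half n - 1) = cU (1 / 2) * (n * (n + 1)) := by
  have h4 : half n = cU (1 / 2) * (n + 1) := rfl
  linear_combination (half n) * two_mul_half n + n * h4

theorem jPlus_eq (n : Cen) : jPlus k a b (cenHom k n) = (opModel k hk ω a b).jLad (half n) := by
  have e : (opModel k hk ω a b).jLad (half n) = jacobiUp (constHom k (dX k)) (constHom k (cosTwo k))
    (cU ((a ^ 2 - b ^ 2) / 2)) (half n) := rfl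
  rw [e, jacobiUp, jPlus, half_mul, two_mul_half, ← cU_smul, ← cU_smul, ← cenHom_mul, ← cenHom_mul,
    ← cenHom_mul, ← cenHom_mul, constOp_eq, constOp_eq, map_add, map_one, map_mul,
    map_mul, map_add, map_one, mul_assoc, mul_assoc, mul_assoc]

theorem jMinus_eq (n : Cen) : jMinus k a b (cenHom k n) = (opModel k hk ω a b).jLad (half (-n)) := by
  rw [← jPlus_eq, map_neg, jPlus, jMinus, neg_add_eq_sub, neg_mul, neg_mul, smul_neg, sub_neg_eq_add]

theorem kPlus_eq (n : Cen) : kPlus k (cenHom k n) = (opModel k hk ω a b).kLad (half n) := by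
  have e : (opModel k hk ω a b).kLad (half n) = laguerreUp (constHom k (dR k))
    (constHom k (invR k ^ 2)) (cU (1 / 4) * eU) (half n) := rfl
  rw [e, laguerreUp, kPlus, half_mul, two_mul_half, ← cU_smul, ← cU_smul, ← cenHom_mul,
    ← cenHom_mul, ← cenHom_mul, ← cenHom_mul, ← cenHom_mul, constOp_eq, constOp_eq, map_add, map_one,
    map_mul, map_mul, map_add, map_one, map_mul, cenHom_eU, mul_one, sub_right_comm, mul_assoc,
    mul_assoc, mul_assoc]

theorem kMinus_eq (n : Cen) : kMinus k (cenHom k n) = (opModel k hk ω a b).kLad (half (-n)) := by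
  rw [← kPlus_eq, map_neg, kPlus, kMinus, neg_add_eq_sub, neg_mul, neg_mul, smul_neg, sub_neg_eq_add]

variable {p q : ℕ} (hr : ratio p q ≠ 0)

theorem half_add' (m : Cen) (j : ℕ) : half (m + 2 * j) = half m + j := by
  unfold half
  linear_combination (j : Cen) * two_mul_cst (U := Cen)

theorem ratio_smul_muVar : (ratio p q : ℂ) • muVar (ratio p q)
    = cenHom (ratio p q) (cst Cen (ratio p q : ℂ) * muU) := by
  rw [map_mul, cenHom_muU, cenHom_mul, cst_cen, cU_smul]

/-- `Ξ₊` in terms of the ladder model. -/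
theorem xiPlus_eq : xiPlus p q a b = (opModel (ratio p q) hr ω a b).xi p q muU := by
  rw [xiPlus, LadderModel.xi, ← prod_reverse_range, ← prod_reverse_range]
  have e1 : ∀ j : ℕ, kPlus (ratio p q) ((ratio p q : ℂ) • muVar _ + 2 * (j : OpPoly (ratio p q)))
      = (opModel (ratio p q) hr ω a b).kLad (half (cst Cen (ratio p q : ℂ) * muU) + (j : Cen)) := by
    intro j
    rw [← half_add', ← kPlus_eq, map_add, ratio_smul_muVar, map_mul (cenHom _) 2, map_ofNat, map_natCast]
  have e2 : ∀ j : ℕ, jPlus (ratio p q) a b (muVar _ + 2 * (j : OpPoly (ratio p q)))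
      = (opModel (ratio p q) hr ω a b).jLad (half muU + (j : Cen)) := by
    intro j
    rw [← half_add', ← jPlus_eq, map_add, cenHom_muU, map_mul, map_ofNat, map_natCast]
  rw [map_bind_pure, map_bind_pure, List.map_congr_left fun j _ => e1 j,
    List.map_congr_left fun j _ => e2 j]
  rfl

/-- `Ξ₋` in terms of the ladder model. -/
theorem xiMinus_eq : xiMinus p q a b = (opModel (ratio p q) hr ω a b).xi p q (-muU) := by
  rw [xiMinus, LadderModel.xi, ← prod_reverse_range, ← prod_reverse_range]
  have e1 : ∀ j : ℕ, kMinus (ratio p q) ((ratio p q : ℂ) • muVar _ - 2 * (j : OpPoly (ratio p q)))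
      = (opModel (ratio p q) hr ω a b).kLad (half (cst Cen (ratio p q : ℂ) * -muU) + (j : Cen)) := by
    intro j
    have h : cst Cen (ratio p q : ℂ) * -muU + 2 * j = -(cst Cen (ratio p q : ℂ) * muU - 2 * j) := by
      ring
    rw [← half_add', h, ← kMinus_eq, map_sub, ratio_smul_muVar, map_mul (cenHom _) 2, map_ofNat,
      map_natCast]
  have e2 : ∀ j : ℕ, jMinus (ratio p q) a b (muVar _ - 2 * (j : OpPoly (ratio p q)))
      = (opModel (ratio p q) hr ω a b).jLad (half (-muU) + (j : Cen)) := by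
    intro j
    have h : -muU + 2 * (j : Cen) = -(muU - 2 * j) := by ring
    rw [← half_add', h, ← jMinus_eq, map_sub, cenHom_muU, map_mul, map_ofNat, map_natCast]
  rw [map_bind_pure, map_bind_pure, List.map_congr_left fun j _ => e1 j,
    List.map_congr_left fun j _ => e2 j]
  rfl

end XiOperators

/-! ### Parity in `μ` -/

section Substitution

variable (k : ℝ)

theorem commute_constHom_cenHom (m : Cen) (T : Op k) : Commute (constHom k T) (cenHom k m) :=
  (commute_cenHom m _).symm

/-- Substitution of a scalar polynomial for `μ`. -/
def substMu (m : Cen) : OpPoly k →+* OpPoly k :=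
  evalHom (constHom k) (cenHom k m) (eVar k) (commute_constHom_cenHom k m)
    (fun T => by rw [← cenHom_eU]; exact commute_constHom_cenHom k eU T) (commute_cenHom m _)

variable {k}

theorem substMu_constHom (m : Cen) (T : Op k) : substMu k m (constHom k T) = constHom k T :=
  evalHom_C_C _ _ _ _ _ _ _

theorem substMu_muVar (m : Cen) : substMu k m (muVar k) = cenHom k m := evalHom_C_X _ _ _ _ _ _

theorem substMu_eVar (m : Cen) : substMu k m (eVar k) = eVar k := evalHom_X _ _ _ _ _ _

/-- Substitution of a scalar polynomial for `μ` in scalar polynomials. -/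
def substCen (m : Cen) : Cen →+* Cen :=
  Polynomial.eval₂RingHom (Polynomial.eval₂RingHom cUHom m) eU

theorem substCen_cU (m : Cen) (c : ℂ) : substCen m (cU c) = cU c := by
  simp [substCen, cU, cUHom]

theorem substCen_muU (m : Cen) : substCen m muU = m := by
  simp [substCen, muU]

theorem substCen_eU (m : Cen) : substCen m eU = eU := by
  simp [substCen, eU]

theorem cenHom_C_C (c : ℂ) : cenHom k (Polynomial.C (Polynomial.C c)) = constHom k (algebraMap ℂ _ c) := by
  simp [cenHom, constHom]

theorem substMu_cenHom (m u : Cen) : substMu k m (cenHom k u) = cenHom k (substCen m u) := by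
  have h : (substMu k m).comp (cenHom k) = (cenHom k).comp (substCen m) := by
    refine hom_ext_two (fun c => ?_) ?_ ?_
    · rw [RingHom.comp_apply, cenHom_C_C, substMu_constHom, RingHom.comp_apply,
        ← cenHom_C_C]
      exact congrArg _ (substCen_cU m c).symm
    · exact (congrArg (substMu k m) cenHom_muU).trans ((substMu_muVar m).trans
        (congrArg (cenHom k) (substCen_muU m).symm))
    · exact (congrArg (substMu k m) cenHom_eU).trans ((substMu_eVar m).trans
        (cenHom_eU.symm.trans (congrArg (cenHom k) (substCen_eU m).symm)))
  exact congrArg (fun f => f u) h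

theorem substMu_smul (m u : Cen) (F : OpPoly k) :
    substMu k m (u • F) = substCen m u • substMu k m F := by
  rw [← cenHom_mul, map_mul, substMu_cenHom, cenHom_mul]

variable (hk : k ≠ 0) (ω a b : ℂ)

theorem substMu_jLad (m s : Cen) : substMu k m ((opModel k hk ω a b).jLad s)
    = (opModel k hk ω a b).jLad (substCen m s) := by
  have e : ∀ s, (opModel k hk ω a b).jLad s = jacobiUp (constHom k (dX k)) (constHom k (cosTwo k))
    (cU ((a ^ 2 - b ^ 2) / 2)) s := fun _ => rfl
  rw [e, e, jacobiUp, jacobiUp, map_sub, map_sub, substMu_smul, substMu_smul, substMu_smul,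
    substMu_constHom, substMu_constHom, substCen_cU, map_one, map_mul, map_mul, map_sub, map_mul,
    map_ofNat, map_one]

theorem substMu_kLad (m s : Cen) : substMu k m ((opModel k hk ω a b).kLad s)
    = (opModel k hk ω a b).kLad (substCen m s) := by
  have e : ∀ s, (opModel k hk ω a b).kLad s = laguerreUp (constHom k (dR k))
    (constHom k (invR k ^ 2)) (cU (1 / 4) * eU) s := fun _ => rfl
  rw [e, e, laguerreUp, laguerreUp, map_sub, map_sub, substMu_smul, substMu_smul, substMu_smul,
    substMu_constHom, substMu_constHom, map_mul (substCen m) (cU _), substCen_cU, substCen_eU,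
    map_one, map_mul, map_mul, map_sub, map_mul, map_ofNat, map_one]

/-- Substituting for `μ` in `Ξ₊` substitutes in its parameter. -/
theorem substMu_xi (m u : Cen) (p q : ℕ) : substMu k m ((opModel k hk ω a b).xi p q u)
    = (opModel k hk ω a b).xi p q (substCen m u) := by
  have h : ∀ (J : Cen → OpPoly k) (_ : ∀ s, substMu k m (J s) = J (substCen m s)) (n : ℕ) (s : Cen),
      substMu k m (upChain J n s) = upChain J n (substCen m s) := by
    intro J hJ n s
    induction n with
    | zero => exact map_one _
    | succ n ih => rw [upChain_succ, map_mul, ih, hJ, map_add, map_natCast, upChain_succ]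
  have hh : ∀ u : Cen, substCen m (half u) = half (substCen m u) := by
    intro u
    unfold half
    rw [map_mul, map_add, map_one, cst_cen, substCen_cU]
  rw [LadderModel.xi, LadderModel.xi, map_mul, h _ (substMu_kLad hk ω a b m),
    h _ (substMu_jLad hk ω a b m), hh, hh, map_mul (substCen m), cst_cen, substCen_cU]

end Substitution

section Parity

variable {k : ℝ}

theorem coeff_coeff_monomial {A : Type*} [Semiring A] (T : A) (i j i' j' : ℕ) :
    ((Polynomial.C (Polynomial.C T * Polynomial.X ^ i') * Polynomial.X ^ j').coeff j).coeff i
      = if j = j' then if i = i' then T else 0 else 0 := by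
  rw [Polynomial.coeff_C_mul_X_pow]
  split_ifs <;> simp_all

/-- The substitution `μ ↦ -μ` changes the sign of the odd coefficients. -/
theorem coeffOp_substMu_neg (F : OpPoly k) (i j : ℕ) :
    coeffOp (substMu k (-muU) F) i j = (-1) ^ i * coeffOp F i j := by
  have e : ∀ (T : Op k) (i' j' : ℕ), constHom k T * cenHom k (-muU) ^ i' * eVar k ^ j'
      = Polynomial.C (Polynomial.C ((-1) ^ i' * T) * Polynomial.X ^ i') * Polynomial.X ^ j' := by
    intro T i' j'
    rw [map_neg, cenHom_muU, neg_pow, eVar, muVar, constHom]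
    simp only [RingHom.comp_apply, map_mul, map_pow, map_neg, map_one, ← mul_assoc]
    congr 2
    exact ((Commute.one_right _).neg_right.pow_right _).eq
  have h : substMu k (-muU) F = F.sum fun j' G => G.sum fun i' T =>
      Polynomial.C (Polynomial.C ((-1) ^ i' * T) * Polynomial.X ^ i') * Polynomial.X ^ j' := by
    rw [substMu, evalHom_eq_sum]
    exact Finset.sum_congr rfl fun j' _ => Finset.sum_congr rfl fun i' _ => e _ _ _
  have hT : ∀ F : OpPoly k, coeffOp F i j = (F.coeff j).coeff i := fun _ => rfl
  rw [hT, hT, h, Polynomial.sum, Polynomial.finsetSum_coeff, Polynomial.finsetSum_coeff,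
    Finset.sum_eq_single j]
  · rw [Polynomial.sum, Polynomial.finsetSum_coeff, Polynomial.finsetSum_coeff,
      Finset.sum_eq_single i]
    · rw [coeff_coeff_monomial, if_pos rfl, if_pos rfl]
    · intro i' _ hi
      rw [coeff_coeff_monomial, if_pos rfl, if_neg hi.symm]
    · intro hi
      rw [Polynomial.notMem_support_iff.1 hi, mul_zero, coeff_coeff_monomial, ite_self, ite_self]
  · intro j' _ hj
    rw [Polynomial.sum, Polynomial.finsetSum_coeff, Polynomial.finsetSum_coeff]
    refine Finset.sum_eq_zero fun i' _ => ?_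
    rw [coeff_coeff_monomial, if_neg hj.symm]
  · intro hj
    rw [Polynomial.notMem_support_iff.1 hj, Polynomial.sum_zero_index, Polynomial.coeff_zero,
      Polynomial.coeff_zero]

variable {p q : ℕ} (hr : ratio p q ≠ 0) (a b : ℂ)

include hr in
theorem substMu_neg_xiPlus : substMu _ (-muU) (xiPlus p q a b) = xiMinus p q a b := by
  rw [xiPlus_eq 0 a b hr, xiMinus_eq 0 a b hr, substMu_xi, substCen_muU]

include hr in
theorem substMu_neg_xiMinus : substMu _ (-muU) (xiMinus p q a b) = xiPlus p q a b := by
  rw [xiPlus_eq 0 a b hr, xiMinus_eq 0 a b hr, substMu_xi, map_neg, substCen_muU, neg_neg]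

/-- Operators have no 2-torsion. -/
theorem op_eq_zero_of_eq_neg {T : Op k} (h : T = -T) : T = 0 := by
  have h2 : (2 : ℂ) • T = 0 := by
    rw [two_smul]
    nth_rewrite 2 [h]
    exact add_neg_cancel T
  exact (smul_eq_zero.1 h2).resolve_left two_ne_zero

include hr in
/-- `Ξ₊ + Ξ₋` is even in `μ`. -/
theorem coeffOp_xi_add (i j : ℕ) (hi : Odd i) :
    coeffOp (xiPlus p q a b + xiMinus p q a b) i j = 0 := by
  have h := coeffOp_substMu_neg (xiPlus p q a b + xiMinus p q a b) i j
  rw [map_add, substMu_neg_xiPlus hr, substMu_neg_xiMinus hr, add_comm, hi.neg_one_pow,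
    neg_one_mul] at h
  exact op_eq_zero_of_eq_neg h

include hr in
/-- `Ξ₊ - Ξ₋` is odd in `μ`. -/
theorem coeffOp_xi_sub (i j : ℕ) (hi : Even i) :
    coeffOp (xiPlus p q a b - xiMinus p q a b) i j = 0 := by
  have h := coeffOp_substMu_neg (xiPlus p q a b - xiMinus p q a b) i j
  rw [map_sub, substMu_neg_xiPlus hr, substMu_neg_xiMinus hr, ← neg_sub, hi.neg_one_pow,
    one_mul] at h
  refine op_eq_zero_of_eq_neg (h.symm.trans ?_)
  simp only [coeffOp, Polynomial.coeff_neg]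

end Parity

end TTW

end

noncomputable section

namespace TTW

/-! ### Substitution of operators for the spectral parameters -/

section Quantize

variable {k : ℝ} (hk : k ≠ 0) (ω a b : ℂ)

theorem substMu_eq_sum (m : Cen) (F Φ : OpPoly k) : substMu k m F * Φ
    = ∑ j ∈ F.support, ∑ i ∈ (F.coeff j).support,
      (m ^ i * eU ^ j) • (constHom k ((F.coeff j).coeff i) * Φ) := by
  rw [substMu, evalHom_eq_sum, Polynomial.sum, Finset.sum_mul]
  refine Finset.sum_congr rfl fun j _ => ?_
  rw [Polynomial.sum, Finset.sum_mul]
  refine Finset.sum_congr rfl fun i _ => ?_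
  rw [← cenHom_mul, map_mul, map_pow, map_pow, cenHom_eU, ← mul_assoc, mul_assoc (constHom k _)]
  congr 1
  rw [← cenHom_eU, ← map_pow, ← map_pow, ← map_mul]
  exact (commute_cenHom _ _).eq.symm

/-- On an eigenfunction, `quantize F` acts as `F` with each power `μ ^ i` lowered to an even power. -/
theorem quantize_mul_mem {F : OpPoly k} (hF : F ∈ diffPolys k) {m₀ m : Cen} {Φ : OpPoly k}
    (h : (opModel k hk ω a b).IsEig m₀ m Φ) :
    constHom k (quantize ω a b F) * Φ - ∑ j ∈ F.support, ∑ i ∈ (F.coeff j).support,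
      (m ^ (2 * (i / 2)) * eU ^ j) • (constHom k ((F.coeff j).coeff i) * Φ)
      ∈ (opModel k hk ω a b).eigIdeal m₀ := by
  rw [quantize, Polynomial.sum, map_sum, Finset.sum_mul, ← Finset.sum_sub_distrib]
  refine sum_mem fun j _ => ?_
  rw [Polynomial.sum, map_sum, Finset.sum_mul, ← Finset.sum_sub_distrib]
  exact sum_mem fun i _ => h.monomial (constHom_mem (hF i j)) (i / 2) j

/-- Quantizing a polynomial that is even in `μ`. -/
theorem quantize_even {F : OpPoly k} (hF : F ∈ diffPolys k)
    (hodd : ∀ i j, Odd i → coeffOp F i j = 0) {m₀ m : Cen} {Φ : OpPoly k}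
    (h : (opModel k hk ω a b).IsEig m₀ m Φ) :
    constHom k (quantize ω a b F) * Φ - substMu k m F * Φ ∈ (opModel k hk ω a b).eigIdeal m₀ := by
  convert quantize_mul_mem hk ω a b hF h using 2
  rw [substMu_eq_sum]
  refine Finset.sum_congr rfl fun j _ => Finset.sum_congr rfl fun i hi => ?_
  have hi' : Even i := by
    by_contra hc
    exact Polynomial.mem_support_iff.1 hi (hodd i j (Nat.not_even_iff_odd.1 hc))
  rw [Nat.two_mul_div_two_of_even hi']

/-- Quantizing a polynomial that is odd in `μ`, after division by `μ`. -/
theorem quantize_odd {F : OpPoly k} (hF : F ∈ diffPolys k)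
    (heven : ∀ i j, Even i → coeffOp F i j = 0) {m₀ m : Cen} {Φ : OpPoly k}
    (h : (opModel k hk ω a b).IsEig m₀ m Φ) :
    m • (constHom k (quantize ω a b F) * Φ) - substMu k m F * Φ
      ∈ (opModel k hk ω a b).eigIdeal m₀ := by
  have key := LadderModel.smul_mem_eigIdeal m (quantize_mul_mem hk ω a b hF h)
  convert key using 1
  rw [← cenHom_mul, ← cenHom_mul, mul_sub, substMu_eq_sum, Finset.mul_sum]
  congr 1
  refine Finset.sum_congr rfl fun j _ => ?_
  rw [Finset.mul_sum]
  refine Finset.sum_congr rfl fun i hi => ?_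
  have hi' : Odd i := by
    by_contra hc
    exact Polynomial.mem_support_iff.1 hi (heven i j (Nat.not_odd_iff_even.1 hc))
  have e : 2 * (i / 2) + 1 = i := Nat.two_mul_div_two_add_one_of_odd hi'
  have e2 : m ^ i * eU ^ j = m * (m ^ (2 * (i / 2)) * eU ^ j) := by
    rw [← mul_assoc, ← pow_succ', e]
  rw [← cenHom_mul, ← cenHom_mul, e2, map_mul, mul_assoc]

theorem quantize_mem {F : OpPoly k} (hF : F ∈ diffPolys k) : quantize ω a b F ∈ diffOps k := by
  rw [quantize]
  refine (diffOps k).sum_mem fun j _ => (diffOps k).sum_mem fun i _ => ?_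
  refine (diffOps k).mul_mem ((diffOps k).mul_mem (hF i j) ((diffOps k).pow_mem
    ((diffOps k).neg_mem (smul_mem_diffOps _ (L2_mem a b))) _)) ((diffOps k).pow_mem
    (H_mem ω a b) _)

variable {p q : ℕ} (hr : ratio p q ≠ 0)

include hr in
theorem xiPlus_mem : xiPlus p q a b ∈ diffPolys (ratio p q) := by
  rw [xiPlus_eq 0 a b hr]
  exact (opModel _ hr 0 a b).xi_mem p q _

include hr in
theorem xiMinus_mem : xiMinus p q a b ∈ diffPolys (ratio p q) := by
  rw [xiMinus_eq 0 a b hr]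
  exact (opModel _ hr 0 a b).xi_mem p q _

/-- `L₃ = Ξ₊ + Ξ₋` on every joint eigenfunction, not only on the generic one: the parity in `μ` makes
the substitution of `-k⁻² L₂` for `μ²` independent of the eigenvalue. -/
theorem L3_mul_mem {m₀ m : Cen} {Φ : OpPoly (ratio p q)}
    (h : (opModel _ hr ω a b).IsEig m₀ m Φ) :
    constHom _ (L3 p q ω a b) * Φ - ((opModel _ hr ω a b).xi p q m * Φ
      + (opModel _ hr ω a b).xi p q (-m) * Φ) ∈ (opModel _ hr ω a b).eigIdeal m₀ := by
  have key := quantize_even hr ω a b ((diffPolys _).add_mem (xiPlus_mem a b hr)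
    (xiMinus_mem a b hr)) (coeffOp_xi_add hr a b) h
  rw [map_add, xiPlus_eq ω a b hr, xiMinus_eq ω a b hr, substMu_xi, substMu_xi, map_neg,
    substCen_muU, add_mul] at key
  rw [L3, xiPlus_eq ω a b hr, xiMinus_eq ω a b hr]
  exact key

/-- `μ L₄ = Ξ₊ - Ξ₋` on every joint eigenfunction. -/
theorem L4_mul_mem {m₀ m : Cen} {Φ : OpPoly (ratio p q)}
    (h : (opModel _ hr ω a b).IsEig m₀ m Φ) :
    m • (constHom _ (L4 p q ω a b) * Φ) - ((opModel _ hr ω a b).xi p q m * Φ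
      - (opModel _ hr ω a b).xi p q (-m) * Φ) ∈ (opModel _ hr ω a b).eigIdeal m₀ := by
  have key := quantize_odd hr ω a b ((diffPolys _).sub_mem (xiPlus_mem a b hr)
    (xiMinus_mem a b hr)) (coeffOp_xi_sub hr a b) h
  rw [map_sub, xiPlus_eq ω a b hr, xiMinus_eq ω a b hr, substMu_xi, substMu_xi, map_neg,
    substCen_muU, sub_mul] at key
  rw [L4, xiPlus_eq ω a b hr, xiMinus_eq ω a b hr]
  exact key

include hr in
theorem L3_mem : L3 p q ω a b ∈ diffOps _ :=
  quantize_mem ω a b ((diffPolys _).add_mem (xiPlus_mem a b hr) (xiMinus_mem a b hr))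

include hr in
theorem L4_mem : L4 p q ω a b ∈ diffOps _ :=
  quantize_mem ω a b ((diffPolys _).sub_mem (xiPlus_mem a b hr) (xiMinus_mem a b hr))

end Quantize

/-! ### Numerical values of the spectral parameters -/

section AtValue

variable {k : ℝ}

theorem commute_smul_one (c : ℂ) (T : Op k) : Commute T (c • (1 : Op k)) := by
  rw [Commute, SemiconjBy, mul_smul_comm, smul_mul_assoc, one_mul, mul_one]

/-- Evaluation of operator polynomials at numbers `μ`, `E`. -/
def atHom (k : ℝ) (μ E : ℂ) : OpPoly k →+* Op k :=
  evalHom (RingHom.id (Op k)) (μ • 1) (E • 1) (commute_smul_one μ) (commute_smul_one E)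
    (commute_smul_one E _)

theorem atHom_eq (F : OpPoly k) (μ E : ℂ) : atHom k μ E F = atValue F μ E := by
  rw [atHom, evalHom_eq_sum, atValue]
  refine Finset.sum_congr rfl fun j _ => Finset.sum_congr rfl fun i _ => ?_
  change (F.coeff j).coeff i * (μ • (1 : Op k)) ^ i * (E • (1 : Op k)) ^ j
    = (μ ^ i * E ^ j) • (F.coeff j).coeff i
  rw [smul_pow, smul_pow, one_pow, one_pow, mul_smul_comm, mul_smul_comm, mul_one,
    mul_one, smul_smul, mul_comm]

/-- Evaluation of scalar polynomials at numbers `μ`, `E`. -/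
def valHom (μ E : ℂ) : Cen →+* ℂ :=
  Polynomial.eval₂RingHom (Polynomial.evalRingHom μ) E

theorem valHom_cU (μ E c : ℂ) : valHom μ E (cU c) = c := by simp [valHom, cU]
theorem valHom_muU (μ E : ℂ) : valHom μ E muU = μ := by simp [valHom, muU]
theorem valHom_eU (μ E : ℂ) : valHom μ E eU = E := by simp [valHom, eU]

theorem atHom_constHom (μ E : ℂ) (T : Op k) : atHom k μ E (constHom k T) = T :=
  evalHom_C_C _ _ _ _ _ _ _

theorem atHom_muVar (μ E : ℂ) : atHom k μ E (muVar k) = μ • 1 := evalHom_C_X _ _ _ _ _ _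

theorem atHom_eVar (μ E : ℂ) : atHom k μ E (eVar k) = E • 1 := evalHom_X _ _ _ _ _ _

theorem atHom_cenHom (μ E : ℂ) (u : Cen) :
    atHom k μ E (cenHom k u) = algebraMap ℂ (Op k) (valHom μ E u) := by
  have h : (atHom k μ E).comp (cenHom k) = (algebraMap ℂ (Op k)).comp (valHom μ E) := by
    refine hom_ext_two (fun c => ?_) ?_ ?_
    · rw [RingHom.comp_apply, cenHom_C_C, atHom_constHom, RingHom.comp_apply]
      exact congrArg _ (valHom_cU μ E c).symm
    · refine (congrArg (atHom k μ E) cenHom_muU).trans ((atHom_muVar μ E).trans ?_)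
      rw [← Algebra.algebraMap_eq_smul_one]
      exact congrArg _ (valHom_muU μ E).symm
    · refine (congrArg (atHom k μ E) cenHom_eU).trans ((atHom_eVar μ E).trans ?_)
      rw [← Algebra.algebraMap_eq_smul_one]
      exact congrArg _ (valHom_eU μ E).symm
  exact congrArg (fun f => f u) h

theorem atHom_smul (μ E : ℂ) (u : Cen) (F : OpPoly k) :
    atHom k μ E (u • F) = valHom μ E u • atHom k μ E F := by
  rw [← cenHom_mul, map_mul, atHom_cenHom, Algebra.smul_def]

/-- Substituting a number for `μ` before evaluation. -/
theorem atHom_substMu (μ E : ℂ) (m : Cen) (F : OpPoly k) :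
    atHom k μ E (substMu k m F) = atHom k (valHom μ E m) E F := by
  have h : (atHom k μ E).comp (substMu k m) = atHom k (valHom μ E m) E := by
    refine hom_ext_two (fun T => ?_) ?_ ?_
    · exact (congrArg (atHom k μ E) (substMu_constHom m T)).trans
        ((atHom_constHom μ E T).trans (atHom_constHom _ E T).symm)
    · refine (congrArg (atHom k μ E) (substMu_muVar m)).trans ((atHom_cenHom μ E m).trans ?_)
      rw [Algebra.algebraMap_eq_smul_one]
      exact (atHom_muVar _ E).symm
    · exact (congrArg (atHom k μ E) (substMu_eVar m)).trans
        ((atHom_eVar μ E).trans (atHom_eVar _ E).symm)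
  exact congrArg (fun f => f F) h

variable (hk : k ≠ 0) {ω a b : ℂ}

theorem atHom_angEq (μ E : ℂ) (m : Cen) : atHom k μ E ((opModel k hk ω a b).angEq m)
    = L2 k a b + ((k : ℂ) ^ 2 * valHom μ E m ^ 2) • (1 : Op k) := by
  have e : (opModel k hk ω a b).angEq m
    = constHom k (L2 k a b) + (cU ((k : ℂ) ^ 2) * m ^ 2) • (1 : OpPoly k) := rfl
  rw [e, map_add, atHom_constHom, atHom_smul, map_one, map_mul, valHom_cU, map_pow]

theorem atHom_enEq (μ E : ℂ) : atHom k μ E ((opModel k hk ω a b).enEq)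
    = H k ω a b - E • (1 : Op k) := by
  have e : (opModel k hk ω a b).enEq = constHom k (H k ω a b) - eU • (1 : OpPoly k) := rfl
  rw [e, map_sub, atHom_constHom, atHom_smul, map_one, valHom_eU]

variable {hk} {μ E : ℂ} {ψ : Smooth k}

/-- The left ideal of a joint eigenfunction annihilates it. -/
theorem IsJointEigen.atHom_eq_zero (hψ : IsJointEigen ω a b μ E ψ) {m : Cen}
    (hm : valHom μ E m ^ 2 = μ ^ 2) {F : OpPoly k}
    (hF : F ∈ (opModel k hk ω a b).eigIdeal m) : atHom k μ E F ψ = 0 := by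
  obtain ⟨X, _, Y, _, rfl⟩ := LadderModel.mem_eigIdeal.1 hF
  have h1 : atHom k μ E ((opModel k hk ω a b).angEq m) ψ = 0 := by
    rw [atHom_angEq, hm, LinearMap.add_apply, hψ.1, LinearMap.smul_apply, Module.End.one_apply,
      neg_smul, neg_add_cancel]
  have h2 : atHom k μ E ((opModel k hk ω a b).enEq) ψ = 0 := by
    rw [atHom_enEq, LinearMap.sub_apply, hψ.2, LinearMap.smul_apply, Module.End.one_apply, sub_self]
  rw [map_add, map_mul, map_mul, LinearMap.add_apply, Module.End.mul_apply, Module.End.mul_apply,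
    h1, h2, map_zero, map_zero, add_zero]

/-- Operator polynomials that intertwine the eigenvalue equations map joint eigenfunctions to joint
eigenfunctions. -/
theorem IsJointEigen.of_isEig (hψ : IsJointEigen ω a b μ E ψ) {m₀ m : Cen}
    (hm : valHom μ E m₀ ^ 2 = μ ^ 2) {Φ : OpPoly k} (hΦ : (opModel k hk ω a b).IsEig m₀ m Φ) :
    IsJointEigen ω a b (valHom μ E m) E (atHom k μ E Φ ψ) := by
  have h1 := hψ.atHom_eq_zero hm hΦ.1
  have h2 := hψ.atHom_eq_zero hm hΦ.2
  rw [map_mul, atHom_angEq, Module.End.mul_apply, LinearMap.add_apply, LinearMap.smul_apply,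
    Module.End.one_apply] at h1
  rw [map_mul, atHom_enEq, Module.End.mul_apply, LinearMap.sub_apply, LinearMap.smul_apply,
    Module.End.one_apply] at h2
  exact ⟨by rw [neg_smul]; exact eq_neg_of_add_eq_zero_left h1, sub_eq_zero.1 h2⟩

end AtValue

end TTW

end

noncomputable section

namespace TTW

/-! ### Separation of the powers of `μ` -/

section Pairs

variable {A : Type*} [Ring A]

theorem end_mul_apply {M : Type*} [AddCommGroup M] (f g : AddMonoid.End M) (x : M) :
    (f * g) x = f (g x) := rfl

theorem end_add_apply {M : Type*} [AddCommGroup M] (f g : AddMonoid.End M) (x : M) :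
    (f + g) x = f x + g x := rfl

theorem end_sub_apply {M : Type*} [AddCommGroup M] (f g : AddMonoid.End M) (x : M) :
    (f - g) x = f x - g x := rfl

theorem end_one_apply {M : Type*} [AddCommGroup M] (x : M) : (1 : AddMonoid.End M) x = x := rfl

/-- Multiplication on the left of both components. -/
def leftPair (A : Type*) [Ring A] : A →+* AddMonoid.End (A × A) where
  toFun s :=
    { toFun := fun x => (s * x.1, s * x.2)
      map_zero' := by simp
      map_add' := fun x y => by simp [mul_add] }
  map_one' := AddMonoidHom.ext fun x => Prod.ext (one_mul _) (one_mul _)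
  map_mul' s t := AddMonoidHom.ext fun x => Prod.ext (mul_assoc _ _ _) (mul_assoc _ _ _)
  map_zero' := AddMonoidHom.ext fun x => Prod.ext (zero_mul _) (zero_mul _)
  map_add' s t := AddMonoidHom.ext fun x => Prod.ext (add_mul _ _ _) (add_mul _ _ _)

/-- Multiplication by `μ`: it maps `u + μ v` to `v μ² + μ u`. -/
def muPair (l : A) : AddMonoid.End (A × A) where
  toFun x := (x.2 * l, x.1)
  map_zero' := by simp
  map_add' x y := by simp [add_mul]

/-- Multiplication on the right of both components. -/
def rightPair (h : A) : AddMonoid.End (A × A) where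
  toFun x := (x.1 * h, x.2 * h)
  map_zero' := by simp
  map_add' x y := by simp [add_mul]

theorem leftPair_apply (s : A) (x : A × A) : leftPair A s x = (s * x.1, s * x.2) := rfl
theorem muPair_apply (l : A) (x : A × A) : muPair l x = (x.2 * l, x.1) := rfl
theorem rightPair_apply (h : A) (x : A × A) : rightPair h x = (x.1 * h, x.2 * h) := rfl

theorem commute_leftPair_mu (l s : A) : Commute (leftPair A s) (muPair l) := by
  refine DFunLike.ext _ _ fun x => ?_
  simp [end_mul_apply, leftPair_apply, muPair_apply, mul_assoc]

theorem commute_leftPair_right (h s : A) : Commute (leftPair A s) (rightPair h) := by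
  refine DFunLike.ext _ _ fun x => ?_
  simp [end_mul_apply, leftPair_apply, rightPair_apply, mul_assoc]

theorem commute_mu_right {l h : A} (hc : Commute l h) : Commute (muPair l) (rightPair h) := by
  refine DFunLike.ext _ _ fun x => ?_
  simp [end_mul_apply, muPair_apply, rightPair_apply, mul_assoc, hc.eq]

theorem commute_right_right {c h : A} (hc : Commute c h) : Commute (rightPair c) (rightPair h) := by
  refine DFunLike.ext _ _ fun x => ?_
  simp [end_mul_apply, rightPair_apply, mul_assoc, hc.eq]

/-- The action of operator polynomials on pairs. The pair `(u, v)` stands for `u + μ v`; the operator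
coefficients multiply on the left, and `μ²` and `E` act by multiplication on the right by the
commuting elements `l` and `h`. -/
def pairHom {l h : A} (hc : Commute l h) : Polynomial (Polynomial A) →+* AddMonoid.End (A × A) :=
  evalHom (leftPair A) (muPair l) (rightPair h) (commute_leftPair_mu l) (commute_leftPair_right h)
    (commute_mu_right hc)

theorem pairHom_C_C {l h : A} (hc : Commute l h) (s : A) (x : A × A) :
    pairHom hc (Polynomial.C (Polynomial.C s)) x = (s * x.1, s * x.2) :=
  congrArg (fun f : AddMonoid.End (A × A) => f x) (evalHom_C_C _ _ _ _ _ _ s)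

theorem pairHom_C_X {l h : A} (hc : Commute l h) (x : A × A) :
    pairHom hc (Polynomial.C Polynomial.X) x = (x.2 * l, x.1) :=
  congrArg (fun f : AddMonoid.End (A × A) => f x) (evalHom_C_X _ _ _ _ _ _)

theorem pairHom_X {l h : A} (hc : Commute l h) (x : A × A) :
    pairHom hc Polynomial.X x = (x.1 * h, x.2 * h) :=
  congrArg (fun f : AddMonoid.End (A × A) => f x) (evalHom_X _ _ _ _ _ _)

/-- The action on pairs is right linear over the elements that commute with `μ²` and `E`. -/
theorem pairHom_mul_right {l h c : A} (hc : Commute l h) (hl : Commute l c) (hh : Commute h c)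
    (F : Polynomial (Polynomial A)) (x : A × A) :
    pairHom hc F (x.1 * c, x.2 * c) = ((pairHom hc F x).1 * c, (pairHom hc F x).2 * c) := by
  have h1 : pairHom hc F ∈ Subring.centralizer {rightPair c} := by
    refine evalHom_mem _ _ _ _ _ _ _ ?_ ?_ _ fun i j => ?_ <;> rw [Subring.mem_centralizer_iff]
    · rintro g rfl
      refine DFunLike.ext _ _ fun x => ?_
      simp [end_mul_apply, muPair_apply, rightPair_apply, mul_assoc, hl.eq]
    · rintro g rfl
      exact (commute_right_right hh).eq.symm
    · rintro g rfl
      exact (commute_leftPair_right _ _).eq.symm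
  rw [Subring.mem_centralizer_iff] at h1
  exact (congrArg (fun f : AddMonoid.End (A × A) => f x) (h1 _ rfl)).symm

/-- Membership of the coefficients in a subring passes to the action on pairs. -/
theorem pairHom_mem {l h : A} (hc : Commute l h) {S : Subring A} (hl : l ∈ S) (hh : h ∈ S)
    {F : Polynomial (Polynomial A)} (hF : ∀ i j, (F.coeff j).coeff i ∈ S) (x : A × A)
    (h1 : x.1 ∈ S) (h2 : x.2 ∈ S) : (pairHom hc F x).1 ∈ S ∧ (pairHom hc F x).2 ∈ S := by
  let R : Subring (AddMonoid.End (A × A)) :=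
    { carrier := {f | ∀ x : A × A, x.1 ∈ S → x.2 ∈ S → (f x).1 ∈ S ∧ (f x).2 ∈ S}
      mul_mem' := fun {f g} hf hg x h1 h2 => hf _ (hg x h1 h2).1 (hg x h1 h2).2
      one_mem' := fun x h1 h2 => ⟨h1, h2⟩
      add_mem' := fun {f g} hf hg x h1 h2 => ⟨S.add_mem (hf x h1 h2).1 (hg x h1 h2).1,
        S.add_mem (hf x h1 h2).2 (hg x h1 h2).2⟩
      zero_mem' := fun x _ _ => ⟨S.zero_mem, S.zero_mem⟩
      neg_mem' := fun {f} hf x h1 h2 => ⟨S.neg_mem (hf x h1 h2).1, S.neg_mem (hf x h1 h2).2⟩ }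
  have h3 : pairHom hc F ∈ R := by
    refine evalHom_mem _ _ _ _ _ _ R ?_ ?_ _ fun i j => ?_
    · exact fun x h1 h2 => ⟨S.mul_mem h2 hl, h1⟩
    · exact fun x h1 h2 => ⟨S.mul_mem h1 hh, S.mul_mem h2 hh⟩
    · exact fun x h1 h2 => ⟨S.mul_mem (hF i j) h1, S.mul_mem (hF i j) h2⟩
  exact h3 x h1 h2

end Pairs

section PairsModel

variable {k : ℝ} (hk : k ≠ 0) (ω a b : ℂ)

/-- The operator that replaces `μ²`. -/
def muSq (k : ℝ) (a b : ℂ) : Op k := -(((k : ℂ) ^ 2)⁻¹ • L2 k a b)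

theorem commute_muSq_H : Commute (muSq k a b) (H k ω a b) :=
  ((commute_H_L2 ω a b).symm.smul_left _).neg_left

theorem pair_constHom (T : Op k) (x : Op k × Op k) :
    pairHom (commute_muSq_H ω a b) (constHom k T) x = (T * x.1, T * x.2) := pairHom_C_C _ _ _

theorem pair_muU_smul (F : OpPoly k) (x : Op k × Op k) :
    pairHom (commute_muSq_H ω a b) (muU • F) x
      = ((pairHom (commute_muSq_H ω a b) F x).2 * muSq k a b,
        (pairHom (commute_muSq_H ω a b) F x).1) := by
  rw [← cenHom_mul, cenHom_muU, map_mul, end_mul_apply]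
  exact pairHom_C_X _ _

theorem pair_eU_smul (F : OpPoly k) (x : Op k × Op k) :
    pairHom (commute_muSq_H ω a b) (eU • F) x
      = ((pairHom (commute_muSq_H ω a b) F x).1 * H k ω a b,
        (pairHom (commute_muSq_H ω a b) F x).2 * H k ω a b) := by
  rw [← cenHom_mul, cenHom_eU, map_mul, end_mul_apply]
  exact pairHom_X _ _

theorem pair_cU_smul (c : ℂ) (F : OpPoly k) (x : Op k × Op k) :
    pairHom (commute_muSq_H ω a b) (cU c • F) x
      = (c • (pairHom (commute_muSq_H ω a b) F x).1, c • (pairHom (commute_muSq_H ω a b) F x).2) := by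
  have e : cenHom k (cU c) = constHom k (c • (1 : Op k)) := by
    rw [← Algebra.algebraMap_eq_smul_one]; exact cenHom_C_C c
  rw [← cenHom_mul, e, map_mul, end_mul_apply, pair_constHom]
  simp only [smul_mul_assoc, one_mul]

theorem pair_enEq : pairHom (commute_muSq_H ω a b) (opModel k hk ω a b).enEq (1, 0) = 0 := by
  have e : (opModel k hk ω a b).enEq = constHom k (H k ω a b) - eU • (1 : OpPoly k) := rfl
  have h : pairHom (commute_muSq_H ω a b) (opModel k hk ω a b).enEq
      = pairHom (commute_muSq_H ω a b) (constHom k (H k ω a b))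
        - pairHom (commute_muSq_H ω a b) (eU • (1 : OpPoly k)) := by rw [e, map_sub]
  rw [h, end_sub_apply, pair_constHom, pair_eU_smul, map_one, end_one_apply]
  simp

theorem pair_angEq_muU :
    pairHom (commute_muSq_H ω a b) ((opModel k hk ω a b).angEq muU) (1, 0) = 0 := by
  have e : (opModel k hk ω a b).angEq muU
      = constHom k (L2 k a b) + cU ((k : ℂ) ^ 2) • (muU • (muU • (1 : OpPoly k))) := by
    have e1 : (opModel k hk ω a b).angEq muU
      = constHom k (L2 k a b) + (cU ((k : ℂ) ^ 2) * muU ^ 2) • (1 : OpPoly k) := rfl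
    rw [e1, ← cenHom_mul, ← cenHom_mul, ← cenHom_mul, ← cenHom_mul, ← mul_assoc, ← mul_assoc,
      ← map_mul, ← map_mul, mul_assoc, pow_two muU]
  have h : pairHom (commute_muSq_H ω a b) ((opModel k hk ω a b).angEq muU)
      = pairHom (commute_muSq_H ω a b) (constHom k (L2 k a b))
        + pairHom (commute_muSq_H ω a b) (cU ((k : ℂ) ^ 2) • (muU • (muU • (1 : OpPoly k)))) := by
    rw [e, map_add]
  have hk2 : (k : ℂ) ^ 2 ≠ 0 := pow_ne_zero 2 (Complex.ofReal_ne_zero.2 hk)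
  rw [h, end_add_apply, pair_constHom, pair_cU_smul, pair_muU_smul, pair_muU_smul, map_one,
    end_one_apply]
  simp [muSq, smul_smul, hk2]

/-- With `μ²` acting as `-k⁻² L₂` and `E` as `H`, the left ideal of the generic joint eigenfunction
annihilates the pair `(1, 0)`; this pair is the generic joint eigenfunction. -/
theorem pair_eq_zero {F : OpPoly k} (hF : F ∈ (opModel k hk ω a b).eigIdeal muU) :
    pairHom (commute_muSq_H ω a b) F (1, 0) = 0 := by
  obtain ⟨X, _, Y, _, rfl⟩ := LadderModel.mem_eigIdeal.1 hF
  rw [map_add, map_mul, map_mul]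
  rw [end_add_apply, end_mul_apply, end_mul_apply, pair_enEq,
    pair_angEq_muU, map_zero, map_zero, add_zero]

/-- An operator that annihilates the generic joint eigenfunction vanishes. -/
theorem constHom_eq_zero (T : Op k)
    (hT : constHom k T ∈ (opModel k hk ω a b).eigIdeal muU) : T = 0 := by
  have h := pair_eq_zero hk ω a b hT
  rw [pair_constHom] at h
  simpa using congrArg Prod.fst h

/-- An operator whose `μ`-fold annihilates the generic joint eigenfunction vanishes: multiplication by
`μ` moves it to the second component. -/
theorem constHom_eq_zero_of_mul (T : Op k)
    (hT : muU • constHom k T ∈ (opModel k hk ω a b).eigIdeal muU) : T = 0 := by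
  have h := pair_eq_zero hk ω a b hT
  rw [pair_muU_smul, pair_constHom] at h
  simpa using congrArg Prod.snd h

/-- An operator that annihilates the eigenfunctions with `μ = m₀` is divisible on the right by
`L₂ + k² m₀²`. -/
theorem exists_factor {Z : Op k} {c : ℂ}
    (hZ : constHom k Z ∈ (opModel k hk ω a b).eigIdeal (cU c)) :
    ∃ T ∈ diffOps k, Z = T * (L2 k a b + ((k : ℂ) ^ 2 * c ^ 2) • (1 : Op k)) := by
  obtain ⟨X, hX, Y, _, hXY⟩ := LadderModel.mem_eigIdeal.1 hZ
  set S : Op k := L2 k a b + ((k : ℂ) ^ 2 * c ^ 2) • (1 : Op k)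
  have hang : pairHom (commute_muSq_H ω a b) ((opModel k hk ω a b).angEq (cU c)) (1, 0) = (S, 0) := by
    have e : (opModel k hk ω a b).angEq (cU c) = constHom k S := by
      have e1 : (opModel k hk ω a b).angEq (cU c)
        = constHom k (L2 k a b) + (cU ((k : ℂ) ^ 2) * cU c ^ 2) • (1 : OpPoly k) := rfl
      rw [e1, map_add, constHom_smul, map_one, cU_eq, cU_eq, cU_eq, map_mul, map_pow cUHom c]
    rw [e, pair_constHom, mul_one, mul_zero]
  have h : pairHom (commute_muSq_H ω a b) (constHom k Z) (1, 0) = pairHom (commute_muSq_H ω a b)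
    (X * (opModel k hk ω a b).angEq (cU c) + Y * (opModel k hk ω a b).enEq) (1, 0) := by rw [hXY]
  have e2 : ((S, 0) : Op k × Op k) = ((1, 0) : Op k × Op k).map (· * S) (· * S) := by
    simp
  have hS : Commute (L2 k a b) S := (Commute.refl _).add_right (commute_smul_one _ _)
  have hS' : Commute (H k ω a b) S := (commute_H_L2 ω a b).add_right (commute_smul_one _ _)
  rw [map_add, map_mul, map_mul, end_add_apply, end_mul_apply,
    end_mul_apply, pair_enEq, map_zero, add_zero, hang, e2, pair_constHom] at h
  -- `S` commutes with `L₂` and `H`, so that it can be taken out on the right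
  have h3 := pairHom_mul_right (commute_muSq_H ω a b) ((hS.smul_left _).neg_left) hS' X (1, 0)
  have h4 := h.trans h3
  refine ⟨(pairHom (commute_muSq_H ω a b) X (1, 0)).1, ?_, ?_⟩
  · exact (pairHom_mem (commute_muSq_H ω a b) ((diffOps k).neg_mem (smul_mem_diffOps _ (L2_mem a b)))
      (H_mem ω a b) hX (1, 0) (diffOps k).one_mem (diffOps k).zero_mem).1
  · have h5 := congrArg Prod.fst h4
    simpa using h5

end PairsModel

end TTW

end

noncomputable section

namespace TTW

/-! ### The structure polynomials -/

section EvenOdd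

variable {W U : Type*} [CommRing W] [CommRing U]

/-- For a polynomial `S(μ)`, the sum `S(μ) + S(-μ)` as a polynomial in `t = μ²`. -/
def evenSum (S : Polynomial W) (t : W) : W :=
  S.sum fun n c => if Even n then 2 * c * t ^ (n / 2) else 0

/-- For a polynomial `S(μ)`, the quotient `(S(μ) - S(-μ)) / μ` as a polynomial in `t = μ²`. -/
def oddSum (S : Polynomial W) (t : W) : W :=
  S.sum fun n c => if Even n then 0 else 2 * c * t ^ (n / 2)

theorem map_evenSum (g : W →+* U) (S : Polynomial W) (t : W) (m : U) (h : g t = m ^ 2) :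
    g (evenSum S t) = S.eval₂ g m + S.eval₂ g (-m) := by
  rw [evenSum, Polynomial.eval₂_eq_sum, Polynomial.eval₂_eq_sum, Polynomial.sum, Polynomial.sum,
    Polynomial.sum, map_sum, ← Finset.sum_add_distrib]
  refine Finset.sum_congr rfl fun n _ => ?_
  split_ifs with hn
  · rw [map_mul, map_mul, map_ofNat, map_pow, h, ← pow_mul, Nat.two_mul_div_two_of_even hn,
      hn.neg_pow]
    ring
  · rw [(Nat.not_even_iff_odd.1 hn).neg_pow, map_zero]
    ring

theorem map_oddSum (g : W →+* U) (S : Polynomial W) (t : W) (m : U) (h : g t = m ^ 2) :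
    m * g (oddSum S t) = S.eval₂ g m - S.eval₂ g (-m) := by
  rw [oddSum, Polynomial.eval₂_eq_sum, Polynomial.eval₂_eq_sum, Polynomial.sum, Polynomial.sum,
    Polynomial.sum, map_sum, Finset.mul_sum, ← Finset.sum_sub_distrib]
  refine Finset.sum_congr rfl fun n _ => ?_
  split_ifs with hn
  · rw [hn.neg_pow, map_zero]
    ring
  · have e := Nat.two_mul_div_two_add_one_of_odd (Nat.not_even_iff_odd.1 hn)
    have e2 : m ^ n = m * (m ^ 2) ^ (n / 2) := by rw [← pow_mul, ← pow_succ', e]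
    rw [map_mul, map_mul, map_ofNat, map_pow, h, (Nat.not_even_iff_odd.1 hn).neg_pow, e2]
    ring

end EvenOdd

section StructureScalar

/-- The scalar by which `Ξ₋ Ξ₊` acts, as a function of `e = E²`, `w = ω²`, `a`, `b` and `μ = m`. -/
def stepScal {V : Type*} [CommRing V] [Algebra ℂ V] (κ : ℂ) (p q : ℕ) (e w a b m : V) : V :=
  (∏ j ∈ Finset.range p, (cst V (1 / 16) * e - (half (cst V κ * m) + j) ^ 2 * w))
    * ∏ j ∈ Finset.range q, (4 * (half m + j) ^ 4 - 2 * (a ^ 2 + b ^ 2) * (half m + j) ^ 2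
      + (cst V (1 / 2) * (a ^ 2 - b ^ 2)) ^ 2)

theorem map_half {V V' : Type*} [CommRing V] [Algebra ℂ V] [CommRing V'] [Algebra ℂ V']
    (g : V →+* V') (hg : ∀ c, g (cst V c) = cst V' c) (m : V) : g (half m) = half (g m) := by
  simp only [half, map_mul, map_add, hg, map_one]

theorem map_stepScal {V V' : Type*} [CommRing V] [Algebra ℂ V] [CommRing V'] [Algebra ℂ V']
    (g : V →+* V') (hg : ∀ c, g (cst V c) = cst V' c) (κ : ℂ) (p q : ℕ) (e w a b m : V) :
    g (stepScal κ p q e w a b m) = stepScal κ p q (g e) (g w) (g a) (g b) (g m) := by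
  simp only [stepScal, map_mul, map_prod, map_sub, map_add, map_pow, map_half g hg, hg, map_ofNat,
    map_natCast]

theorem LadderModel.xiScal_eq {U A B : Type*} [CommRing U] [Algebra ℂ U] [Ring A] [Algebra ℂ A]
    [Ring B] [Algebra U B] (M : LadderModel U A B) (p q : ℕ) (m : U) : M.xiScal p q m
      = stepScal M.κ p q (M.E ^ 2) (cst U (M.ω ^ 2)) (cst U M.a) (cst U M.b) m := by
  rw [LadderModel.xiScal, stepScal]
  have h2 : (2 : U) = cst U 2 := (map_ofNat _ 2).symm
  have h4 : (4 : U) = cst U 4 := (map_ofNat _ 4).symm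
  congr 1
  · refine Finset.prod_congr rfl fun j _ => ?_
    have e1 : cst U (1 / 16) = cst U (1 / 4) ^ 2 := by rw [← map_pow]; norm_num
    have e2 : 4 * cst U (M.ω ^ 2 / 4) = cst U (M.ω ^ 2) := by
      rw [h4, ← map_mul]; congr 1; ring
    rw [kScal, e1]
    linear_combination (-(half (cst U M.κ * m) + j) ^ 2) * e2
  · refine Finset.prod_congr rfl fun j _ => ?_
    have e1 : 4 * cst U ((1 / 2 - M.a ^ 2 - M.b ^ 2) / 2) - 1
        = -(2 * (cst U M.a ^ 2 + cst U M.b ^ 2)) := by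
      rw [h4, h2, ← map_one (algebraMap ℂ U), ← map_pow, ← map_pow, ← map_add, ← map_mul,
        ← map_mul, ← map_sub, ← map_neg]
      congr 1; ring
    have e2 : cst U ((M.a ^ 2 - M.b ^ 2) / 2) = cst U (1 / 2) * (cst U M.a ^ 2 - cst U M.b ^ 2) := by
      rw [← map_pow, ← map_pow, ← map_sub, ← map_mul]
      congr 1; ring
    rw [jScal, e1, e2]
    ring

/-- The polynomial `S(μ)` with coefficients in the polynomials in `E²`, `L₂`, `ω²`, `a`, `b`. -/
def stepPoly (κ : ℂ) (p q : ℕ) : Polynomial (MvPolynomial (Fin 5) ℂ) :=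
  stepScal κ p q (Polynomial.C (MvPolynomial.X 0)) (Polynomial.C (MvPolynomial.X 2))
    (Polynomial.C (MvPolynomial.X 3)) (Polynomial.C (MvPolynomial.X 4)) Polynomial.X

/-- The polynomial that replaces `μ²`, namely `-k⁻² L₂`. -/
def muSqPoly (κ : ℂ) : MvPolynomial (Fin 5) ℂ := MvPolynomial.C (-(κ ^ 2)⁻¹) * MvPolynomial.X 1

/-- The polynomial `P⁽⁺⁾`, obtained from `S(μ) + S(-μ)`: by `up_down`, `Ξ₊ Ξ₋` acts as `S(-μ)`. -/
def polyPlus (κ : ℂ) (p q : ℕ) : MvPolynomial (Fin 5) ℂ :=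
  evenSum (stepPoly κ p q) (muSqPoly κ)

/-- The polynomial `P⁽⁻⁾`, obtained from `(S(μ) - S(-μ)) / μ`. -/
def polyMinus (κ : ℂ) (p q : ℕ) : MvPolynomial (Fin 5) ℂ :=
  oddSum (stepPoly κ p q) (muSqPoly κ)

variable {V : Type*} [CommRing V] [Algebra ℂ V] {κ : ℂ} (p q : ℕ)

theorem eval₂_stepPoly (e l w a b m : V) :
    (stepPoly κ p q).eval₂ (MvPolynomial.aeval ![e, l, w, a, b] : _ →ₐ[ℂ] V).toRingHom m
      = stepScal κ p q e w a b m := by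
  change Polynomial.eval₂RingHom _ m (stepPoly κ p q) = _
  rw [stepPoly, map_stepScal]
  · simp
  · intro c
    rw [cst, Polynomial.algebraMap_apply]
    simp

theorem aeval_polyPlus (hκ : κ ≠ 0) (e w a b m : V) :
    MvPolynomial.aeval ![e, -(cst V (κ ^ 2) * m ^ 2), w, a, b] (polyPlus κ p q)
      = stepScal κ p q e w a b m + stepScal κ p q e w a b (-m) := by
  rw [← eval₂_stepPoly p q e (-(cst V (κ ^ 2) * m ^ 2)),
    ← eval₂_stepPoly p q e (-(cst V (κ ^ 2) * m ^ 2))]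
  refine map_evenSum _ _ _ _ ?_
  simp only [muSqPoly]
  have h : cst V ((κ ^ 2)⁻¹) * cst V (κ ^ 2) = 1 := by
    rw [← map_mul, inv_mul_cancel₀ (pow_ne_zero 2 hκ), map_one]
  have e : (MvPolynomial.aeval ![e, -(cst V (κ ^ 2) * m ^ 2), w, a, b] : _ →ₐ[ℂ] V).toRingHom
      (MvPolynomial.C (-(κ ^ 2)⁻¹) * MvPolynomial.X 1)
      = cst V (-(κ ^ 2)⁻¹) * -(cst V (κ ^ 2) * m ^ 2) := by simp
  rw [e, cst, map_neg]
  linear_combination m ^ 2 * h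

theorem aeval_polyMinus (hκ : κ ≠ 0) (e w a b m : V) :
    m * MvPolynomial.aeval ![e, -(cst V (κ ^ 2) * m ^ 2), w, a, b] (polyMinus κ p q)
      = stepScal κ p q e w a b m - stepScal κ p q e w a b (-m) := by
  rw [← eval₂_stepPoly p q e (-(cst V (κ ^ 2) * m ^ 2)),
    ← eval₂_stepPoly p q e (-(cst V (κ ^ 2) * m ^ 2))]
  refine map_oddSum _ _ _ _ ?_
  simp only [muSqPoly]
  have h : cst V ((κ ^ 2)⁻¹) * cst V (κ ^ 2) = 1 := by
    rw [← map_mul, inv_mul_cancel₀ (pow_ne_zero 2 hκ), map_one]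
  have e : (MvPolynomial.aeval ![e, -(cst V (κ ^ 2) * m ^ 2), w, a, b] : _ →ₐ[ℂ] V).toRingHom
      (MvPolynomial.C (-(κ ^ 2)⁻¹) * MvPolynomial.X 1)
      = cst V (-(κ ^ 2)⁻¹) * -(cst V (κ ^ 2) * m ^ 2) := by simp
  rw [e, cst, map_neg]
  linear_combination m ^ 2 * h

end StructureScalar

section AtOperators

/-- On eigenvectors, a polynomial in `H²` and `L₂` may be replaced by its value. -/
theorem LadderModel.eval_mem {U A B : Type*} [CommRing U] [Algebra ℂ U] [Ring A] [Algebra ℂ A]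
    [Ring B] [Algebra U B] (M : LadderModel U A B) (m : U) (w a b : ℂ)
    (P : MvPolynomial (Fin 5) ℂ) :
    M.φ (∑ s ∈ P.support, (P.coeff s * w ^ s 2 * a ^ s 3 * b ^ s 4) • ((M.h ^ 2) ^ s 0 * M.L ^ s 1))
      - MvPolynomial.aeval ![M.E ^ 2, -(cst U (M.κ ^ 2) * m ^ 2), cst U w, cst U a, cst U b] P
        • (1 : B) ∈ M.eigIdeal m := by
  rw [MvPolynomial.aeval_eq_eval₂Hom, MvPolynomial.coe_eval₂Hom, MvPolynomial.eval₂_eq', map_sum,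
    Finset.sum_smul, ← Finset.sum_sub_distrib]
  refine sum_mem fun s _ => ?_
  have h1 := pow_mul_sub_mem M.h_mem (M.isEig_one m).h_mul 2
  have h2 : M.φ (M.h ^ 2) * 1 - M.E ^ 2 • (1 : B) ∈ M.eigIdeal m := by rwa [map_pow]
  have hm : M.φ (M.h ^ 2) ∈ M.S := by rw [map_pow]; exact M.S.pow_mem M.h_mem 2
  have h3 := pow_mul_sub_mem hm h2 (s 0)
  have h4 := pow_mul_sub_mem M.L_mem (M.isEig_one m).L_mul (s 1)
  have key := smul_mem_eigIdeal (cst U (P.coeff s * w ^ s 2 * a ^ s 3 * b ^ s 4))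
    (add_mem (mul_mem_eigIdeal (M.S.pow_mem hm (s 0)) h4)
      (smul_mem_eigIdeal ((-(cst U (M.κ ^ 2) * m ^ 2)) ^ s 1) h3))
  convert key using 1
  rw [M.φ_smul, map_mul, map_pow M.φ (M.h ^ 2), map_pow M.φ M.L]
  simp only [Fin.prod_univ_five, map_mul, map_pow, mul_one, mul_sub, smul_sub, smul_add, smul_smul,
    mul_smul_comm, Matrix.cons_val]
  rw [sub_add_sub_cancel]
  congr 2
  simp only [cst]
  ring

/-- The same for polynomials multiplied by `μ`. -/
theorem LadderModel.smul_eval_mem {U A B : Type*} [CommRing U] [Algebra ℂ U] [Ring A] [Algebra ℂ A]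
    [Ring B] [Algebra U B] (M : LadderModel U A B) (m : U) (w a b : ℂ)
    (P : MvPolynomial (Fin 5) ℂ) :
    m • M.φ (∑ s ∈ P.support,
        (P.coeff s * w ^ s 2 * a ^ s 3 * b ^ s 4) • ((M.h ^ 2) ^ s 0 * M.L ^ s 1))
      - (m * MvPolynomial.aeval ![M.E ^ 2, -(cst U (M.κ ^ 2) * m ^ 2), cst U w, cst U a, cst U b] P)
        • (1 : B) ∈ M.eigIdeal m := by
  have h := smul_mem_eigIdeal m (M.eval_mem m w a b P)
  rwa [smul_sub, smul_smul] at h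

end AtOperators

end TTW

end

noncomputable section

namespace TTW

theorem poch_eq_prod (j : ℕ) (z : ℂ) : poch j z = ∏ i ∈ Finset.range j, (z + i) := by
  induction j with
  | zero => simp [poch]
  | succ j ih =>
    rw [Finset.prod_range_succ, ← ih]
    exact ascPochhammer_succ_eval j z

theorem cst_complex (c : ℂ) : cst ℂ c = c := rfl

section StructureValues

variable (p q : ℕ) (ω a b n u : ℂ)

/-- The scalar of `Ξ₋ Ξ₊` at `μ_n`, `E_u` is `ξ_n(u)`: each of its factors splits into linear ones,
which are collected into rising factorials. -/
theorem stepScal_mu (k : ℝ) : stepScal (k : ℂ) p q (energy k ω a b u ^ 2) (ω ^ 2) a b (muVal a b n)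
    = (-1) ^ p * 4 ^ q * ω ^ (2 * p) * poch q (n + 1) * poch q (n + a + 1) * poch q (n + b + 1)
    * poch q (n + a + b + 1) * poch p (-u + k * n) * poch p (u + k * (n + a + b + 1) + 1) := by
  have e1 : (-1 : ℂ) ^ p * ω ^ (2 * p) * poch p (-u + k * n) * poch p (u + k * (n + a + b + 1) + 1)
      = ∏ j ∈ Finset.range p, ((-1) * ω ^ 2 * (-u + k * n + j) * (u + k * (n + a + b + 1) + 1 + j)) := by
    rw [poch_eq_prod, poch_eq_prod, Finset.prod_mul_distrib, Finset.prod_mul_distrib,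
      Finset.prod_const, Finset.card_range, mul_pow, pow_mul]
  have e2 : (4 : ℂ) ^ q * poch q (n + 1) * poch q (n + a + 1) * poch q (n + b + 1)
      * poch q (n + a + b + 1)
      = ∏ j ∈ Finset.range q, (4 * (n + 1 + j) * (n + a + 1 + j) * (n + b + 1 + j)
        * (n + a + b + 1 + j)) := by
    simp only [poch_eq_prod, Finset.prod_mul_distrib, Finset.prod_const, Finset.card_range]
  trans (∏ j ∈ Finset.range p, ((-1) * ω ^ 2 * (-u + k * n + j) * (u + k * (n + a + b + 1) + 1 + j)))
    * ∏ j ∈ Finset.range q, (4 * (n + 1 + j) * (n + a + 1 + j) * (n + b + 1 + j)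
        * (n + a + b + 1 + j))
  · rw [stepScal]
    congr 1 <;> refine Finset.prod_congr rfl fun j _ => ?_ <;>
      simp only [half, cst_complex, energy, muVal] <;> ring
  · rw [← e1, ← e2]; ring

/-- The scalar of `Ξ₊ Ξ₋` at `μ_n`, `E_u` is `η_n(u)`. -/
theorem stepScal_neg_mu (k : ℝ) :
    stepScal (k : ℂ) p q (energy k ω a b u ^ 2) (ω ^ 2) a b (-muVal a b n)
    = (-1) ^ p * 4 ^ q * ω ^ (2 * p) * poch q (-n) * poch q (-n - a) * poch q (-n - b)
    * poch q (-n - a - b) * poch p (u - k * n + 1) * poch p (-u - k * (n + a + b + 1)) := by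
  have e1 : (-1 : ℂ) ^ p * ω ^ (2 * p) * poch p (u - k * n + 1) * poch p (-u - k * (n + a + b + 1))
      = ∏ j ∈ Finset.range p, ((-1) * ω ^ 2 * (u - k * n + 1 + j) * (-u - k * (n + a + b + 1) + j)) := by
    rw [poch_eq_prod, poch_eq_prod, Finset.prod_mul_distrib, Finset.prod_mul_distrib,
      Finset.prod_const, Finset.card_range, mul_pow, pow_mul]
  have e2 : (4 : ℂ) ^ q * poch q (-n) * poch q (-n - a) * poch q (-n - b) * poch q (-n - a - b)
      = ∏ j ∈ Finset.range q, (4 * (-n + j) * (-n - a + j) * (-n - b + j) * (-n - a - b + j)) := by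
    simp only [poch_eq_prod, Finset.prod_mul_distrib, Finset.prod_const, Finset.card_range]
  trans (∏ j ∈ Finset.range p, ((-1) * ω ^ 2 * (u - k * n + 1 + j) * (-u - k * (n + a + b + 1) + j)))
    * ∏ j ∈ Finset.range q, (4 * (-n + j) * (-n - a + j) * (-n - b + j) * (-n - a - b + j))
  · rw [stepScal]
    congr 1 <;> refine Finset.prod_congr rfl fun j _ => ?_ <;>
      simp only [half, cst_complex, energy, muVal] <;> ring
  · rw [← e1, ← e2]; ring

variable {p q}

theorem eval_polyPlus (hr : ratio p q ≠ 0) :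
    MvPolynomial.eval ![energy (ratio p q) ω a b u ^ 2,
      -((ratio p q : ℂ) ^ 2 * muVal a b n ^ 2), ω ^ 2, a, b] (polyPlus (ratio p q : ℂ) p q)
      = xiScalar p q ω a b n u + etaScalar p q ω a b n u := by
  rw [← MvPolynomial.coe_aeval_eq_eval]
  refine (aeval_polyPlus (V := ℂ) p q (Complex.ofReal_ne_zero.2 hr) _ _ a b _).trans ?_
  rw [stepScal_mu, stepScal_neg_mu, xiScalar, etaScalar]

theorem eval_polyMinus (hr : ratio p q ≠ 0) :
    muVal a b n * MvPolynomial.eval ![energy (ratio p q) ω a b u ^ 2,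
      -((ratio p q : ℂ) ^ 2 * muVal a b n ^ 2), ω ^ 2, a, b] (polyMinus (ratio p q : ℂ) p q)
      = xiScalar p q ω a b n u - etaScalar p q ω a b n u := by
  rw [← MvPolynomial.coe_aeval_eq_eval]
  refine (aeval_polyMinus (V := ℂ) p q (Complex.ofReal_ne_zero.2 hr) _ _ a b _).trans ?_
  rw [stepScal_mu, stepScal_neg_mu, xiScalar, etaScalar]

end StructureValues

section QuantizationInstance

variable {p q : ℕ} (hr : ratio p q ≠ 0) (ω a b : ℂ)

theorem ratio_mul (hr : ratio p q ≠ 0) : (ratio p q : ℂ) * q = p := by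
  have hq : (q : ℝ) ≠ 0 := fun h => hr (by simp [ratio, h])
  have h : ratio p q * q = p := div_mul_cancel₀ _ hq
  exact_mod_cast h

/-- The basis independent operators of the TTW system as a quantization of the ladder model. -/
def opQuantization : (opModel (ratio p q) hr ω a b).Quantization p q where
  μ := muU
  ratio := ratio_mul hr
  L3 := L3 p q ω a b
  L4 := L4 p q ω a b
  Pp := evalAtOps (polyPlus (ratio p q : ℂ) p q) (H (ratio p q) ω a b ^ 2) (L2 (ratio p q) a b)
    (ω ^ 2) a b
  Pm := evalAtOps (polyMinus (ratio p q : ℂ) p q) (H (ratio p q) ω a b ^ 2) (L2 (ratio p q) a b)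
    (ω ^ 2) a b
  L3_mem := constHom_mem (L3_mem ω a b hr)
  L4_mem := constHom_mem (L4_mem ω a b hr)
  L3_mul := fun _ _ _ h => L3_mul_mem ω a b hr h
  L4_mul := fun _ _ _ h => L4_mul_mem ω a b hr h
  Pp_mem := by
    have h := (opModel (ratio p q) hr ω a b).eval_mem muU (ω ^ 2) a b (polyPlus (ratio p q : ℂ) p q)
    have e := aeval_polyPlus (V := Cen) p q (κ := (ratio p q : ℂ)) (Complex.ofReal_ne_zero.2 hr)
      (eU ^ 2) (cst Cen (ω ^ 2)) (cst Cen a) (cst Cen b) muU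
    rw [LadderModel.xiScal_eq, LadderModel.xiScal_eq]
    exact e ▸ h
  Pm_mem := by
    have h := (opModel (ratio p q) hr ω a b).smul_eval_mem muU (ω ^ 2) a b (polyMinus (ratio p q : ℂ) p q)
    have e := aeval_polyMinus (V := Cen) p q (κ := (ratio p q : ℂ)) (Complex.ofReal_ne_zero.2 hr)
      (eU ^ 2) (cst Cen (ω ^ 2)) (cst Cen a) (cst Cen b) muU
    rw [LadderModel.xiScal_eq, LadderModel.xiScal_eq]
    exact e ▸ h
  eq_zero := constHom_eq_zero hr ω a b
  eq_zero_of_mul := constHom_eq_zero_of_mul hr ω a b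

/-! ### Action on joint eigenfunctions -/

variable {ω a b} {μ E : ℂ} {ψ : Smooth (ratio p q)}

theorem atHom_xi_muU (ω : ℂ) (μ E : ℂ) : atHom _ μ E ((opModel (ratio p q) hr ω a b).xi p q muU)
    = atValue (xiPlus p q a b) μ E := by rw [← xiPlus_eq ω a b hr, atHom_eq]

theorem atHom_xi_neg_muU (ω : ℂ) (μ E : ℂ) :
    atHom _ μ E ((opModel (ratio p q) hr ω a b).xi p q (-muU))
      = atValue (xiMinus p q a b) μ E := by rw [← xiMinus_eq ω a b hr, atHom_eq]

theorem valHom_add (μ E : ℂ) (q : ℕ) : valHom μ E (muU + 2 * q) = μ + 2 * q := by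
  rw [map_add, map_mul, valHom_muU, map_ofNat, map_natCast]

theorem valHom_sub (μ E : ℂ) (q : ℕ) : valHom μ E (muU - 2 * q) = μ - 2 * q := by
  rw [map_sub, map_mul, valHom_muU, map_ofNat, map_natCast]

include hr in
theorem IsJointEigen.xiPlus (h : IsJointEigen ω a b μ E ψ) :
    IsJointEigen ω a b (μ + 2 * q) E (atValue (TTW.xiPlus p q a b) μ E ψ) := by
  have key := h.of_isEig (by rw [valHom_muU]) ((opModel (ratio p q) hr ω a b).isEig_xi
    (ratio_mul hr) muU)
  rwa [valHom_add, atHom_xi_muU] at key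

include hr in
theorem IsJointEigen.xiMinus (h : IsJointEigen ω a b μ E ψ) :
    IsJointEigen ω a b (μ - 2 * q) E (atValue (TTW.xiMinus p q a b) μ E ψ) := by
  have key := h.of_isEig (by rw [valHom_muU]) ((opModel (ratio p q) hr ω a b).isEig_xi_neg
    (ratio_mul hr) muU)
  rwa [valHom_sub, atHom_xi_neg_muU] at key

include hr in
theorem IsJointEigen.L3_apply (h : IsJointEigen ω a b μ E ψ) : L3 p q ω a b ψ
    = atValue (TTW.xiPlus p q a b) μ E ψ + atValue (TTW.xiMinus p q a b) μ E ψ := by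
  have key := h.atHom_eq_zero (m := muU) (by rw [valHom_muU]) (opQuantization hr ω a b).L3_sub
  have e : (opQuantization hr ω a b).μ = muU := rfl
  have e2 : (opModel (ratio p q) hr ω a b).φ (opQuantization hr ω a b).L3
    = constHom _ (L3 p q ω a b) := rfl
  rw [e, e2, map_sub, map_add, atHom_constHom, atHom_xi_muU, atHom_xi_neg_muU] at key
  exact sub_eq_zero.1 key

include hr in
theorem IsJointEigen.L4_apply (h : IsJointEigen ω a b μ E ψ) : μ • L4 p q ω a b ψ
    = atValue (TTW.xiPlus p q a b) μ E ψ - atValue (TTW.xiMinus p q a b) μ E ψ := by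
  have key := h.atHom_eq_zero (m := muU) (by rw [valHom_muU]) (opQuantization hr ω a b).L4_sub
  have e : (opQuantization hr ω a b).μ = muU := rfl
  have e2 : (opModel (ratio p q) hr ω a b).φ (opQuantization hr ω a b).L4
    = constHom _ (L4 p q ω a b) := rfl
  rw [e, e2, map_sub, map_sub, atHom_smul, valHom_muU, atHom_constHom, atHom_xi_muU,
    atHom_xi_neg_muU] at key
  exact sub_eq_zero.1 key

/-- The value of the scalar by which `Ξ₋ Ξ₊` acts. -/
def stepVal (p q : ℕ) (ω a b μ E : ℂ) : ℂ :=
  stepScal (ratio p q : ℂ) p q (E ^ 2) (ω ^ 2) a b μ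

theorem valHom_xiScal (m : Cen) : valHom μ E ((opModel (ratio p q) hr ω a b).xiScal p q m)
    = stepVal p q ω a b (valHom μ E m) E := by
  rw [LadderModel.xiScal_eq, map_stepScal _ (fun c => valHom_cU μ E c)]
  have e : (opModel (ratio p q) hr ω a b).E = eU := rfl
  rw [e, map_pow, valHom_eU, stepVal, cst_cen, cst_cen, cst_cen, valHom_cU, valHom_cU, valHom_cU]
  rfl

theorem smul_one_apply (c : ℂ) (ψ : Smooth (ratio p q)) :
    (c • (1 : Op (ratio p q))) ψ = c • ψ := rfl

include hr in
theorem IsJointEigen.xiMinus_xiPlus (h : IsJointEigen ω a b μ E ψ) :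
    atValue (TTW.xiMinus p q a b) (μ + 2 * q) E (atValue (TTW.xiPlus p q a b) μ E ψ)
      = stepVal p q ω a b μ E • ψ := by
  have key := h.atHom_eq_zero (by rw [valHom_muU]) ((opModel (ratio p q) hr ω a b).xi_mul_xi
    (ratio_mul hr) muU)
  have e : (opModel (ratio p q) hr ω a b).xi p q (-muU - 2 * q)
      = substMu _ (muU + 2 * q) ((opModel (ratio p q) hr ω a b).xi p q (-muU)) := by
    rw [substMu_xi, map_neg, substCen_muU, neg_add']
  rw [map_sub, map_mul, e, atHom_substMu, valHom_add, atHom_xi_neg_muU, atHom_xi_muU, atHom_smul,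
    map_one, valHom_xiScal, valHom_muU] at key
  exact sub_eq_zero.1 key

include hr in
theorem IsJointEigen.xiPlus_xiMinus (h : IsJointEigen ω a b μ E ψ) :
    atValue (TTW.xiPlus p q a b) (μ - 2 * q) E (atValue (TTW.xiMinus p q a b) μ E ψ)
      = stepVal p q ω a b (-μ) E • ψ := by
  have key := h.atHom_eq_zero (m := -muU) (by rw [map_neg, valHom_muU, neg_sq])
    ((opModel (ratio p q) hr ω a b).xi_mul_xi (ratio_mul hr) (-muU))
  have e : (opModel (ratio p q) hr ω a b).xi p q (- -muU - 2 * q)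
      = substMu _ (muU - 2 * q) ((opModel (ratio p q) hr ω a b).xi p q muU) := by
    rw [substMu_xi, substCen_muU, neg_neg]
  rw [map_sub, map_mul, e, atHom_substMu, valHom_sub, atHom_xi_neg_muU, atHom_xi_muU, atHom_smul,
    map_one, valHom_xiScal, map_neg, valHom_muU] at key
  exact sub_eq_zero.1 key

include hr in
theorem IsJointEigen.polyPlus_apply (h : IsJointEigen ω a b μ E ψ) :
    evalAtOps (polyPlus (ratio p q : ℂ) p q) (H (ratio p q) ω a b ^ 2) (L2 (ratio p q) a b)
      (ω ^ 2) a b ψ = (stepVal p q ω a b μ E + stepVal p q ω a b (-μ) E) • ψ := by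
  have key := h.atHom_eq_zero (m := muU) (by rw [valHom_muU]) (opQuantization hr ω a b).Pp_mem
  have e : (opQuantization hr ω a b).μ = muU := rfl
  have e2 : (opModel (ratio p q) hr ω a b).φ (opQuantization hr ω a b).Pp
    = constHom _ (evalAtOps (polyPlus (ratio p q : ℂ) p q) (H (ratio p q) ω a b ^ 2)
      (L2 (ratio p q) a b) (ω ^ 2) a b) := rfl
  rw [e, e2, map_sub, atHom_constHom, atHom_smul, map_one, map_add, valHom_xiScal, valHom_xiScal,
    map_neg, valHom_muU] at key
  exact sub_eq_zero.1 key

include hr in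
theorem IsJointEigen.polyMinus_apply (h : IsJointEigen ω a b μ E ψ) :
    μ • evalAtOps (polyMinus (ratio p q : ℂ) p q) (H (ratio p q) ω a b ^ 2) (L2 (ratio p q) a b)
      (ω ^ 2) a b ψ = (stepVal p q ω a b μ E - stepVal p q ω a b (-μ) E) • ψ := by
  have key := h.atHom_eq_zero (m := muU) (by rw [valHom_muU]) (opQuantization hr ω a b).Pm_mem
  have e : (opQuantization hr ω a b).μ = muU := rfl
  have e2 : (opModel (ratio p q) hr ω a b).φ (opQuantization hr ω a b).Pm
    = constHom _ (evalAtOps (polyMinus (ratio p q : ℂ) p q) (H (ratio p q) ω a b ^ 2)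
      (L2 (ratio p q) a b) (ω ^ 2) a b) := rfl
  rw [e, e2, map_sub, atHom_smul, atHom_constHom, atHom_smul, map_one, map_sub, valHom_xiScal,
    valHom_xiScal, map_neg, valHom_muU] at key
  exact sub_eq_zero.1 key

end QuantizationInstance

end TTW

end

noncomputable section

namespace TTW

/-! ### The symmetry of lower order -/

section SelfScalar

variable {U : Type*} [CommRing U]

theorem selfScalar_even (c : U → U) (z h : U) (n : ℕ) :
    selfScalar c z h (2 * n) = ∏ l ∈ Finset.Icc 1 n, c (-(h * (2 * l - 1))) := by
  induction n with
  | zero => simp [selfScalar]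
  | succ n ih =>
    rw [Finset.prod_Icc_succ_top (by omega), ← ih, Nat.mul_succ, selfScalar, mul_comm]
    congr 4
    push_cast
    ring

theorem selfScalar_odd (c : U → U) (z h : U) (n : ℕ) :
    selfScalar c z h (2 * n + 1) = z * ∏ l ∈ Finset.Icc 1 n, c (-(h * (2 * l))) := by
  induction n with
  | zero => simp [selfScalar]
  | succ n ih =>
    rw [Finset.prod_Icc_succ_top (by omega), ← mul_assoc, ← ih, Nat.mul_succ, add_right_comm,
      selfScalar, mul_comm]
    congr 4
    push_cast
    ring

variable [Algebra ℂ U]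

theorem cst_neg_nat (l : ℕ) : -(cst U (1 / 2) * (2 * l)) = cst U (-l : ℂ) := by
  have e : cst U (-l : ℂ) = -(l : U) := by rw [cst, map_neg, map_natCast]
  rw [e]
  linear_combination -(l : U) * two_mul_cst (U := U)

theorem cst_neg_nat_sub (l : ℕ) :
    -(cst U (1 / 2) * (2 * l - 1)) = cst U (-(l - 1 / 2 : ℂ)) := by
  have e : cst U (-(l - 1 / 2 : ℂ)) = -(l - cst U (1 / 2)) := by
    rw [cst, map_neg, map_sub, map_natCast]
  rw [e]
  linear_combination -(l : U) * two_mul_cst (U := U)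

theorem kScal_cst (ω : ℂ) (e : U) (s : ℂ) :
    kScal ω e (cst U s) = cst U (1 / 16) * e ^ 2 - cst U (ω ^ 2 * s ^ 2) := by
  have e1 : cst U (1 / 16) = cst U (1 / 4) ^ 2 := by rw [← map_pow]; norm_num
  have e2 : 4 * cst U s ^ 2 * cst U (ω ^ 2 / 4) = cst U (ω ^ 2 * s ^ 2) := by
    rw [← map_ofNat (algebraMap ℂ U) 4, ← map_pow, ← map_mul, ← map_mul]
    congr 1; ring
  rw [kScal, e1, e2]
  ring

theorem jScal_cst (a b s : ℂ) : jScal a b (cst U s) = cst U (quarterProd a b (-(2 * s))) := by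
  rw [jScal, ← map_ofNat (algebraMap ℂ U) 4, ← map_one (algebraMap ℂ U)]
  simp only [cst, ← map_pow, ← map_mul, ← map_add, ← map_sub]
  congr 1
  rw [quarterProd]
  ring

theorem aeval_betaRadial (p : ℕ) (ω : ℂ) (e : U) : Polynomial.aeval e (betaRadial p ω)
    = selfScalar (kScal ω e) (-(cst U (1 / 4) * e)) (cst U (1 / 2)) p := by
  rw [betaRadial]
  split_ifs with hp
  · obtain ⟨n, rfl⟩ := hp
    have e1 : (2 * n + 1 - 1) / 2 = n := by omega
    rw [e1, selfScalar_odd, map_mul, map_mul, map_prod, Polynomial.aeval_C, Polynomial.aeval_X]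
    congr 1
    · rw [neg_div, map_neg, neg_mul]
    · refine Finset.prod_congr rfl fun l _ => ?_
      rw [cst_neg_nat, kScal_cst]
      simp [cst]
  · obtain ⟨n, rfl⟩ := Nat.not_odd_iff_even.1 hp
    have e1 : (n + n) / 2 = n := by omega
    rw [e1, ← two_mul, selfScalar_even, map_prod]
    refine Finset.prod_congr rfl fun l _ => ?_
    rw [cst_neg_nat_sub, kScal_cst, neg_sq]
    simp [cst]

theorem cst_betaAngular (q : ℕ) (a b : ℂ) : cst U (betaAngular q a b)
    = selfScalar (jScal a b) (-cst U ((a ^ 2 - b ^ 2) / 2)) (cst U (1 / 2)) q := by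
  rw [betaAngular]
  split_ifs with hq
  · obtain ⟨n, rfl⟩ := hq
    have e1 : (2 * n + 1 - 1) / 2 = n := by omega
    rw [e1, selfScalar_odd, cst, map_mul, map_prod, map_neg]
    congr 1
    refine Finset.prod_congr rfl fun l _ => ?_
    rw [cst_neg_nat, jScal_cst]
    congr 2; ring
  · obtain ⟨n, rfl⟩ := Nat.not_odd_iff_even.1 hq
    have e1 : (n + n) / 2 = n := by omega
    rw [e1, ← two_mul, selfScalar_even, cst, map_prod]
    refine Finset.prod_congr rfl fun l _ => ?_
    rw [cst_neg_nat_sub, jScal_cst]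
    congr 2; ring

/-- The polynomial `Q` is `-2` times the scalar by which `Ξ₋` acts at `μ = q`. There
`L₃ - q L₄ = (Ξ₊ + Ξ₋) - (Ξ₊ - Ξ₋) = 2 Ξ₋`. -/
theorem aeval_betaPoly (p q : ℕ) (ω a b : ℂ) (e : U) : Polynomial.aeval e (betaPoly p q ω a b)
    = -2 * (selfScalar (kScal ω e) (-(cst U (1 / 4) * e)) (cst U (1 / 2)) p
      * selfScalar (jScal a b) (-cst U ((a ^ 2 - b ^ 2) / 2)) (cst U (1 / 2)) q) := by
  rw [← aeval_betaRadial, ← cst_betaAngular, betaPoly, map_mul, Polynomial.aeval_C, map_mul,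
    map_neg, map_ofNat]
  ring

end SelfScalar

section LowerSymmetry

variable {p q : ℕ} (hr : ratio p q ≠ 0) (ω a b : ℂ)

/-- `L₃ - q L₄ + Q(H)`. -/
def lowerNum (p q : ℕ) (ω a b : ℂ) : Op (ratio p q) :=
  L3 p q ω a b - (q : ℂ) • L4 p q ω a b
    + Polynomial.aeval (H (ratio p q) ω a b) (betaPoly p q ω a b)

/-- `L₂ + k² q²`. -/
def shiftL2 (p q : ℕ) (a b : ℂ) : Op (ratio p q) :=
  L2 (ratio p q) a b + ((ratio p q : ℂ) ^ 2 * q ^ 2) • (1 : Op (ratio p q))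

include hr in
/-- The operator `L₃ - q L₄ + Q(H)` annihilates the joint eigenfunctions with `μ = q`, hence is divisible
by `L₂ + k² q²` on the right. -/
theorem exists_lowerNum_eq :
    ∃ T ∈ diffOps (ratio p q), lowerNum p q ω a b = T * shiftL2 p q a b := by
  have h := (opQuantization hr ω a b).L3_sub_L4_self (betaPoly p q ω a b)
    (aeval_betaPoly p q ω a b _)
  have e : (q : Cen) = cU (q : ℂ) := by rw [cU_eq, map_natCast]
  rw [e] at h
  exact exists_factor hr ω a b h

include hr in
theorem lie_H_L3 : H (ratio p q) ω a b * L3 p q ω a b - L3 p q ω a b * H (ratio p q) ω a b = 0 :=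
  (opQuantization hr ω a b).commute_h_L3

include hr in
theorem lie_H_L4 : H (ratio p q) ω a b * L4 p q ω a b - L4 p q ω a b * H (ratio p q) ω a b = 0 :=
  (opQuantization hr ω a b).commute_h_L4

include hr in
theorem lie_L2_L3 : L2 (ratio p q) a b * L3 p q ω a b - L3 p q ω a b * L2 (ratio p q) a b
    - (4 * q : ℂ) • (L4 p q ω a b * L2 (ratio p q) a b)
    + (4 * (ratio p q : ℂ) ^ 2 * q ^ 2) • L3 p q ω a b = 0 :=
  (opQuantization hr ω a b).L_L3

include hr in
theorem lie_L2_L4 : L2 (ratio p q) a b * L4 p q ω a b - L4 p q ω a b * L2 (ratio p q) a b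
    + (4 * (ratio p q : ℂ) ^ 2 * q) • L3 p q ω a b
    + (4 * (ratio p q : ℂ) ^ 2 * q ^ 2) • L4 p q ω a b = 0 :=
  (opQuantization hr ω a b).L_L4

theorem commute_aeval {k : ℝ} {A T : Op k} (h : Commute A T) (Q : Polynomial ℂ) :
    Commute A (Polynomial.aeval T Q) := by
  induction Q using Polynomial.induction_on' with
  | add P Q hP hQ => rw [map_add]; exact hP.add_right hQ
  | monomial n z =>
    rw [Polynomial.aeval_monomial]
    exact Commute.mul_right (Algebra.commutes z A).symm (h.pow_right n)

variable {ω a b}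

include hr in
/-- The quotient inherits the commutation with `H`, because `L₂ + k² q²` can be cancelled. -/
theorem lower_commute_H {T : Op (ratio p q)} (hT : T ∈ diffOps _)
    (h : lowerNum p q ω a b = T * shiftL2 p q a b) : Commute (H (ratio p q) ω a b) T := by
  have h3 := lie_H_L3 hr ω a b
  have h4 := lie_H_L4 hr ω a b
  have h5 := commute_aeval (Commute.refl (H (ratio p q) ω a b)) (betaPoly p q ω a b)
  have hS : Commute (H (ratio p q) ω a b) (shiftL2 p q a b) :=
    (commute_H_L2 ω a b).add_right (commute_smul_one _ _)
  have hZ : Commute (H (ratio p q) ω a b) (lowerNum p q ω a b) :=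
    ((show Commute _ _ from sub_eq_zero.1 h3).sub_right
      ((show Commute _ _ from sub_eq_zero.1 h4).smul_right _)).add_right h5
  have hm := (diffOps _).sub_mem ((diffOps _).mul_mem (H_mem (k := ratio p q) ω a b) hT)
    ((diffOps _).mul_mem hT (H_mem (k := ratio p q) ω a b))
  refine sub_eq_zero.1 (eq_zero_of_mul_L2 hm (c := (ratio p q : ℂ) ^ 2 * q ^ 2) (a := a) (b := b) ?_)
  change _ * shiftL2 p q a b = 0
  rw [sub_mul, mul_assoc, ← h, hZ.eq, h, mul_assoc T, ← hS.eq, mul_assoc, sub_self]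

include hr in
/-- The commutator of the quotient with `L₂`, again by cancelling `L₂ + k² q²`. -/
theorem lower_lie_L2 {T : Op (ratio p q)} (hT : T ∈ diffOps _)
    (h : lowerNum p q ω a b = T * shiftL2 p q a b) :
    L2 (ratio p q) a b * T - T * L2 (ratio p q) a b = (4 * q : ℂ) • L4 p q ω a b := by
  have h3 := lie_L2_L3 hr ω a b
  have h4 := lie_L2_L4 hr ω a b
  have h5 := commute_aeval (commute_H_L2 (k := ratio p q) ω a b).symm (betaPoly p q ω a b)
  have hS : Commute (L2 (ratio p q) a b) (shiftL2 p q a b) :=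
    (Commute.refl _).add_right (commute_smul_one _ _)
  have hm := (diffOps _).sub_mem ((diffOps _).sub_mem
    ((diffOps _).mul_mem (L2_mem (k := ratio p q) a b) hT)
    ((diffOps _).mul_mem hT (L2_mem (k := ratio p q) a b)))
    (smul_mem_diffOps (4 * q : ℂ) (L4_mem ω a b hr))
  refine sub_eq_zero.1 (eq_zero_of_mul_L2 hm (c := (ratio p q : ℂ) ^ 2 * q ^ 2) (a := a) (b := b) ?_)
  change _ * shiftL2 p q a b = 0
  have e1 : L2 (ratio p q) a b * T * shiftL2 p q a b
      = L2 (ratio p q) a b * lowerNum p q ω a b := by rw [mul_assoc, ← h]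
  have e2 : T * L2 (ratio p q) a b * shiftL2 p q a b
      = lowerNum p q ω a b * L2 (ratio p q) a b := by rw [h, mul_assoc, mul_assoc, hS.eq]
  rw [sub_mul, sub_mul, e1, e2, lowerNum, shiftL2, mul_add, add_mul, h5.eq]
  generalize L2 (ratio p q) a b = A at *
  generalize L3 p q ω a b = B at *
  generalize L4 p q ω a b = C at *
  simp only [mul_sub, sub_mul, mul_smul_comm, smul_mul_assoc, mul_add, mul_one, smul_smul]
  linear_combination (norm := module) h3 - (q : ℂ) • h4

theorem L5_mul {T : Op (ratio p q)} (hr : ratio p q ≠ 0)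
    (h : lowerNum p q ω a b = T * shiftL2 p q a b) :
    ((1 / (4 * q) : ℂ) • T) * ((1 / (ratio p q : ℂ) ^ 2) • L2 (ratio p q) a b
      + ((q : ℂ) ^ 2) • (1 : Op (ratio p q)))
      = (1 / (4 * q * (ratio p q : ℂ) ^ 2)) • lowerNum p q ω a b := by
  have hk : (ratio p q : ℂ) ^ 2 ≠ 0 := pow_ne_zero 2 (Complex.ofReal_ne_zero.2 hr)
  have e : (1 / (ratio p q : ℂ) ^ 2) • L2 (ratio p q) a b + ((q : ℂ) ^ 2) • (1 : Op (ratio p q))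
      = (1 / (ratio p q : ℂ) ^ 2) • shiftL2 p q a b := by
    rw [shiftL2, smul_add, smul_smul]
    congr 2
    rw [← mul_assoc, one_div, inv_mul_cancel₀ hk, one_mul]
  rw [e, h, smul_mul_assoc, mul_smul_comm, smul_smul]
  congr 1
  field_simp

include hr in
theorem IsJointEigen.aeval_H_apply {μ E : ℂ} {ψ : Smooth (ratio p q)}
    (h : IsJointEigen ω a b μ E ψ) : Polynomial.aeval (H (ratio p q) ω a b) (betaPoly p q ω a b) ψ
      = (betaPoly p q ω a b).eval E • ψ := by
  have key := h.atHom_eq_zero (m := muU) (by rw [valHom_muU])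
    (LadderModel.Quantization.aeval_h_sub_mem (M := opModel (ratio p q) hr ω a b) muU
      (betaPoly p q ω a b))
  have e2 : (opModel (ratio p q) hr ω a b).φ (Polynomial.aeval (opModel (ratio p q) hr ω a b).h
    (betaPoly p q ω a b)) = constHom _ (Polynomial.aeval (H (ratio p q) ω a b)
      (betaPoly p q ω a b)) := rfl
  have e3 : valHom μ E (Polynomial.aeval (opModel (ratio p q) hr ω a b).E (betaPoly p q ω a b))
      = (betaPoly p q ω a b).eval E := by
    rw [Polynomial.aeval_def, Polynomial.hom_eval₂]
    have e4 : (opModel (ratio p q) hr ω a b).E = eU := rfl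
    have e5 : (valHom μ E).comp (algebraMap ℂ Cen) = RingHom.id ℂ :=
      RingHom.ext fun c => valHom_cU μ E c
    rw [e4, valHom_eU, e5]
    exact Polynomial.eval₂_id
  rw [map_sub, e2, atHom_constHom, atHom_smul, map_one, e3] at key
  exact sub_eq_zero.1 key

include hr in
/-- The action of the lower order symmetry on joint eigenfunctions. -/
theorem IsJointEigen.L5_apply {T : Op (ratio p q)} (h : lowerNum p q ω a b = T * shiftL2 p q a b)
    {μ E : ℂ} {ψ : Smooth (ratio p q)} (hψ : IsJointEigen ω a b μ E ψ) (h0 : μ ≠ 0) (h1 : μ ≠ q)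
    (h2 : μ ≠ -q) : ((1 / (4 * q) : ℂ) • T) ψ = (-(1 / (4 * q * (ratio p q : ℂ) ^ 2))) •
      ((1 / ((μ + q) * μ)) • atValue (TTW.xiPlus p q a b) μ E ψ
        + (1 / ((μ - q) * μ)) • atValue (TTW.xiMinus p q a b) μ E ψ
        + ((betaPoly p q ω a b).eval E / (μ ^ 2 - q ^ 2)) • ψ) := by
  have hk : (ratio p q : ℂ) ≠ 0 := Complex.ofReal_ne_zero.2 hr
  have hq : (q : ℂ) ≠ 0 := by
    intro hq
    exact hr (by rw [Nat.cast_eq_zero] at hq; simp [ratio, hq])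
  have e1 := congrArg (fun A : Op (ratio p q) => A ψ) h
  have e2 := hψ.L3_apply hr
  have e3 := hψ.L4_apply hr
  have e4 := hψ.aeval_H_apply hr
  have e3' : L4 p q ω a b ψ = μ⁻¹ • (atValue (TTW.xiPlus p q a b) μ E ψ
      - atValue (TTW.xiMinus p q a b) μ E ψ) := by
    rw [← e3, smul_smul, inv_mul_cancel₀ h0, one_smul]
  have e5 : shiftL2 p q a b ψ = ((ratio p q : ℂ) ^ 2 * (q ^ 2 - μ ^ 2)) • ψ := by
    rw [shiftL2, LinearMap.add_apply, hψ.1, smul_one_apply, ← add_smul]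
    congr 1
    ring
  have hd : (q : ℂ) ^ 2 - μ ^ 2 ≠ 0 := by
    rw [sq_sub_sq]
    exact mul_ne_zero (fun hc => h2 (by linear_combination hc)) (fun hc => h1 (by linear_combination -hc))
  have hd2 : μ + q ≠ 0 := fun hc => h2 (by linear_combination hc)
  have hd3 : μ - q ≠ 0 := fun hc => h1 (by linear_combination hc)
  have hd4 : μ ^ 2 - (q : ℂ) ^ 2 ≠ 0 := by rw [sq_sub_sq]; exact mul_ne_zero hd2 hd3
  have e6 : ((ratio p q : ℂ) ^ 2 * (q ^ 2 - μ ^ 2)) • T ψ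
      = atValue (TTW.xiPlus p q a b) μ E ψ + atValue (TTW.xiMinus p q a b) μ E ψ
        - (q : ℂ) • (μ⁻¹ • (atValue (TTW.xiPlus p q a b) μ E ψ
          - atValue (TTW.xiMinus p q a b) μ E ψ)) + (betaPoly p q ω a b).eval E • ψ := by
    rw [← e2, ← e3', ← e4, ← map_smul T, ← e5]
    exact e1.symm
  have hc : (ratio p q : ℂ) ^ 2 * (q ^ 2 - μ ^ 2) ≠ 0 := mul_ne_zero (pow_ne_zero 2 hk) hd
  have e7 : T ψ = ((ratio p q : ℂ) ^ 2 * (q ^ 2 - μ ^ 2))⁻¹ •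
      (((ratio p q : ℂ) ^ 2 * (q ^ 2 - μ ^ 2)) • T ψ) := by
    rw [smul_smul, inv_mul_cancel₀ hc, one_smul]
  rw [LinearMap.smul_apply, e7, e6]
  generalize atValue (TTW.xiPlus p q a b) μ E ψ = X
  generalize atValue (TTW.xiMinus p q a b) μ E ψ = Y
  match_scalars
  · field_simp
    ring
  · field_simp
    ring
  · field_simp
    ring

end LowerSymmetry

end TTW

end

noncomputable section

namespace TTW

/-! ### Orders of the symmetries -/

section Weights

variable {k : ℝ}

/-- `v` is of order at most `N - 1` with symbol `b` of that degree, for the phase function `θ`; for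
`N = 0` this means `v = 0`. -/
def LowSym : ℕ → Op k → Smooth k → Prop
  | 0, v, b => v = 0 ∧ b = 0
  | N + 1, v, b => OrderLE N v ∧ HasSymbol (fLin k 0) N v b

/-- The pair `x = (u, v)`, standing for `u + μ v`, has weight at most `N` and symbols `a`, `b` of that
weight. Here `μ` has weight one, so that `u` is of order at most `N` and `v` of order at most
`N - 1`. -/
def PairSym (N : ℕ) (x : Op k × Op k) (a b : Smooth k) : Prop :=
  (OrderLE N x.1 ∧ HasSymbol (fLin k 0) N x.1 a) ∧ LowSym N x.2 b

theorem LowSym.add {N : ℕ} {v v' : Op k} {b b' : Smooth k} (h : LowSym N v b)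
    (h' : LowSym N v' b') : LowSym N (v + v') (b + b') := by
  cases N with
  | zero => exact ⟨by rw [h.1, h'.1, add_zero], by rw [h.2, h'.2, add_zero]⟩
  | succ N => exact ⟨h.1.add h'.1, h.2.add h'.2⟩

theorem LowSym.mul_left {N l : ℕ} {v T : Op k} {b t : Smooth k} (h : LowSym N v b)
    (hT : OrderLE l T) (ht : HasSymbol (fLin k 0) l T t) : LowSym (N + l) (T * v) (t * b) := by
  cases N with
  | zero =>
    rw [h.1, h.2, mul_zero, mul_zero, zero_add]
    cases l with
    | zero => exact ⟨rfl, rfl⟩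
    | succ l => exact ⟨orderLE_zero l, hasSymbol_zero _ l⟩
  | succ N =>
    rw [show N + 1 + l = (l + N) + 1 by omega]
    exact ⟨hT.mul h.1, ht.mul h.2⟩

theorem LowSym.mul_right {N l : ℕ} {v T : Op k} {b t : Smooth k} (h : LowSym N v b)
    (hT : OrderLE l T) (ht : HasSymbol (fLin k 0) l T t) : LowSym (N + l) (v * T) (t * b) := by
  cases N with
  | zero =>
    rw [h.1, h.2, zero_mul, mul_zero, zero_add]
    cases l with
    | zero => exact ⟨rfl, rfl⟩
    | succ l => exact ⟨orderLE_zero l, hasSymbol_zero _ l⟩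
  | succ N =>
    rw [show N + 1 + l = (N + l) + 1 by omega, mul_comm t]
    exact ⟨h.1.mul hT, h.2.mul ht⟩

/-- Multiplication by `μ` moves the second component to the first one, with a factor of order two. -/
theorem LowSym.mul_right' {N : ℕ} {v T : Op k} {b t : Smooth k} (h : LowSym N v b)
    (hT : OrderLE 2 T) (ht : HasSymbol (fLin k 0) 2 T t) :
    OrderLE (N + 1) (v * T) ∧ HasSymbol (fLin k 0) (N + 1) (v * T) (t * b) := by
  cases N with
  | zero =>
    rw [h.1, h.2, zero_mul, mul_zero]
    exact ⟨orderLE_zero _, hasSymbol_zero _ _⟩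
  | succ N =>
    rw [mul_comm t]
    exact ⟨h.1.mul hT, h.2.mul ht⟩

theorem LowSym.succ {N : ℕ} {v : Op k} {b : Smooth k} (h : LowSym N v b) : LowSym (N + 1) v 0 := by
  cases N with
  | zero => rw [h.1]; exact ⟨orderLE_zero 0, hasSymbol_zero _ 0⟩
  | succ N => exact ⟨h.1.mono N.le_succ, h.2.succ⟩

/-- `F` raises the weight of pairs by at most `n`, and acts on the symbols, with `μ` replaced by the
number `m`, as multiplication by `s`. -/
def HasWeight (m : ℂ) (n : ℕ) (F : AddMonoid.End (Op k × Op k)) (s : Smooth k) : Prop :=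
  ∀ (N : ℕ) (x : Op k × Op k) (a b : Smooth k), PairSym N x a b →
    ∃ a' b', PairSym (N + n) (F x) a' b' ∧ a' + m • b' = s * (a + m • b)

variable {m : ℂ} {n n' : ℕ} {F G : AddMonoid.End (Op k × Op k)} {s t : Smooth k}

theorem HasWeight.mul (hF : HasWeight m n F s) (hG : HasWeight m n' G t) :
    HasWeight m (n + n') (F * G) (s * t) := by
  intro N x a b h
  obtain ⟨a', b', h1, h2⟩ := hG N x a b h
  obtain ⟨a'', b'', h3, h4⟩ := hF _ _ _ _ h1
  refine ⟨a'', b'', ?_, by rw [h4, h2, mul_assoc]⟩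
  rw [add_comm n, ← add_assoc]
  exact h3

theorem HasWeight.add (hF : HasWeight m n F s) (hG : HasWeight m n G t) :
    HasWeight m n (F + G) (s + t) := by
  intro N x a b h
  obtain ⟨a', b', h1, h2⟩ := hF N x a b h
  obtain ⟨a'', b'', h3, h4⟩ := hG N x a b h
  refine ⟨a' + a'', b' + b'', ⟨⟨h1.1.1.add h3.1.1, h1.1.2.add h3.1.2⟩, h1.2.add h3.2⟩, ?_⟩
  rw [smul_add, add_mul, ← h2, ← h4]
  abel

theorem HasWeight.succ (hF : HasWeight m n F s) : HasWeight m (n + 1) F 0 := by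
  intro N x a b h
  obtain ⟨a', b', h1, _⟩ := hF N x a b h
  exact ⟨0, 0, ⟨⟨h1.1.1.mono (Nat.le_succ _), h1.1.2.succ⟩, h1.2.succ⟩, by simp⟩

theorem HasWeight.mono (hF : HasWeight m n F s) (h : n < n') : HasWeight m n' F 0 := by
  induction n', h using Nat.le_induction with
  | base => exact hF.succ
  | succ n' _ ih => exact ih.succ

theorem hasWeight_leftPair {T : Op k} (hT : OrderLE n T) (ht : HasSymbol (fLin k 0) n T t) :
    HasWeight m n (leftPair (Op k) T) t := by
  intro N x a b h
  refine ⟨t * a, t * b, ⟨⟨?_, ?_⟩, h.2.mul_left hT ht⟩, by rw [mul_add, mul_smul_comm]⟩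
  · rw [add_comm]; exact hT.mul h.1.1
  · rw [add_comm]; exact ht.mul h.1.2

theorem hasWeight_rightPair {T : Op k} (hT : OrderLE n T) (ht : HasSymbol (fLin k 0) n T t) :
    HasWeight m n (rightPair T) t := by
  intro N x a b h
  refine ⟨a * t, t * b, ⟨⟨h.1.1.mul hT, h.1.2.mul ht⟩, h.2.mul_right hT ht⟩, ?_⟩
  rw [mul_add, mul_smul_comm, mul_comm a]

/-- Multiplication by `μ` has weight one, provided that `m²` is the symbol of the operator `l` that
replaces `μ²`. -/
theorem hasWeight_muPair {l : Op k} (hl : OrderLE 2 l)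
    (hs : HasSymbol (fLin k 0) 2 l (m ^ 2 • 1)) : HasWeight m 1 (muPair l) (m • 1) := by
  intro N x a b h
  refine ⟨(m ^ 2 • 1) * b, a, ⟨h.2.mul_right' hl hs, h.1⟩, ?_⟩
  simp only [smul_mul_assoc, one_mul, smul_add, smul_smul, pow_two]
  rw [add_comm]

end Weights

section Symbols

variable {k : ℝ}

theorem hasSymbol_L2 (a b : ℂ) : HasSymbol (fLin k 0) 2 (L2 k a b) 1 := by
  simpa using hasSymbol_L2_add a b 0 0

theorem orderLE_L2 (a b : ℂ) : OrderLE 2 (L2 k a b) := by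
  rw [L2]
  refine OrderLE.add (OrderLE.add ?_ ((orderLE_invSinSq.smul _).mono (by omega)))
    ((orderLE_invCosSq.smul _).mono (by omega))
  rw [pow_two]
  exact orderLE_dθ.mul orderLE_dθ

theorem orderLE_dR : OrderLE 1 (dR k) := by
  rw [dR, invR_eq]
  exact ((orderLE_mulOp (fInvR k)).mul orderLE_dr).smul _

theorem hasSymbol_dR : HasSymbol (fLin k 0) 1 (dR k) 0 := by
  have h := ((hasSymbol_mulOp (fLin k 0) (fInvR k)).mul (hasSymbol_dr (fLin k 0))).smul (1 / 2)
  rw [dr_fLin, zero_smul, mul_zero, smul_zero] at h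
  rw [dR, invR_eq]
  exact h

theorem orderLE_dX : OrderLE 1 (dX k) := by
  rw [dX, sinTwo_eq]
  exact (((orderLE_mulOp (fSin k)).mul orderLE_dθ).smul _).neg

theorem hasSymbol_dX : HasSymbol (fLin k 0) 1 (dX k) (-((2 * (k : ℂ))⁻¹ • fSin k)) := by
  have h := ((hasSymbol_mulOp (fLin k 0) (fSin k)).mul (hasSymbol_dθ (fLin k 0))).smul
    (-(2 * (k : ℂ))⁻¹)
  rw [dθ_fLin, mul_one, neg_smul, neg_smul] at h
  rw [dX, sinTwo_eq]
  exact h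

theorem H_eq_add (ω a b : ℂ) : H k ω a b = (dr k ^ 2 + invR k * dr k - ω ^ 2 • rSq k)
    + invR k ^ 2 * L2 k a b := by
  unfold H L2
  noncomm_ring

theorem orderLE_H (ω a b : ℂ) : OrderLE 2 (H k ω a b) := by
  rw [H_eq_add, invR_eq, rSq_eq, sub_eq_add_neg, ← mulOp_pow, pow_two (dr k)]
  exact (((orderLE_dr.mul orderLE_dr).add (((orderLE_mulOp _).mul orderLE_dr).mono (by omega))).add
    (((orderLE_mulOp _).smul _).neg.mono (by omega))).add ((orderLE_mulOp _).mul (orderLE_L2 a b))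

theorem hasSymbol_H (ω a b : ℂ) : HasSymbol (fLin k 0) 2 (H k ω a b) (fInvR k ^ 2) := by
  have h1 := (hasSymbol_dr (fLin k 0)).mul (hasSymbol_dr (fLin k 0))
  rw [dr_fLin, zero_smul, mul_zero] at h1
  have h2 := ((orderLE_mulOp (fInvR k)).mul orderLE_dr).hasSymbol_zero (N := 2) (by omega)
    (fLin k 0)
  have h3 := ((orderLE_mulOp (fRSq k)).smul (ω ^ 2)).neg.hasSymbol_zero (N := 2) (by omega)
    (fLin k 0)
  have h4 := (hasSymbol_mulOp (fLin k 0) (fInvR k ^ 2)).mul (hasSymbol_L2 (k := k) a b)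
  have h := ((h1.add h2).add h3).add h4
  rw [H_eq_add, invR_eq, rSq_eq, sub_eq_add_neg, ← mulOp_pow, pow_two (dr k)]
  simpa using h

end Symbols

end TTW

end

noncomputable section

namespace TTW

/-! ### Symbols of the ladder operators -/

section LadderWeights

variable {k : ℝ} (hk : k ≠ 0) (ω a b : ℂ)

/-- The value of `μ` in symbols: the symbol of `-k⁻² L₂` is its square. -/
def muSym (k : ℝ) : ℂ := Complex.I / k

theorem muSym_sq (k : ℝ) : muSym k ^ 2 = -((k : ℂ) ^ 2)⁻¹ := by
  rw [muSym, div_pow, Complex.I_sq, neg_div, one_div]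

theorem weight_const {n : ℕ} {T : Op k} {t : Smooth k} (hT : OrderLE n T)
    (ht : HasSymbol (fLin k 0) n T t) :
    HasWeight (muSym k) n (pairHom (commute_muSq_H ω a b) (constHom k T)) t := by
  have e : pairHom (commute_muSq_H ω a b) (constHom k T) = leftPair (Op k) T :=
    evalHom_C_C _ _ _ _ _ _ T
  rw [e]
  exact hasWeight_leftPair hT ht

theorem weight_cU (c : ℂ) :
    HasWeight (muSym k) 0 (pairHom (commute_muSq_H ω a b) (cenHom k (cU c))) (c • 1) := by
  have e : cenHom k (cU c) = constHom k (c • (1 : Op k)) := by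
    rw [← Algebra.algebraMap_eq_smul_one]; exact cenHom_C_C c
  rw [e]
  exact weight_const ω a b (orderLE_one.smul c) ((hasSymbol_one _).smul c)

theorem weight_muU :
    HasWeight (muSym k) 1 (pairHom (commute_muSq_H ω a b) (cenHom k muU)) (muSym k • 1) := by
  have e : pairHom (commute_muSq_H ω a b) (muVar k) = muPair (muSq k a b) :=
    evalHom_C_X _ _ _ _ _ _
  rw [cenHom_muU, e]
  refine hasWeight_muPair ((orderLE_L2 a b).smul _).neg ?_
  rw [muSym_sq, muSq, ← neg_smul]
  exact (hasSymbol_L2 a b).smul _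

theorem weight_eU :
    HasWeight (muSym k) 2 (pairHom (commute_muSq_H ω a b) (cenHom k eU)) (fInvR k ^ 2) := by
  have e : pairHom (commute_muSq_H ω a b) (eVar k) = rightPair (H k ω a b) :=
    evalHom_X _ _ _ _ _ _
  rw [cenHom_eU, e]
  exact hasWeight_rightPair (orderLE_H ω a b) (hasSymbol_H ω a b)

/-- Scalar polynomials of weight at most one in `μ`, of the form `c μ + d`. -/
theorem weight_linear (c d : ℂ) :
    HasWeight (muSym k) 1 (pairHom (commute_muSq_H ω a b) (cenHom k (cU c * muU + cU d)))
      ((c * muSym k) • 1) := by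
  have h := ((weight_cU ω a b c).mul (weight_muU (k := k) ω a b)).add
    ((weight_cU ω a b d).mono (n' := 0 + 1) (by omega))
  rw [map_add, map_mul, map_add, map_mul, mul_comm c]
  simpa [smul_smul] using h

/-- The weight of a ladder operator `2s D - s (2s - 1) y - z`, with `2s = c μ + d`. -/
theorem weight_ladder {D y : Op k} {f g h : Smooth k} {z : Cen} (hD : OrderLE 1 D)
    (hD' : HasSymbol (fLin k 0) 1 D f) (hy : OrderLE 0 y) (hy' : HasSymbol (fLin k 0) 0 y g)
    (hz : HasWeight (muSym k) 2 (pairHom (commute_muSq_H ω a b) (cenHom k z)) h)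
    {s : Cen} {c d : ℂ} (hs : 2 * s = cU c * muU + cU d) :
    HasWeight (muSym k) 2 (pairHom (commute_muSq_H ω a b)
      ((2 * s) • constHom k D - (s * (2 * s - 1)) • constHom k y - z • (1 : OpPoly k)))
      ((c * muSym k) • f - (1 / 2 * (c * muSym k) ^ 2) • g - h) := by
  have h1 := (weight_linear (k := k) ω a b c d).mul (weight_const ω a b hD hD')
  have h2 := ((((weight_cU (k := k) ω a b (-(1 / 2))).mul (weight_linear ω a b c d)).mul
    (weight_linear ω a b c (d - 1)))).mul (weight_const ω a b hy hy')
  have h3 := (weight_cU (k := k) ω a b (-1)).mul hz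
  have e2 : cU (-(1 / 2)) * (cU c * muU + cU d) * (cU c * muU + cU (d - 1)) = -(s * (2 * s - 1)) := by
    have e3 : cU c * muU + cU (d - 1) = 2 * s - 1 := by
      rw [hs, cU_eq (d - 1), map_sub, map_one, ← cU_eq]; ring
    have e4 : cU (-(1 / 2)) * 2 = -1 := by
      have := two_mul_cst (U := Cen)
      rw [cst_cen] at this
      rw [cU_eq, map_neg, ← cU_eq]
      linear_combination -this
    rw [← hs, e3]
    linear_combination (s * (2 * s - 1)) * e4
  rw [← map_mul, ← map_mul, ← map_mul, ← map_mul, ← map_mul, e2] at h2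
  rw [← map_mul, ← hs] at h1
  rw [← map_mul, ← map_mul] at h3
  have e5 : cU (-1) * z = -z := by
    have e6 : cU (-1) = -1 := by rw [cU_eq, map_neg, map_one]
    rw [e6]; ring
  rw [e5] at h3
  have key := (h1.add h2).add h3
  rw [← cenHom_mul, ← cenHom_mul, ← cenHom_mul, mul_one, sub_eq_add_neg, sub_eq_add_neg,
    ← neg_mul, ← map_neg, ← map_neg, map_add, map_add]
  convert key using 1
  have e7 : ((c * muSym k) • (1 : Smooth k)) * f = (c * muSym k) • f := by
    rw [smul_mul_assoc, one_mul]
  have e8 : (-(1 / 2) : ℂ) • (1 : Smooth k) * (c * muSym k) • (1 : Smooth k)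
      * (c * muSym k) • (1 : Smooth k) * g = -((1 / 2 * (c * muSym k) ^ 2) • g) := by
    rw [smul_mul_smul_comm, one_mul, smul_mul_smul_comm, one_mul, smul_mul_assoc, one_mul, ← neg_smul]
    congr 1
    ring
  have e9 : ((-1 : ℂ) • (1 : Smooth k)) * h = -h := by
    rw [smul_mul_assoc, one_mul, neg_smul, one_smul]
  rw [e7, e8, e9, ← sub_eq_add_neg, ← sub_eq_add_neg]

theorem weight_jLad {s : Cen} {c d : ℂ} (hs : 2 * s = cU c * muU + cU d) :
    HasWeight (muSym k) 2 (pairHom (commute_muSq_H ω a b) ((opModel k hk ω a b).jLad s))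
      ((-(c * muSym k) / (2 * k)) • fSin k - (1 / 2 * (c * muSym k) ^ 2) • fCos k) := by
  have e : (opModel k hk ω a b).jLad s = jacobiUp (constHom k (dX k)) (constHom k (cosTwo k))
    (cU ((a ^ 2 - b ^ 2) / 2)) s := rfl
  rw [e, jacobiUp]
  have hy : OrderLE 0 (cosTwo k) := by rw [cosTwo_eq]; exact orderLE_mulOp _
  have hy' : HasSymbol (fLin k 0) 0 (cosTwo k) (fCos k) := by
    rw [cosTwo_eq]; exact hasSymbol_mulOp _ _
  have h := weight_ladder ω a b orderLE_dX hasSymbol_dX hy hy'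
    ((weight_cU ω a b ((a ^ 2 - b ^ 2) / 2)).mono (by omega)) hs
  convert h using 1
  rw [sub_zero, smul_neg, smul_smul, ← neg_smul]
  congr 2
  ring

theorem weight_kLad {s : Cen} {c d : ℂ} (hs : 2 * s = cU c * muU + cU d) :
    HasWeight (muSym k) 2 (pairHom (commute_muSq_H ω a b) ((opModel k hk ω a b).kLad s))
      ((-(1 / 2 * (c * muSym k) ^ 2) - 1 / 4) • fInvR k ^ 2) := by
  have e : (opModel k hk ω a b).kLad s = laguerreUp (constHom k (dR k))
    (constHom k (invR k ^ 2)) (cU (1 / 4) * eU) s := rfl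
  rw [e, laguerreUp]
  have hy : OrderLE 0 (invR k ^ 2) := by
    rw [invR_eq, ← mulOp_pow]; exact orderLE_mulOp _
  have hy' : HasSymbol (fLin k 0) 0 (invR k ^ 2) (fInvR k ^ 2) := by
    rw [invR_eq, ← mulOp_pow]; exact hasSymbol_mulOp _ _
  have hz := (weight_cU (k := k) ω a b (1 / 4)).mul (weight_eU ω a b)
  rw [← map_mul, ← map_mul] at hz
  have h := weight_ladder ω a b orderLE_dR hasSymbol_dR hy hy' hz hs
  convert h using 1
  rw [smul_zero, smul_mul_assoc, one_mul]
  match_scalars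
  ring

/-- A chain of `n` ladder operators of weight two with common symbol `t` has weight `2n` and symbol
`t ^ n`; the shift of `s` along the chain does not affect the symbol. -/
theorem weight_upChain {J : Cen → OpPoly k} {u : Cen} {c d : ℂ} {t : Smooth k}
    (hu : 2 * u = cU c * muU + cU d)
    (hJ : ∀ (s : Cen) (d : ℂ), 2 * s = cU c * muU + cU d →
      HasWeight (muSym k) 2 (pairHom (commute_muSq_H ω a b) (J s)) t) (n : ℕ) :
    HasWeight (muSym k) (2 * n) (pairHom (commute_muSq_H ω a b) (upChain J n u)) (t ^ n) := by
  induction n with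
  | zero =>
    rw [upChain_zero, map_one, pow_zero]
    intro N x a b h
    exact ⟨a, b, h, (one_mul _).symm⟩
  | succ n ih =>
    have hs : 2 * (u + (n : Cen)) = cU c * muU + cU (d + 2 * n) := by
      rw [mul_add, hu, cU_eq (d + 2 * n), map_add, map_mul, map_ofNat, map_natCast, ← cU_eq]
      ring
    have h := (hJ _ _ hs).mul ih
    rw [upChain_succ, map_mul, pow_succ', Nat.mul_succ, add_comm]
    exact h

end LadderWeights

section XiWeights

variable {p q : ℕ} (hr : ratio p q ≠ 0) (ω a b : ℂ)

/-- The common symbol of the Laguerre ladder operators. -/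
def kSym (p q : ℕ) : Smooth (ratio p q) := (1 / 4 : ℂ) • fInvR (ratio p q) ^ 2

/-- The symbol of the Jacobi ladder operators, `c = 1` for raising and `c = -1` for lowering. -/
def jSym (p q : ℕ) (c : ℂ) : Smooth (ratio p q) :=
  (1 / (2 * (ratio p q : ℂ) ^ 2)) • (fCos (ratio p q) - (c * Complex.I) • fSin (ratio p q))

/-- The symbol of `Ξ₊` (for `c = 1`) and of `Ξ₋` (for `c = -1`). -/
theorem weight_xi {c : ℂ} (hc : c ^ 2 = 1) :
    HasWeight (muSym (ratio p q)) (2 * p + 2 * q) (pairHom (commute_muSq_H ω a b)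
      ((opModel (ratio p q) hr ω a b).xi p q (cU c * muU))) (kSym p q ^ p * jSym p q c ^ q) := by
  have hk : (ratio p q : ℂ) ≠ 0 := Complex.ofReal_ne_zero.2 hr
  rw [LadderModel.xi, map_mul]
  refine HasWeight.mul ?_ ?_
  · refine weight_upChain ω a b (c := ratio p q * c) (d := 1) ?_ (fun s d hs => ?_) p
    · rw [two_mul_half, cU_eq (_ * _), map_mul, cU_eq 1, map_one, cU_eq c]
      rw [mul_assoc]
      rfl
    · have h := weight_kLad hr ω a b hs
      convert h using 1
      rw [kSym]
      congr 1
      rw [mul_pow, mul_pow, muSym_sq, hc, mul_one, mul_neg, mul_inv_cancel₀ (pow_ne_zero 2 hk)]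
      norm_num
  · refine weight_upChain ω a b (c := c) (d := 1) ?_ (fun s d hs => ?_) q
    · rw [two_mul_half, cU_eq 1, map_one]
    · have h := weight_jLad hr ω a b hs
      convert h using 1
      rw [jSym, smul_sub, smul_smul, sub_eq_neg_add, sub_eq_add_neg, ← neg_smul, ← neg_smul]
      congr 2
      · rw [muSym]; field_simp
      · rw [mul_pow, muSym_sq, hc]; field_simp

/-- The pair `(1, 0)` has weight zero; weights of operator polynomials are read off from their values
there. -/
theorem pairSym_one (k : ℝ) : PairSym (k := k) 0 (1, 0) 1 0 :=
  ⟨⟨orderLE_one, hasSymbol_one _⟩, rfl, rfl⟩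

include hr in
/-- On the pair `(1, 0)` the polynomial `Ξ₊ + Ξ₋` has only an even part, namely `L₃`. -/
theorem pair_xi_add : pairHom (commute_muSq_H ω a b) ((opModel (ratio p q) hr ω a b).xi p q muU
    + (opModel (ratio p q) hr ω a b).xi p q (-muU)) (1, 0) = (L3 p q ω a b, 0) := by
  have h := pair_eq_zero hr ω a b (opQuantization hr ω a b).L3_sub
  have e : (opQuantization hr ω a b).μ = muU := rfl
  have e2 : (opModel (ratio p q) hr ω a b).φ (opQuantization hr ω a b).L3
    = constHom _ (L3 p q ω a b) := rfl
  rw [e, e2, map_sub, end_sub_apply, sub_eq_zero, pair_constHom, mul_one, mul_zero] at h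
  exact h.symm

include hr in
/-- On the pair `(1, 0)` the polynomial `Ξ₊ - Ξ₋` has only an odd part, namely `L₄`. -/
theorem pair_xi_sub : pairHom (commute_muSq_H ω a b) ((opModel (ratio p q) hr ω a b).xi p q muU
    - (opModel (ratio p q) hr ω a b).xi p q (-muU)) (1, 0) = (0, L4 p q ω a b) := by
  have h := pair_eq_zero hr ω a b (opQuantization hr ω a b).L4_sub
  have e : (opQuantization hr ω a b).μ = muU := rfl
  have e2 : (opModel (ratio p q) hr ω a b).φ (opQuantization hr ω a b).L4
    = constHom _ (L4 p q ω a b) := rfl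
  rw [e, e2, map_sub, end_sub_apply, sub_eq_zero, pair_muU_smul, pair_constHom, mul_one, mul_zero,
    zero_mul] at h
  exact h.symm

theorem weight_xi_pos : HasWeight (muSym (ratio p q)) (2 * p + 2 * q)
    (pairHom (commute_muSq_H ω a b) ((opModel (ratio p q) hr ω a b).xi p q muU))
    (kSym p q ^ p * jSym p q 1 ^ q) := by
  have h := weight_xi hr ω a b (c := 1) (one_pow 2)
  rwa [cU_eq, map_one, one_mul] at h

theorem weight_xi_neg : HasWeight (muSym (ratio p q)) (2 * p + 2 * q)
    (pairHom (commute_muSq_H ω a b) ((opModel (ratio p q) hr ω a b).xi p q (-muU)))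
    (kSym p q ^ p * jSym p q (-1) ^ q) := by
  have h := weight_xi hr ω a b (c := -1) (by norm_num)
  have e : cU (-1) * muU = -muU := by
    have e6 : cU (-1) = -1 := by rw [cU_eq, map_neg, map_one]
    rw [e6]; ring
  rwa [e] at h

include hr in
theorem orderLE_L3 : OrderLE (2 * p + 2 * q) (L3 p q ω a b) := by
  obtain ⟨a', b', h, -⟩ := ((weight_xi_pos hr ω a b).add (weight_xi_neg hr ω a b)) 0 (1, 0) 1 0
    (pairSym_one _)
  rw [← map_add, pair_xi_add, zero_add] at h
  exact h.1.1

include hr in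
/-- `L₄` is of order `2 (p + q) - 1`, with an explicit symbol. -/
theorem L4_symbol (hp : 0 < p) : OrderLE (2 * p + 2 * q - 1) (L4 p q ω a b) ∧ ∃ t,
    HasSymbol (fLin _ 0) (2 * p + 2 * q - 1) (L4 p q ω a b) t ∧
    muSym (ratio p q) • t
      = kSym p q ^ p * jSym p q 1 ^ q - kSym p q ^ p * jSym p q (-1) ^ q := by
  have hw := (weight_xi_neg hr ω a b)
  have hneg : HasWeight (muSym (ratio p q)) (2 * p + 2 * q)
    (pairHom (commute_muSq_H ω a b) (-(opModel (ratio p q) hr ω a b).xi p q (-muU)))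
    (-(kSym p q ^ p * jSym p q (-1) ^ q)) := by
    have h := (weight_cU (k := ratio p q) ω a b (-1)).mul hw
    rw [← map_mul, zero_add, cU_eq, map_neg, map_one, map_neg, map_one, neg_one_mul, neg_smul,
      one_smul, neg_one_mul] at h
    exact h
  obtain ⟨a', b', h, h2⟩ := ((weight_xi_pos hr ω a b).add hneg) 0 (1, 0) 1 0 (pairSym_one _)
  rw [← map_add, ← sub_eq_add_neg, pair_xi_sub, zero_add] at h
  have ha : a' = 0 := h.1.2.unique (hasSymbol_zero _ _)
  rw [ha, zero_add, smul_zero, add_zero, mul_one, ← sub_eq_add_neg] at h2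
  have hn : 2 * p + 2 * q = (2 * p + 2 * q - 1) + 1 := by omega
  have h3 := h.2
  rw [hn] at h3
  exact ⟨h3.1, b', h3.2, h2⟩

/-- The ray on which `sin (2pθ) = 1` avoids the singular rays of the potential. -/
theorem quarter_angle_mem (hp : 0 < p) (hq : 0 < q) :
    ((1 : ℝ), Real.pi / (4 * p)) ∈ domain (ratio p q) := by
  have hp' : (0 : ℝ) < p := Nat.cast_pos.2 hp
  have hq' : (1 : ℝ) ≤ q := Nat.one_le_cast.2 hq
  have e : ratio p q * (Real.pi / (4 * p)) = Real.pi / (4 * q) := by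
    rw [ratio]; field_simp
  have h0 : 0 < Real.pi / (4 * q) := by positivity
  have h1 : Real.pi / (4 * q) < Real.pi / 2 := by
    apply div_lt_div_of_pos_left Real.pi_pos (by norm_num) (by linarith)
  refine ⟨one_pos, ?_, ?_⟩
  · change Real.sin (ratio p q * (Real.pi / (4 * p))) ≠ 0
    rw [e]
    exact (Real.sin_pos_of_pos_of_lt_pi h0 (by linarith [Real.pi_pos])).ne'
  · change Real.cos (ratio p q * (Real.pi / (4 * p))) ≠ 0
    rw [e]
    exact (Real.cos_pos_of_mem_Ioo ⟨by linarith, h1⟩).ne'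

theorem smooth_sub_apply {k : ℝ} (f g : Smooth k) (x : domain k) : (f - g).1 x = f.1 x - g.1 x := rfl
theorem smooth_mul_apply {k : ℝ} (f g : Smooth k) (x : domain k) : (f * g).1 x = f.1 x * g.1 x := rfl
theorem smooth_smul_apply {k : ℝ} (c : ℂ) (f : Smooth k) (x : domain k) :
    (c • f).1 x = c * f.1 x := rfl
theorem smooth_pow_apply {k : ℝ} (f : Smooth k) (n : ℕ) (x : domain k) :
    (f ^ n).1 x = f.1 x ^ n := rfl

include hr in
/-- The symbol of `L₄` is proportional to `sin (2pθ)`, hence nonzero. -/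
theorem not_orderLE_L4 (hp : 0 < p) (hq : 0 < q) :
    ¬ OrderLE (2 * p + 2 * q - 2) (L4 p q ω a b) := by
  intro hO
  obtain ⟨-, t, ht, e⟩ := L4_symbol hr ω a b hp
  have h0 : t = 0 := ht.unique (hO.hasSymbol_zero (by omega) _)
  rw [h0, smul_zero] at e
  -- at `r = 1`, `2pθ = π / 2` the two symbols differ by the sign of `i`
  have hx := congrArg (fun f : Smooth (ratio p q) => f.1 ⟨_, quarter_angle_mem hp hq⟩) e
  have hk : (ratio p q : ℂ) ≠ 0 := Complex.ofReal_ne_zero.2 hr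
  have hp' : (p : ℝ) ≠ 0 := Nat.cast_ne_zero.2 hp.ne'
  have hq' : (q : ℝ) ≠ 0 := Nat.cast_ne_zero.2 hq.ne'
  simp only [smooth_sub_apply, smooth_mul_apply, smooth_pow_apply, kSym, jSym, smooth_smul_apply,
    fInvR_apply, fCos_apply, fSin_apply] at hx
  have e1 : 2 * ratio p q * (Real.pi / (4 * p)) = Real.pi / (2 * q) := by
    rw [ratio]; field_simp; norm_num
  rw [e1] at hx
  have e2 : ∀ c : ℂ, (((Real.cos (Real.pi / (2 * q)) : ℝ) : ℂ)
      - c * Complex.I * ((Real.sin (Real.pi / (2 * q)) : ℝ) : ℂ))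
      = Complex.cos (Real.pi / (2 * q) : ℝ) - c * Complex.I * Complex.sin (Real.pi / (2 * q) : ℝ) := by
    intro c
    rw [Complex.ofReal_cos, Complex.ofReal_sin]
  have e3 : (Complex.cos (Real.pi / (2 * q) : ℝ) - 1 * Complex.I * Complex.sin (Real.pi / (2 * q) : ℝ))
      ^ q = -Complex.I := by
    have h : Complex.cos (Real.pi / (2 * q) : ℝ) - 1 * Complex.I * Complex.sin (Real.pi / (2 * q) : ℝ)
        = Complex.exp (-((Real.pi / (2 * q) : ℝ) : ℂ) * Complex.I) := by
      rw [Complex.exp_mul_I, Complex.cos_neg, Complex.sin_neg]; ring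
    rw [h, ← Complex.exp_nat_mul]
    have h2 : (q : ℂ) * (-((Real.pi / (2 * q) : ℝ) : ℂ) * Complex.I) = (-(Real.pi / 2)) * Complex.I := by
      have : (q : ℂ) ≠ 0 := Nat.cast_ne_zero.2 hq.ne'
      push_cast
      field_simp
    rw [h2, Complex.exp_mul_I, Complex.cos_neg, Complex.sin_neg, Complex.cos_pi_div_two,
      Complex.sin_pi_div_two]
    ring
  have e4 : (Complex.cos (Real.pi / (2 * q) : ℝ) - (-1) * Complex.I * Complex.sin (Real.pi / (2 * q) : ℝ))
      ^ q = Complex.I := by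
    have h : Complex.cos (Real.pi / (2 * q) : ℝ) - (-1) * Complex.I * Complex.sin (Real.pi / (2 * q) : ℝ)
        = Complex.exp (((Real.pi / (2 * q) : ℝ) : ℂ) * Complex.I) := by
      rw [Complex.exp_mul_I]; ring
    rw [h, ← Complex.exp_nat_mul]
    have h2 : (q : ℂ) * (((Real.pi / (2 * q) : ℝ) : ℂ) * Complex.I) = (Real.pi / 2) * Complex.I := by
      have : (q : ℂ) ≠ 0 := Nat.cast_ne_zero.2 hq.ne'
      push_cast
      field_simp
    rw [h2, Complex.exp_mul_I, Complex.cos_pi_div_two, Complex.sin_pi_div_two]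
    ring
  rw [e2, e2, mul_pow _ _ q, mul_pow _ _ q, e3, e4] at hx
  have hz : (0 : Smooth (ratio p q)).1 ⟨_, quarter_angle_mem hp hq⟩ = 0 := rfl
  rw [hz] at hx
  have hne : (1 / 4 * ((1 : ℝ) : ℂ)⁻¹ ^ 2) ^ p * (1 / (2 * (ratio p q : ℂ) ^ 2)) ^ q
      * (2 * Complex.I) ≠ 0 := by
    refine mul_ne_zero (mul_ne_zero (pow_ne_zero _ (by norm_num)) (pow_ne_zero _ ?_))
      (mul_ne_zero two_ne_zero Complex.I_ne_zero)
    exact one_div_ne_zero (mul_ne_zero two_ne_zero (pow_ne_zero 2 hk))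
  apply hne
  linear_combination hx

/-! ### The order of the symmetry obtained by division -/

theorem OrderLE.aeval {k : ℝ} {T : Op k} (hT : OrderLE 2 T) {Q : Polynomial ℂ} {n : ℕ}
    (hQ : Q.natDegree ≤ n) : OrderLE (2 * n) (Polynomial.aeval T Q) := by
  have hpow : ∀ i, OrderLE (2 * i) (T ^ i) := fun i => by
    induction i with
    | zero => rw [pow_zero]; exact orderLE_one
    | succ i ih => rw [pow_succ]; exact ih.mul hT
  rw [Polynomial.aeval_eq_sum_range]
  refine Finset.sum_induction _ (OrderLE (2 * n)) (fun _ _ => OrderLE.add) (orderLE_zero _) ?_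
  intro i hi
  rw [Finset.mem_range] at hi
  exact ((hpow i).smul _).mono (by omega)

/-- The degree bound makes `Q(H)` an operator of order at most `2p`. -/
theorem natDegree_betaRadial (p : ℕ) (ω : ℂ) : (betaRadial p ω).natDegree ≤ p := by
  have h : ∀ (n : ℕ) (f : ℕ → ℂ), (∏ l ∈ Finset.Icc 1 n, (Polynomial.C (1 / 16) * Polynomial.X ^ 2
      - Polynomial.C (f l))).natDegree ≤ 2 * n := by
    intro n f
    refine (Polynomial.natDegree_prod_le _ _).trans ?_
    refine (Finset.sum_le_card_nsmul _ _ 2 fun l _ => ?_).trans ?_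
    · compute_degree
    · simp [mul_comm]
  rw [betaRadial]
  split_ifs with hp
  · obtain ⟨n, rfl⟩ := hp
    have e1 : (2 * n + 1 - 1) / 2 = n := by omega
    rw [e1]
    refine Polynomial.natDegree_mul_le.trans ?_
    have h1 : (Polynomial.C (-1 / 4 : ℂ) * Polynomial.X).natDegree ≤ 1 := by compute_degree
    have h2 := h n fun l => ω ^ 2 * (l : ℂ) ^ 2
    exact (Nat.add_le_add h1 h2).trans (by omega)
  · obtain ⟨n, rfl⟩ := Nat.not_odd_iff_even.1 hp
    have e1 : (n + n) / 2 = n := by omega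
    rw [e1]
    refine (h n fun l => ω ^ 2 * ((l : ℂ) - 1 / 2) ^ 2).trans (by omega)

include hr in
/-- Division by `L₂ + k² q²` lowers the order by two. -/
theorem orderLE_lower (hp : 0 < p) (hq : 0 < q) {T : Op (ratio p q)} (hT : T ∈ diffOps _)
    (h : lowerNum p q ω a b = T * shiftL2 p q a b) : OrderLE (2 * p + 2 * q - 2) T := by
  obtain ⟨M, hM⟩ := hT
  have e : 2 * p + 2 * q - 2 + 2 = 2 * p + 2 * q := by omega
  refine hM.of_mul_L2 (a := a) (b := b) (c := (ratio p q : ℂ) ^ 2 * q ^ 2) ?_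
  change OrderLE _ (T * shiftL2 p q a b)
  rw [← h, e, lowerNum, sub_eq_add_neg]
  refine ((orderLE_L3 hr ω a b).add ((((L4_symbol hr ω a b hp).1).smul _).neg.mono (by omega))).add ?_
  have hQ : (betaPoly p q ω a b).natDegree ≤ p :=
    (Polynomial.natDegree_C_mul_le _ _).trans (natDegree_betaRadial p ω)
  exact ((orderLE_H ω a b).aeval hQ).mono (by omega)

end XiWeights

end TTW

end

noncomputable section

namespace TTW

section Hypergeometric

/-! ### Contiguous relations for hypergeometric functions -/

theorem hasSum_of_eq {f g : ℕ → ℂ} {S : ℂ} (h : ∀ j, f j = g j) (hg : HasSum g S) :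
    HasSum f S := by
  rwa [funext h]

/-- Inside the disc of convergence a power series may be summed and differentiated termwise; the
derivative is recorded in the form `z f'(z)`, which preserves the exponents. -/
theorem hasSum_powerSeries {c : ℕ → ℂ} {z : ℂ}
    (hz : ‖z‖ₑ < (FormalMultilinearSeries.ofScalars ℂ c).radius) :
    HasSum (fun j => c j * z ^ j) ((FormalMultilinearSeries.ofScalars ℂ c).sum z) ∧
    HasSum (fun j => (j * c j) * z ^ j)
      (z * deriv (FormalMultilinearSeries.ofScalars ℂ c).sum z) ∧
    AnalyticAt ℂ (FormalMultilinearSeries.ofScalars ℂ c).sum z := by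
  set p := FormalMultilinearSeries.ofScalars ℂ c with hp
  have h := p.hasFPowerSeriesOnBall (lt_of_le_of_lt (zero_le) hz)
  have hz' : z ∈ Metric.eball (0 : ℂ) p.radius := by simpa using hz
  have h1 := h.hasSum hz'
  have h2 := (h.fderiv.hasSum hz').mapL (ContinuousLinearMap.apply ℂ ℂ z)
  rw [zero_add] at h1 h2
  have e : ∀ j (x : ℂ), p j (fun _ => x) = c j * x ^ j := fun j x => by
    rw [hp, FormalMultilinearSeries.ofScalars_apply_eq, smul_eq_mul]
  refine ⟨by simpa only [e] using h1, ?_, h.analyticAt_of_mem hz'⟩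
  have e2 : ∀ j, ContinuousLinearMap.apply ℂ ℂ z (p.derivSeries j fun _ => z)
      = ((j + 1 : ℕ) * c (j + 1)) * z ^ (j + 1) := fun j => by
    rw [ContinuousLinearMap.apply_apply, FormalMultilinearSeries.derivSeries_apply_diag, e,
      nsmul_eq_mul, mul_assoc]
  have e3 : ContinuousLinearMap.apply ℂ ℂ z (fderiv ℂ p.sum z) = z * deriv p.sum z := by
    rw [ContinuousLinearMap.apply_apply, ← fderiv_apply_one_eq_deriv, ← smul_eq_mul, ← map_smul,
      smul_eq_mul, mul_one]
  simp only [e2] at h2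
  rw [e3] at h2
  have h3 := (hasSum_nat_add_iff (f := fun j : ℕ => (j * c j) * z ^ j) 1).1 h2
  simpa using h3

/-- The coefficients of `z f(z)`, from those of `f`. -/
def shiftCoeff (c : ℕ → ℂ) : ℕ → ℂ
  | 0 => 0
  | j + 1 => c j

theorem hasSum_shift {c : ℕ → ℂ} {z S : ℂ} (h : HasSum (fun j => c j * z ^ j) S) :
    HasSum (fun j => shiftCoeff c j * z ^ j) (z * S) := by
  have e : ∀ j : ℕ, shiftCoeff c (j + 1) * z ^ (j + 1) = z * (c j * z ^ j) := fun j => by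
    rw [shiftCoeff]; ring
  have h2 := (hasSum_nat_add_iff (f := fun j : ℕ => shiftCoeff c j * z ^ j) 1).1
    (hasSum_of_eq e (h.mul_left z))
  simpa [shiftCoeff] using h2

/-- The functional equation of `1 / Γ`, valid at all points since `1 / Γ = 0` at the poles of `Γ`. -/
theorem one_div_Gamma_add_one (s : ℂ) :
    (Complex.Gamma s)⁻¹ = s * (Complex.Gamma (s + 1))⁻¹ := by
  simpa using Complex.one_div_Gamma_eq_self_mul_one_div_Gamma_add_one s

theorem eval_ascPochhammer_succ_left (j : ℕ) (x : ℂ) :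
    (ascPochhammer ℂ (j + 1)).eval x = x * (ascPochhammer ℂ j).eval (x + 1) := by
  rw [ascPochhammer_succ_left]; simp [Polynomial.eval_comp]

theorem eval_ascPochhammer_succ_right (j : ℕ) (x : ℂ) :
    (ascPochhammer ℂ (j + 1)).eval x = (ascPochhammer ℂ j).eval x * (x + j) := by
  rw [ascPochhammer_succ_right]; simp

theorem inv_factorial_eq (j : ℕ) :
    ((Nat.factorial j : ℕ) : ℂ)⁻¹ = (j + 1) * ((Nat.factorial (j + 1) : ℕ) : ℂ)⁻¹ := by
  have h : ((j : ℂ) + 1) ≠ 0 := by exact_mod_cast j.succ_ne_zero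
  rw [Nat.factorial_succ]
  push_cast
  rw [mul_inv, mul_inv_cancel_left₀ h]

/-- The Jacobi function as a function of `z = (1 - x) / 2`, without its normalizing factor. -/
def jacobiReg (a b n z : ℂ) : ℂ := Complex.regularizedGaussHGFun (-n) (n + a + b + 1) (a + 1) z

/-- The Laguerre function without its normalizing factor. -/
def laguerreReg (m A z : ℂ) : ℂ := Complex.regularizedHGFun {-m} {A + 1} z

/-- The coefficients of the power series `jacobiReg`, with the division written as multiplication by
inverses so that `1 / Γ = 0` at the poles of `Γ`. -/
def jacobiCoeff (a b n : ℂ) (j : ℕ) : ℂ :=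
  (ascPochhammer ℂ j).eval (-n) * (ascPochhammer ℂ j).eval (n + a + b + 1)
    * (((Nat.factorial j : ℕ) : ℂ)⁻¹ * (Complex.Gamma (a + 1 + j))⁻¹)

/-- The coefficients of the power series `laguerreReg`. -/
def laguerreCoeff (m A : ℂ) (j : ℕ) : ℂ :=
  (ascPochhammer ℂ j).eval (-m) * (((Nat.factorial j : ℕ) : ℂ)⁻¹ * (Complex.Gamma (A + 1 + j))⁻¹)

theorem jacobiCoeff_eq (a b n : ℂ) :
    Complex.regularizedHGFunCoeff {-n, n + a + b + 1} {a + 1} = jacobiCoeff a b n := by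
  funext j
  simp only [Complex.regularizedHGFunCoeff, jacobiCoeff, div_eq_mul_inv, mul_inv,
    Multiset.insert_eq_cons, Multiset.map_cons, Multiset.prod_cons, Multiset.map_singleton,
    Multiset.prod_singleton]

theorem laguerreCoeff_eq (m A : ℂ) :
    Complex.regularizedHGFunCoeff {-m} {A + 1} = laguerreCoeff m A := by
  funext j
  simp only [Complex.regularizedHGFunCoeff, laguerreCoeff, div_eq_mul_inv, mul_inv,
    Multiset.map_singleton, Multiset.prod_singleton]

theorem jacobiReg_eq (a b n : ℂ) :
    jacobiReg a b n = (FormalMultilinearSeries.ofScalars ℂ (jacobiCoeff a b n)).sum := by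
  rw [← jacobiCoeff_eq]; rfl

theorem laguerreReg_eq (m A : ℂ) :
    laguerreReg m A = (FormalMultilinearSeries.ofScalars ℂ (laguerreCoeff m A)).sum := by
  rw [← laguerreCoeff_eq]; rfl

theorem jacobi_radius (a b n : ℂ) {z : ℂ} (hz : ‖z‖ < 1) :
    ‖z‖ₑ < (FormalMultilinearSeries.ofScalars ℂ (jacobiCoeff a b n)).radius := by
  rw [← jacobiCoeff_eq]
  refine lt_of_lt_of_le ?_
    (Complex.radius_regularizedGaussHGFunSeries_ge_one (-n) (n + a + b + 1) (a + 1))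
  rw [enorm_eq_nnnorm]
  exact_mod_cast hz

theorem laguerre_radius (m A z : ℂ) :
    ‖z‖ₑ < (FormalMultilinearSeries.ofScalars ℂ (laguerreCoeff m A)).radius := by
  have h : (FormalMultilinearSeries.ofScalars ℂ (laguerreCoeff m A)).radius = ⊤ :=
    laguerreCoeff_eq m A ▸ Complex.radius_regularizedHGFunSeries_eq_top (by simp)
  rw [h]
  exact enorm_lt_top

/-- The raising relation for Jacobi functions. -/
theorem jacobiReg_raise (a b n : ℂ) {z : ℂ} (hz : ‖z‖ < 1) :
    (2 * n + a + b + 2) * (-2 * (1 - z) * (z * deriv (jacobiReg a b n) z))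
        - (n + a + b + 1) * ((2 * n + a + b + 2) * (1 - 2 * z) + a - b) * jacobiReg a b n z
      = -2 * (n + a + b + 1) * (n + a + 1) * jacobiReg a b (n + 1) z := by
  obtain ⟨h0, h1, -⟩ := hasSum_powerSeries (jacobi_radius a b n hz)
  obtain ⟨h2, -, -⟩ := hasSum_powerSeries (jacobi_radius a b (n + 1) hz)
  rw [← jacobiReg_eq] at h0 h1 h2
  have hl := (((h1.mul_left (-2 * (2 * n + a + b + 2))).add
    ((hasSum_shift h1).mul_left (2 * (2 * n + a + b + 2)))).add
    (h0.mul_left (-(n + a + b + 1) * (2 * (n + a + 1))))).add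
    ((hasSum_shift h0).mul_left (2 * (n + a + b + 1) * (2 * n + a + b + 2)))
  have hr := h2.mul_left (-2 * (n + a + b + 1) * (n + a + 1))
  have key := hl.unique (hasSum_of_eq (fun j => ?_) hr)
  · linear_combination key
  rcases j with _ | j
  · simp only [shiftCoeff, jacobiCoeff, ascPochhammer_zero, Polynomial.eval_one]
    push_cast
    ring
  · simp only [shiftCoeff, jacobiCoeff]
    rw [eval_ascPochhammer_succ_right j (-n), eval_ascPochhammer_succ_right j (n + a + b + 1),
      eval_ascPochhammer_succ_left j (-(n + 1)), eval_ascPochhammer_succ_right j (n + 1 + a + b + 1),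
      inv_factorial_eq j, one_div_Gamma_add_one (a + 1 + j)]
    have e1 : (n + a + b + 1) * (ascPochhammer ℂ j).eval (n + 1 + a + b + 1)
        = (ascPochhammer ℂ j).eval (n + a + b + 1) * (n + a + b + 1 + j) := by
      rw [← eval_ascPochhammer_succ_right, eval_ascPochhammer_succ_left]
      ring_nf
    have e2 : -(n + 1) + 1 = -n := by ring
    rw [e2]
    push_cast
    have e3 : a + 1 + ((j : ℂ) + 1) = a + 1 + j + 1 := by ring
    rw [e3]
    generalize (Complex.Gamma (a + 1 + j + 1))⁻¹ = G at *
    generalize ((Nat.factorial (j + 1) : ℂ))⁻¹ = N at *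
    generalize (ascPochhammer ℂ j).eval (-n) = P at *
    generalize (ascPochhammer ℂ j).eval (n + 1 + a + b + 1) = Q' at *
    generalize (ascPochhammer ℂ j).eval (n + a + b + 1) = Q at *
    linear_combination (-2 * (n + a + 1) * (n + 1) * P * G * N * (n + 1 + a + b + 1 + j) * z ^ (j + 1)) * e1

/-- The lowering relation is the raising relation at `n ↦ -n - a - b - 1`, because the
hypergeometric function is symmetric in its upper parameters. -/
theorem jacobiReg_reflect (a b n : ℂ) : jacobiReg a b (-n - a - b - 1) = jacobiReg a b n := by
  funext z
  have e1 : -(-n - a - b - 1) = n + a + b + 1 := by ring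
  have e2 : -n - a - b - 1 + a + b + 1 = -n := by ring
  rw [jacobiReg, jacobiReg, e1, e2, Complex.regularizedGaussHGFun_symm]

/-- The raising relation for Laguerre functions, multiplied by `z`. -/
theorem laguerreReg_raise (m A z : ℂ) :
    m * (z * laguerreReg m A z) + (1 + A) * (z * deriv (laguerreReg m A) z)
      = -(m * (m + A + 1)) * (z * (z * laguerreReg (m - 1) (A + 2) z)) := by
  obtain ⟨h0, h1, -⟩ := hasSum_powerSeries (laguerre_radius m A z)
  obtain ⟨h2, -, -⟩ := hasSum_powerSeries (laguerre_radius (m - 1) (A + 2) z)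
  rw [← laguerreReg_eq] at h0 h1 h2
  have hl := ((hasSum_shift h0).mul_left m).add (h1.mul_left (1 + A))
  have hr := (hasSum_shift (hasSum_shift h2)).mul_left (-(m * (m + A + 1)))
  refine hl.unique (hasSum_of_eq (fun j => ?_) hr)
  rcases j with _ | _ | j
  · simp [shiftCoeff]
  · simp only [shiftCoeff, laguerreCoeff, zero_add]
    rw [one_div_Gamma_add_one (A + 1 + (0 : ℕ))]
    have e : A + 1 + ((0 : ℕ) : ℂ) + 1 = A + 1 + (1 : ℕ) := by push_cast; ring
    rw [e]
    simp
    ring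
  · simp only [shiftCoeff, laguerreCoeff]
    have e1 : -m + 1 = -(m - 1) := by ring
    have e2 : A + 1 + ((j + 1 : ℕ) : ℂ) = A + 1 + j + 1 := by push_cast; ring
    have e3 : A + 1 + ((j + 1 + 1 : ℕ) : ℂ) = A + 1 + j + 1 + 1 := by push_cast; ring
    have e4 : A + 2 + 1 + (j : ℂ) = A + 1 + j + 1 + 1 := by ring
    rw [e2, e3, e4, eval_ascPochhammer_succ_left (j + 1) (-m), eval_ascPochhammer_succ_left j (-m),
      e1, eval_ascPochhammer_succ_right j, one_div_Gamma_add_one (A + 1 + j + 1),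
      inv_factorial_eq j, inv_factorial_eq (j + 1)]
    push_cast
    ring

/-- The lowering relation for Laguerre functions, multiplied by `z`. -/
theorem laguerreReg_lower (m A z : ℂ) :
    (m + A) * (z * laguerreReg m A z) + (1 - A) * (z * deriv (laguerreReg m A) z)
        + A * (1 - A) * laguerreReg m A z
      = -laguerreReg (m + 1) (A - 2) z := by
  obtain ⟨h0, h1, -⟩ := hasSum_powerSeries (laguerre_radius m A z)
  obtain ⟨h2, -, -⟩ := hasSum_powerSeries (laguerre_radius (m + 1) (A - 2) z)
  rw [← laguerreReg_eq] at h0 h1 h2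
  have hl := (((hasSum_shift h0).mul_left (m + A)).add (h1.mul_left (1 - A))).add
    (h0.mul_left (A * (1 - A)))
  have hr := h2.mul_left (-1)
  rw [neg_one_mul] at hr
  refine hl.unique (hasSum_of_eq (fun j => ?_) hr)
  rcases j with _ | j
  · simp only [shiftCoeff, laguerreCoeff]
    have e1 : A - 2 + 1 + ((0 : ℕ) : ℂ) = A - 1 := by push_cast; ring
    have e2 : A + 1 + ((0 : ℕ) : ℂ) = A - 1 + 1 + 1 := by push_cast; ring
    rw [e1, e2, one_div_Gamma_add_one (A - 1), one_div_Gamma_add_one (A - 1 + 1)]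
    simp
    ring
  · simp only [shiftCoeff, laguerreCoeff]
    have e1 : -(m + 1) + 1 = -m := by ring
    have e2 : A + 1 + ((j + 1 : ℕ) : ℂ) = A + j + 1 + 1 := by push_cast; ring
    have e3 : A - 2 + 1 + ((j + 1 : ℕ) : ℂ) = A + j := by push_cast; ring
    have e4 : A + 1 + (j : ℂ) = A + j + 1 := by ring
    rw [e2, e3, e4, eval_ascPochhammer_succ_left j (-(m + 1)), eval_ascPochhammer_succ_right j (-m),
      e1, one_div_Gamma_add_one (A + j), one_div_Gamma_add_one (A + j + 1), inv_factorial_eq j]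
    push_cast
    ring

end Hypergeometric

end TTW

end

noncomputable section

namespace TTW

section Eigenfunctions

variable {k : ℝ}

/-! ### Smooth functions of the radius and of the angle -/

theorem contDiffOn_real {f : ℂ → ℂ} {g : ℝ × ℝ → ℂ} (hf : ∀ x ∈ domain k, AnalyticAt ℂ f (g x))
    (hg : ContDiffOn ℝ ((⊤ : ℕ∞) : WithTop ℕ∞) g (domain k)) :
    ContDiffOn ℝ ((⊤ : ℕ∞) : WithTop ℕ∞) (fun x => f (g x)) (domain k) := fun x hx =>
  ((hf x hx).restrictScalars (𝕜 := ℝ)).contDiffAt.comp_contDiffWithinAt x (hg x hx)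

theorem contDiffOn_log_sin : ContDiffOn ℝ ((⊤ : ℕ∞) : WithTop ℕ∞)
    (fun x : ℝ × ℝ => ((Real.log (Real.sin (k * x.2)) : ℝ) : ℂ)) (domain k) :=
  Complex.ofRealCLM.contDiff.comp_contDiffOn (ContDiffOn.log
    (Real.contDiff_sin.comp (contDiff_const.mul contDiff_snd)).contDiffOn fun _ hx => hx.2.1)

theorem contDiffOn_log_cos : ContDiffOn ℝ ((⊤ : ℕ∞) : WithTop ℕ∞)
    (fun x : ℝ × ℝ => ((Real.log (Real.cos (k * x.2)) : ℝ) : ℂ)) (domain k) :=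
  Complex.ofRealCLM.contDiff.comp_contDiffOn (ContDiffOn.log
    (Real.contDiff_cos.comp (contDiff_const.mul contDiff_snd)).contDiffOn fun _ hx => hx.2.2)

theorem contDiffOn_log_radius : ContDiffOn ℝ ((⊤ : ℕ∞) : WithTop ℕ∞)
    (fun x : ℝ × ℝ => ((Real.log x.1 : ℝ) : ℂ)) (domain k) :=
  Complex.ofRealCLM.contDiff.comp_contDiffOn (contDiff_fst.contDiffOn.log fun _ hx => hx.1.ne')

theorem analyticAt_jacobiReg (a b n : ℂ) {z : ℂ} (hz : ‖z‖ < 1) :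
    AnalyticAt ℂ (jacobiReg a b n) z := by
  rw [jacobiReg_eq]; exact (hasSum_powerSeries (jacobi_radius a b n hz)).2.2

theorem analyticAt_laguerreReg (m A z : ℂ) : AnalyticAt ℂ (laguerreReg m A) z := by
  rw [laguerreReg_eq]; exact (hasSum_powerSeries (laguerre_radius m A z)).2.2

theorem norm_sin_sq_lt_one {t : ℝ} (h : Real.cos t ≠ 0) : ‖((Real.sin t : ℝ) : ℂ) ^ 2‖ < 1 := by
  rw [norm_pow, Complex.norm_real, Real.norm_eq_abs, sq_abs, Real.sin_sq]
  have := pow_pos (abs_pos.2 h) 2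
  rw [sq_abs] at this
  linarith

/-- The angular factor as a function of `θ`. The powers are written as exponentials of real
logarithms, and `log |t| = log t`. -/
def angVal (k : ℝ) (a b n : ℂ) (θ : ℝ) : ℂ :=
  Complex.exp ((a + 1 / 2) * (Real.log (Real.sin (k * θ)) : ℝ)
    + (b + 1 / 2) * (Real.log (Real.cos (k * θ)) : ℝ))
    * jacobiReg a b n ((Real.sin (k * θ) : ℝ) ^ 2)

/-- The radial factor as a function of `r`, for `r > 0`; the power `r ^ A` is written as an
exponential. -/
def radVal (ω m A : ℂ) (r : ℝ) : ℂ :=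
  Complex.exp (A / 2 * Complex.log ω + A * (Real.log r : ℝ) - ω / 2 * (r : ℂ) ^ 2)
    * laguerreReg m A (ω * (r : ℂ) ^ 2)

/-- The angular factor of the eigenfunctions, without normalization. -/
def angFn (k : ℝ) (a b n : ℂ) : Smooth k := Smooth.restrict (fun x => angVal k a b n x.2) <| by
  have hs : ContDiff ℝ ((⊤ : ℕ∞) : WithTop ℕ∞) fun x : ℝ × ℝ => ((Real.sin (k * x.2) : ℝ) : ℂ) :=
    Complex.ofRealCLM.contDiff.comp (Real.contDiff_sin.comp (contDiff_const.mul contDiff_snd))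
  refine ContDiffOn.mul (ContDiffOn.cexp ?_) (contDiffOn_real
    (g := fun x => ((Real.sin (k * x.2) : ℝ) : ℂ) ^ 2) (fun x hx => ?_) (hs.pow 2).contDiffOn)
  · exact (contDiffOn_const.mul contDiffOn_log_sin).add (contDiffOn_const.mul contDiffOn_log_cos)
  · exact analyticAt_jacobiReg a b n (norm_sin_sq_lt_one hx.2.2)

/-- The radial factor of the eigenfunctions, without normalization. -/
def radFn (k : ℝ) (ω m A : ℂ) : Smooth k := Smooth.restrict (fun x => radVal ω m A x.1) <| by
  have hr : ContDiff ℝ ((⊤ : ℕ∞) : WithTop ℕ∞) fun x : ℝ × ℝ => (x.1 : ℂ) :=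
    Complex.ofRealCLM.contDiff.comp contDiff_fst
  refine ContDiffOn.mul (ContDiffOn.cexp ?_) (contDiffOn_real
    (g := fun x => ω * (x.1 : ℂ) ^ 2) (fun x hx => analyticAt_laguerreReg m A _)
    (contDiff_const.mul (hr.pow 2)).contDiffOn)
  exact (contDiffOn_const.add (contDiffOn_const.mul contDiffOn_log_radius)).sub
    (contDiff_const.mul (hr.pow 2)).contDiffOn

theorem angFn_apply (a b n : ℂ) (x : domain k) : (angFn k a b n).1 x = angVal k a b n x.1.2 := rfl

theorem radFn_apply (ω m A : ℂ) (x : domain k) : (radFn k ω m A).1 x = radVal ω m A x.1.1 := rfl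

theorem hasDerivAt_angVal (a b n : ℂ) (x : domain k) :
    HasDerivAt (angVal k a b n)
      (Complex.exp ((a + 1 / 2) * (Real.log (Real.sin (k * x.1.2)) : ℝ)
        + (b + 1 / 2) * (Real.log (Real.cos (k * x.1.2)) : ℝ))
      * ((a + 1 / 2) * ((k * Real.cos (k * x.1.2) / Real.sin (k * x.1.2) : ℝ) : ℂ)
        + (b + 1 / 2) * ((-(k * Real.sin (k * x.1.2)) / Real.cos (k * x.1.2) : ℝ) : ℂ))
      * jacobiReg a b n ((Real.sin (k * x.1.2) : ℝ) ^ 2)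
      + Complex.exp ((a + 1 / 2) * (Real.log (Real.sin (k * x.1.2)) : ℝ)
        + (b + 1 / 2) * (Real.log (Real.cos (k * x.1.2)) : ℝ))
      * (deriv (jacobiReg a b n) ((Real.sin (k * x.1.2) : ℝ) ^ 2)
        * (2 * ((Real.sin (k * x.1.2) : ℝ) : ℂ) * (k * Real.cos (k * x.1.2))))) x.1.2 := by
  have hs : HasDerivAt (fun t => Real.sin (k * t)) (k * Real.cos (k * x.1.2)) x.1.2 := by
    simpa [mul_comm] using ((hasDerivAt_id x.1.2).const_mul k).sin
  have hc : HasDerivAt (fun t => Real.cos (k * t)) (-(k * Real.sin (k * x.1.2))) x.1.2 := by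
    simpa [mul_comm] using ((hasDerivAt_id x.1.2).const_mul k).cos
  have hF := (analyticAt_jacobiReg a b n (norm_sin_sq_lt_one x.2.2.2)).differentiableAt.hasDerivAt
  have h1 := ((hs.log x.2.2.1).ofReal_comp.const_mul (a + 1 / 2)).add
    ((hc.log x.2.2.2).ofReal_comp.const_mul (b + 1 / 2))
  have h2 := hF.comp x.1.2 ((hasDerivAt_sin_mul k x.1.2).fun_pow 2)
  refine (h1.cexp.mul h2).congr_deriv ?_
  simp [Function.comp]

theorem hasDerivAt_radVal (ω m A : ℂ) {r : ℝ} (hr : r ≠ 0) :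
    HasDerivAt (radVal ω m A)
      (Complex.exp (A / 2 * Complex.log ω + A * (Real.log r : ℝ) - ω / 2 * (r : ℂ) ^ 2)
        * (A * (r : ℂ)⁻¹ - ω * r) * laguerreReg m A (ω * (r : ℂ) ^ 2)
      + Complex.exp (A / 2 * Complex.log ω + A * (Real.log r : ℝ) - ω / 2 * (r : ℂ) ^ 2)
        * (deriv (laguerreReg m A) (ω * (r : ℂ) ^ 2) * (ω * (2 * r)))) r := by
  have hid := (hasDerivAt_id r).ofReal_comp
  have hF := (analyticAt_laguerreReg m A (ω * (r : ℂ) ^ 2)).differentiableAt.hasDerivAt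
  have h1 := (((Real.hasDerivAt_log hr).ofReal_comp.const_mul A).const_add
    (A / 2 * Complex.log ω)).sub ((hid.fun_pow 2).const_mul (ω / 2))
  have h2 := hF.comp r ((hid.fun_pow 2).const_mul ω)
  refine (h1.cexp.mul h2).congr_deriv ?_
  simp only [id_eq, pow_one, Complex.ofReal_inv, Complex.ofReal_one, mul_one, Nat.cast_ofNat,
    Nat.add_one_sub_one, Pi.sub_apply, Function.comp_apply]
  ring

theorem dr_angFn (a b n : ℂ) : dr k (angFn k a b n) = 0 :=
  dr_eq_zero_of_angular (angFn_apply a b n) fun x => (hasDerivAt_angVal a b n x).differentiableAt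

theorem dθ_radFn (ω m A : ℂ) : dθ k (radFn k ω m A) = 0 := by
  apply Smooth.ext'
  intro x
  have := partialD_of_radial (0, 1) (radFn_apply ω m A) (hasDerivAt_radVal ω m A x.2.1.ne')
  simpa [dθ] using this

theorem dX_angFn (hk : k ≠ 0) (a b n : ℂ) (x : domain k) {z : ℂ}
    (hz : z = ((Real.sin (k * x.1.2) : ℝ) : ℂ) ^ 2) :
    (dX k (angFn k a b n)).1 x = Complex.exp ((a + 1 / 2) * (Real.log (Real.sin (k * x.1.2)) : ℝ)
      + (b + 1 / 2) * (Real.log (Real.cos (k * x.1.2)) : ℝ))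
      * (-((a + 1 / 2) * (1 - z) - (b + 1 / 2) * z) * jacobiReg a b n z
        - 2 * (1 - z) * (z * deriv (jacobiReg a b n) z)) := by
  have hk' : (k : ℂ) ≠ 0 := Complex.ofReal_ne_zero.2 hk
  have hS : ((Real.sin (k * x.1.2) : ℝ) : ℂ) ≠ 0 := Complex.ofReal_ne_zero.2 x.2.2.1
  have hC : ((Real.cos (k * x.1.2) : ℝ) : ℂ) ≠ 0 := Complex.ofReal_ne_zero.2 x.2.2.2
  have h := dθ_of_angular (angFn_apply a b n) (hasDerivAt_angVal a b n x)
  have e : (dX k (angFn k a b n)).1 x = -((2 * (k : ℂ))⁻¹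
      * ((Real.sin (2 * k * x.1.2) : ℝ) * (dθ k (angFn k a b n)).1 x)) := rfl
  have e2 : ((Real.sin (2 * k * x.1.2) : ℝ) : ℂ) = 2 * (Real.sin (k * x.1.2) : ℝ)
      * (Real.cos (k * x.1.2) : ℝ) := by
    rw [mul_assoc 2, Real.sin_two_mul]; push_cast; ring
  have e3 : ((Real.cos (k * x.1.2) : ℝ) : ℂ) ^ 2 = 1 - z := by
    rw [hz, ← Complex.ofReal_pow, Real.cos_sq']; push_cast; ring
  rw [e, h, e2, ← hz, ← e3]
  simp only [Complex.ofReal_div, Complex.ofReal_neg, Complex.ofReal_mul]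
  have hz' : ((Real.sin (k * x.1.2) : ℝ) : ℂ) * (Real.sin (k * x.1.2) : ℝ) = z := by rw [hz]; ring
  generalize ((Real.sin (k * x.1.2) : ℝ) : ℂ) = S at *
  generalize ((Real.cos (k * x.1.2) : ℝ) : ℂ) = C at *
  generalize jacobiReg a b n z = F
  generalize deriv (jacobiReg a b n) z = F'
  subst hz
  field_simp
  ring

theorem dR_radFn (ω m A : ℂ) (x : domain k) :
    (dR k (radFn k ω m A)).1 x
      = Complex.exp (A / 2 * Complex.log ω + A * (Real.log x.1.1 : ℝ) - ω / 2 * (x.1.1 : ℂ) ^ 2)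
      * ((A / 2 * ((x.1.1 : ℂ) ^ 2)⁻¹ - ω / 2) * laguerreReg m A (ω * (x.1.1 : ℂ) ^ 2)
        + ω * deriv (laguerreReg m A) (ω * (x.1.1 : ℂ) ^ 2)) := by
  have hx : (x.1.1 : ℂ) ≠ 0 := by exact_mod_cast x.2.1.ne'
  have h := dr_of_radial (radFn_apply ω m A) (hasDerivAt_radVal ω m A x.2.1.ne')
  have e : (dR k (radFn k ω m A)).1 x = (1 / 2 : ℂ)
      * ((x.1.1 : ℂ)⁻¹ * (dr k (radFn k ω m A)).1 x) := rfl
  rw [e, h]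
  field_simp

/-! ### The ladder operators on the separated eigenfunctions -/

/-- The Jacobi raising operator; lowering operators are those with argument `1 - s`. -/
theorem jacobiUp_angFn (hk : k ≠ 0) (a b n : ℂ) :
    jacobiUp (dX k) (cosTwo k) ((a ^ 2 - b ^ 2) / 2) (n + (a + b) / 2 + 1) (angFn k a b n)
      = (-2 * (n + a + b + 1) * (n + a + 1)) • angFn k a b (n + 1) := by
  apply Smooth.ext'
  intro x
  obtain ⟨z, hz⟩ : ∃ z, z = ((Real.sin (k * x.1.2) : ℝ) : ℂ) ^ 2 := ⟨_, rfl⟩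
  have hz1 : ‖z‖ < 1 := hz ▸ norm_sin_sq_lt_one x.2.2.2
  have e1 : ∀ s c : ℂ, (jacobiUp (dX k) (cosTwo k) c s (angFn k a b n)).1 x
      = 2 * s * (dX k (angFn k a b n)).1 x
        - s * (2 * s - 1) * ((Real.cos (2 * k * x.1.2) : ℝ) * angVal k a b n x.1.2)
        - c * angVal k a b n x.1.2 := fun _ _ => rfl
  have e2 : ((Real.cos (2 * k * x.1.2) : ℝ) : ℂ) = 1 - 2 * z := by
    rw [mul_assoc 2, Real.cos_two_mul, Real.cos_sq', hz]; push_cast; ring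
  rw [e1, e2, dX_angFn hk a b n x hz, smooth_smul_apply, angFn_apply, angVal, angVal, ← hz]
  linear_combination Complex.exp ((a + 1 / 2) * (Real.log (Real.sin (k * x.1.2)) : ℝ)
      + (b + 1 / 2) * (Real.log (Real.cos (k * x.1.2)) : ℝ)) * jacobiReg_raise a b n hz1

/-- The angular factor depends on `n` only through `μ²`. -/
theorem angFn_reflect (a b n : ℂ) : angFn k a b (-n - a - b - 1) = angFn k a b n := by
  apply Smooth.ext'
  intro x
  rw [angFn_apply, angFn_apply, angVal, angVal, jacobiReg_reflect]

/-- The Jacobi lowering operator, by reflection of `jacobiUp_angFn`. -/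
theorem jacobiUp_angFn_lower (hk : k ≠ 0) (a b n : ℂ) :
    jacobiUp (dX k) (cosTwo k) ((a ^ 2 - b ^ 2) / 2) (1 - (n + (a + b) / 2 + 1)) (angFn k a b n)
      = (-2 * n * (n + b)) • angFn k a b (n - 1) := by
  have h := jacobiUp_angFn hk a b (-n - a - b - 1)
  have e : -n - a - b - 1 + 1 = -(n - 1) - a - b - 1 := by ring
  rw [angFn_reflect, e, angFn_reflect] at h
  have e1 : 1 - (n + (a + b) / 2 + 1) = -n - a - b - 1 + (a + b) / 2 + 1 := by ring
  have e2 : -2 * n * (n + b) = -2 * (-n - a - b - 1 + a + b + 1) * (-n - a - b - 1 + a + 1) := by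
    ring
  rw [e1, e2]
  exact h

variable {ω : ℂ}

theorem laguerreUp_radFn_apply (m A g s : ℂ) (x : domain k) :
    (laguerreUp (dR k) (invR k ^ 2) g s (radFn k ω m A)).1 x
      = 2 * s * (dR k (radFn k ω m A)).1 x
        - s * (2 * s - 1) * ((x.1.1 : ℂ)⁻¹ * ((x.1.1 : ℂ)⁻¹ * radVal ω m A x.1.1))
        - g * radVal ω m A x.1.1 := rfl

/-- The raising operator on Laguerre functions; `4 g` is the energy. -/
theorem laguerreUp_radFn (hω : ω ≠ 0) (m A : ℂ) :
    laguerreUp (dR k) (invR k ^ 2) (-ω * (2 * m + A + 1) / 2) ((A + 1) / 2) (radFn k ω m A)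
      = (-ω * (m * (m + A + 1))) • radFn k ω (m - 1) (A + 2) := by
  apply Smooth.ext'
  intro x
  have hx : (x.1.1 : ℂ) ≠ 0 := by exact_mod_cast x.2.1.ne'
  have h := laguerreReg_raise m A (ω * (x.1.1 : ℂ) ^ 2)
  rw [laguerreUp_radFn_apply, dR_radFn, smooth_smul_apply, radFn_apply, radVal, radVal]
  have e : Complex.exp ((A + 2) / 2 * Complex.log ω + (A + 2) * (Real.log x.1.1 : ℝ)
      - ω / 2 * (x.1.1 : ℂ) ^ 2)
      = Complex.exp (A / 2 * Complex.log ω + A * (Real.log x.1.1 : ℝ) - ω / 2 * (x.1.1 : ℂ) ^ 2)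
        * (ω * (x.1.1 : ℂ) ^ 2) := by
    have e1 : (A + 2) / 2 * Complex.log ω + (A + 2) * (Real.log x.1.1 : ℝ)
        - ω / 2 * (x.1.1 : ℂ) ^ 2 = (A / 2 * Complex.log ω + A * (Real.log x.1.1 : ℝ)
        - ω / 2 * (x.1.1 : ℂ) ^ 2) + (Complex.log ω + (2 : ℕ) * (Real.log x.1.1 : ℝ)) := by
      push_cast; ring
    rw [e1, Complex.exp_add, Complex.exp_add, Complex.exp_log hω, Complex.exp_nat_mul,
      ← Complex.ofReal_exp, Real.exp_log x.2.1]
  rw [e]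
  generalize Complex.exp _ = X
  generalize laguerreReg m A _ = G at *
  generalize laguerreReg (m - 1) (A + 2) _ = G2 at *
  generalize deriv (laguerreReg m A) _ = G' at *
  have h2 : m * G + (1 + A) * G' = -(m * (m + A + 1)) * (ω * (x.1.1 : ℂ) ^ 2 * G2) := by
    -- the contiguous relation carries an extra factor `z = ω r²`
    apply mul_left_cancel₀ (mul_ne_zero hω (pow_ne_zero 2 hx))
    linear_combination h
  field_simp
  linear_combination 2 * (x.1.1 : ℂ) ^ 2 * X * ω * h2

/-- The lowering operator on Laguerre functions. -/
theorem laguerreUp_radFn_lower (hω : ω ≠ 0) (m A : ℂ) :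
    laguerreUp (dR k) (invR k ^ 2) (-ω * (2 * m + A + 1) / 2) (1 - (A + 1) / 2) (radFn k ω m A)
      = (-ω) • radFn k ω (m + 1) (A - 2) := by
  apply Smooth.ext'
  intro x
  have hx : (x.1.1 : ℂ) ≠ 0 := by exact_mod_cast x.2.1.ne'
  have h := laguerreReg_lower m A (ω * (x.1.1 : ℂ) ^ 2)
  rw [laguerreUp_radFn_apply, dR_radFn, smooth_smul_apply, radFn_apply, radVal, radVal]
  have e : Complex.exp (A / 2 * Complex.log ω + A * (Real.log x.1.1 : ℝ) - ω / 2 * (x.1.1 : ℂ) ^ 2)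
      = Complex.exp ((A - 2) / 2 * Complex.log ω + (A - 2) * (Real.log x.1.1 : ℝ)
      - ω / 2 * (x.1.1 : ℂ) ^ 2) * (ω * (x.1.1 : ℂ) ^ 2) := by
    have e1 : A / 2 * Complex.log ω + A * (Real.log x.1.1 : ℝ)
        - ω / 2 * (x.1.1 : ℂ) ^ 2 = ((A - 2) / 2 * Complex.log ω + (A - 2) * (Real.log x.1.1 : ℝ)
        - ω / 2 * (x.1.1 : ℂ) ^ 2) + (Complex.log ω + (2 : ℕ) * (Real.log x.1.1 : ℝ)) := by
      push_cast; ring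
    rw [e1, Complex.exp_add, Complex.exp_add, Complex.exp_log hω, Complex.exp_nat_mul,
      ← Complex.ofReal_exp, Real.exp_log x.2.1]
  rw [e]
  generalize Complex.exp _ = X
  generalize laguerreReg m A _ = G at *
  generalize laguerreReg (m + 1) (A - 2) _ = G2 at *
  generalize deriv (laguerreReg m A) _ = G' at *
  field_simp
  linear_combination 2 * X * h

end Eigenfunctions

end TTW

end

noncomputable section

namespace TTW

section Separation

variable {k : ℝ} {ω : ℂ}

/-! ### Separation of variables -/

theorem commute_dX_mulOp {F : Smooth k} (hF : dθ k F = 0) : Commute (dX k) (mulOp F) := by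
  rw [dX, sinTwo_eq]
  exact (((commute_mulOp (k := k) _ _).mul_left (commute_dθ_mulOp hF)).smul_left _).neg_left

theorem commute_dR_mulOp {G : Smooth k} (hG : dr k G = 0) : Commute (dR k) (mulOp G) := by
  rw [dR, invR_eq]
  exact ((commute_mulOp (k := k) _ _).mul_left (commute_dr_mulOp hG)).smul_left _

theorem commute_L2_mulOp (a b : ℂ) {F : Smooth k} (hF : dθ k F = 0) :
    Commute (L2 k a b) (mulOp F) := by
  rw [L2, invSinSq_eq, invCosSq_eq]
  exact (((commute_dθ_mulOp hF).pow_left 2).add_left ((commute_mulOp _ _).smul_left _)).add_left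
    ((commute_mulOp _ _).smul_left _)

theorem commute_jacobiUp_mulOp (c s : ℂ) {F : Smooth k} (hF : dθ k F = 0) :
    Commute (jacobiUp (dX k) (cosTwo k) c s) (mulOp F) := by
  rw [jacobiUp, cosTwo_eq]
  exact (((commute_dX_mulOp hF).smul_left _).sub_left ((commute_mulOp _ _).smul_left _)).sub_left
    ((Commute.one_left _).smul_left _)

theorem commute_laguerreUp_mulOp (g s : ℂ) {G : Smooth k} (hG : dr k G = 0) :
    Commute (laguerreUp (dR k) (invR k ^ 2) g s) (mulOp G) := by
  rw [laguerreUp, invR_eq, ← mulOp_pow]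
  exact (((commute_dR_mulOp hG).smul_left _).sub_left ((commute_mulOp _ _).smul_left _)).sub_left
    ((Commute.one_left _).smul_left _)

theorem apply_mul_of_commute {T : Op k} {F : Smooth k} (h : Commute T (mulOp F)) (G : Smooth k) :
    T (F * G) = F * T G :=
  congrArg (fun S : Op k => S G) h.eq

/-- The angular differential equation follows from the ladder relations: lowering a raised function
multiplies it by the scalar `J(-s) J(s)`, and this determines the action of the second order
operator when `s ≠ 0`; otherwise raise a lowered function. -/
theorem angularOp_angFn (hk : k ≠ 0) (a b n : ℂ) {s : ℂ} (hs : s = n + (a + b) / 2 + 1) :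
    angularOp (dX k) (cosTwo k) ((a ^ 2 - b ^ 2) / 2) ((1 / 2 - a ^ 2 - b ^ 2) / 2)
      (s ^ 2 - s + 1 / 4) (angFn k a b n) = 0 := by
  have fac := fun s : ℂ => jacobiUp_mul_jacobiUp (dX_mul_cosTwo hk) ((a ^ 2 - b ^ 2) / 2)
    ((1 / 2 - a ^ 2 - b ^ 2) / 2) s (1 / 4) (by norm_num)
  have up := jacobiUp_angFn hk a b n
  have down := jacobiUp_angFn_lower hk a b n
  rw [← hs] at up down
  -- the factorization determines the second order operator up to the factor `4s²`
  by_cases h0 : s = 0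
  · have h := congrArg (fun T : Op k => T (angFn k a b n)) (fac (1 - s))
    have e1 : -(1 - s) = n - 1 + (a + b) / 2 + 1 := by rw [hs]; ring
    have e2 : (1 - s) ^ 2 - (1 - s) + 1 / 4 = s ^ 2 - s + 1 / 4 := by ring
    simp only [Module.End.mul_apply, LinearMap.sub_apply, LinearMap.smul_apply,
      Module.End.one_apply, down, map_smul] at h
    rw [e1, jacobiUp_angFn hk, sub_add_cancel, e2, smul_smul, eq_sub_iff_add_eq, ← eq_sub_iff_add_eq',
      ← sub_smul] at h
    have hz : 4 * (1 - s) ^ 4 + (4 * ((1 / 2 - a ^ 2 - b ^ 2) / 2) - 1) * (1 - s) ^ 2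
        + ((a ^ 2 - b ^ 2) / 2) ^ 2
        - -2 * n * (n + b) * (-2 * (n - 1 + a + b + 1) * (n - 1 + a + 1)) = 0 := by
      rw [hs]; ring
    rw [hz, zero_smul, h0] at h
    rw [h0]
    exact (smul_eq_zero.1 h).resolve_left (by norm_num)
  · have h := congrArg (fun T : Op k => T (angFn k a b n)) (fac s)
    have e1 : -s = 1 - (n + 1 + (a + b) / 2 + 1) := by rw [hs]; ring
    simp only [Module.End.mul_apply, LinearMap.sub_apply, LinearMap.smul_apply,
      Module.End.one_apply, up, map_smul] at h
    rw [e1, jacobiUp_angFn_lower hk, add_sub_cancel_right, smul_smul, eq_sub_iff_add_eq,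
      ← eq_sub_iff_add_eq', ← sub_smul] at h
    have hz : 4 * s ^ 4 + (4 * ((1 / 2 - a ^ 2 - b ^ 2) / 2) - 1) * s ^ 2
        + ((a ^ 2 - b ^ 2) / 2) ^ 2
        - -2 * (n + a + b + 1) * (n + a + 1) * (-2 * (n + 1) * (n + 1 + b)) = 0 := by
      rw [hs]; ring
    rw [hz, zero_smul] at h
    exact (smul_eq_zero.1 h).resolve_left (mul_ne_zero (by norm_num) (pow_ne_zero 2 h0))

/-- The radial differential equation, by the same argument. -/
theorem radialOp_radFn (hω : ω ≠ 0) (m A : ℂ) :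
    radialOp (dR k) (invR k ^ 2) (-ω * (2 * m + A + 1) / 2) (ω ^ 2 / 4) (A ^ 2 / 4)
      (radFn k ω m A) = 0 := by
  have fac := fun s : ℂ => laguerreUp_mul_laguerreUp (dR_mul_invR_sq (k := k))
    (-ω * (2 * m + A + 1) / 2) (ω ^ 2 / 4) s (1 / 4) (by norm_num)
  have up := laguerreUp_radFn (k := k) hω m A
  have down := laguerreUp_radFn_lower (k := k) hω m A
  by_cases h0 : (A + 1) / 2 = 0
  · have h := congrArg (fun T : Op k => T (radFn k ω m A)) (fac (1 - (A + 1) / 2))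
    have up' := laguerreUp_radFn (k := k) hω (m + 1) (A - 2)
    have e1 : -(1 - (A + 1) / 2) = (A - 2 + 1) / 2 := by ring
    have e2 : (1 - (A + 1) / 2) ^ 2 - (1 - (A + 1) / 2) + 1 / 4 = A ^ 2 / 4 := by ring
    have e3 : -ω * (2 * (m + 1) + (A - 2) + 1) / 2 = -ω * (2 * m + A + 1) / 2 := by ring
    rw [e3, add_sub_cancel_right, sub_add_cancel] at up'
    simp only [Module.End.mul_apply, LinearMap.sub_apply, LinearMap.smul_apply,
      Module.End.one_apply, down, map_smul] at h
    rw [e1, up', e2, smul_smul, eq_sub_iff_add_eq, ← eq_sub_iff_add_eq', ← sub_smul] at h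
    have hz : (-ω * (2 * m + A + 1) / 2) ^ 2 - 4 * (1 - (A + 1) / 2) ^ 2 * (ω ^ 2 / 4)
        - -ω * (-ω * ((m + 1) * (m + 1 + (A - 2) + 1))) = 0 := by ring
    rw [hz, zero_smul, h0] at h
    exact (smul_eq_zero.1 h).resolve_left (by norm_num)
  · have h := congrArg (fun T : Op k => T (radFn k ω m A)) (fac ((A + 1) / 2))
    have down' := laguerreUp_radFn_lower (k := k) hω (m - 1) (A + 2)
    have e1 : -((A + 1) / 2) = 1 - (A + 2 + 1) / 2 := by ring
    have e2 : ((A + 1) / 2) ^ 2 - (A + 1) / 2 + 1 / 4 = A ^ 2 / 4 := by ring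
    have e3 : -ω * (2 * (m - 1) + (A + 2) + 1) / 2 = -ω * (2 * m + A + 1) / 2 := by ring
    rw [e3, add_sub_cancel_right, sub_add_cancel] at down'
    simp only [Module.End.mul_apply, LinearMap.sub_apply, LinearMap.smul_apply,
      Module.End.one_apply, up, map_smul] at h
    rw [e1, down', e2, smul_smul, eq_sub_iff_add_eq, ← eq_sub_iff_add_eq', ← sub_smul] at h
    have hz : (-ω * (2 * m + A + 1) / 2) ^ 2 - 4 * ((A + 1) / 2) ^ 2 * (ω ^ 2 / 4)
        - -ω * (m * (m + A + 1)) * -ω = 0 := by ring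
    rw [hz, zero_smul] at h
    exact (smul_eq_zero.1 h).resolve_left (mul_ne_zero (by norm_num) (pow_ne_zero 2 h0))

theorem L2_angFn (hk : k ≠ 0) (a b n : ℂ) :
    L2 k a b (angFn k a b n) = (-((k : ℂ) ^ 2 * muVal a b n ^ 2)) • angFn k a b n := by
  have h := angularOp_angFn hk a b n rfl
  have e : L2 k a b = (4 * (k : ℂ) ^ 2) • (wOp k * angularOp (dX k) (cosTwo k) ((a ^ 2 - b ^ 2) / 2)
      ((1 / 2 - a ^ 2 - b ^ 2) / 2) (muVal a b n ^ 2 / 4))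
      + (-((k : ℂ) ^ 2 * muVal a b n ^ 2)) • (1 : Op k) := by
    have e3 : ∀ (Y : Op k) (t : ℂ), wOp k * (Y + t • (1 - cosTwo k * cosTwo k))
        = wOp k * Y + t • (1 : Op k) := fun Y t => by
      rw [mul_add, mul_smul_comm, wOp_mul]
    rw [L2_eq hk, angularOp, e3]
    module
  have e2 : (n + (a + b) / 2 + 1) ^ 2 - (n + (a + b) / 2 + 1) + 1 / 4 = muVal a b n ^ 2 / 4 := by
    rw [muVal]; ring
  rw [e2] at h
  rw [e, LinearMap.add_apply, LinearMap.smul_apply, Module.End.mul_apply, h, map_zero, smul_zero,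
    zero_add, LinearMap.smul_apply, Module.End.one_apply]

/-- A product of a Laguerre and a Jacobi function solves both eigenvalue equations: `L₂` is read off
from the angular equation, and `H` from `L₂` and the radial equation. -/
theorem isJointEigen_mul (hk : k ≠ 0) (hω : ω ≠ 0) (a b n m : ℂ) :
    IsJointEigen ω a b (muVal a b n) (energy k ω a b (m + k * n))
      (radFn k ω m (k * muVal a b n) * angFn k a b n) := by
  set A := (k : ℂ) * muVal a b n with hA
  have hL : L2 k a b (radFn k ω m A * angFn k a b n)
      = (-((k : ℂ) ^ 2 * muVal a b n ^ 2)) • (radFn k ω m A * angFn k a b n) := by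
    rw [apply_mul_of_commute (commute_L2_mulOp a b (dθ_radFn ω m A)), L2_angFn hk, mul_smul_comm]
  refine ⟨hL, ?_⟩
  have hR : radialOp (dR k) (invR k ^ 2) (-ω * (2 * m + A + 1) / 2) (ω ^ 2 / 4) (A ^ 2 / 4)
      (radFn k ω m A * angFn k a b n) = 0 := by
    have hc := commute_dR_mulOp (dr_angFn (k := k) a b n)
    have hy : Commute (invR k ^ 2) (mulOp (angFn k a b n)) := by
      rw [invR_eq, ← mulOp_pow]; exact commute_mulOp _ _
    have hcomm : Commute (radialOp (dR k) (invR k ^ 2) (-ω * (2 * m + A + 1) / 2) (ω ^ 2 / 4)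
        (A ^ 2 / 4)) (mulOp (angFn k a b n)) :=
      ((((hc.mul_left hc).add_left (hy.mul_left hc)).sub_left (hy.smul_left _)).sub_left
        ((Commute.one_left _).smul_left _)).sub_left ((hy.mul_left hy).smul_left _)
    rw [mul_comm (radFn k ω m A), apply_mul_of_commute hcomm, radialOp_radFn hω, mul_zero]
  have e : H k ω a b = (4 : ℂ) • (rSq k * radialOp (dR k) (invR k ^ 2) (-ω * (2 * m + A + 1) / 2)
      (ω ^ 2 / 4) (A ^ 2 / 4)) + (-2 * ω * (2 * m + A + 1)) • (1 : Op k)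
      + invR k ^ 2 * (L2 k a b + A ^ 2 • (1 : Op k)) := by
    have h1 : rSq k * invR k ^ 2 = 1 := by rw [pow_two]; exact rSq_mul_invR_sq
    have h2 : rSq k * (invR k ^ 2 * invR k ^ 2) = invR k ^ 2 := by rw [← mul_assoc, h1, one_mul]
    rw [H_eq, radialOp]
    simp only [mul_sub, mul_add, mul_smul_comm, h1, h2, mul_one]
    module
  have hE : energy k ω a b (m + k * n) = -2 * ω * (2 * m + A + 1) := by
    rw [energy, hA, muVal]; ring
  rw [e, LinearMap.add_apply, LinearMap.add_apply, LinearMap.smul_apply, Module.End.mul_apply, hR,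
    map_zero, smul_zero, zero_add, Module.End.mul_apply, LinearMap.add_apply, hL,
    LinearMap.smul_apply, LinearMap.smul_apply, Module.End.one_apply, ← add_smul, hA, mul_pow,
    neg_add_cancel, zero_smul, map_zero, add_zero, hE]

end Separation

end TTW

end

noncomputable section

namespace TTW

/-! ### The ladder chains on the normalized eigenfunctions -/

section Normalization

/-- The hypothesis keeps `z, z + 1, …` off the poles of `Γ`, where `Γ` has the value `0` and the
functional equation fails. -/
theorem Gamma_mul_poch {z : ℂ} (j : ℕ) (h : ∀ i : ℕ, z + i ≠ 0) :
    Complex.Gamma z * poch j z = Complex.Gamma (z + j) := by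
  induction j with
  | zero => simp [poch]
  | succ j ih =>
    rw [poch_eq_prod, Finset.prod_range_succ, ← poch_eq_prod, ← mul_assoc, ih, mul_comm,
      ← Complex.Gamma_add_one _ (h j)]
    push_cast
    ring_nf

/-- In contrast to `Gamma_mul_poch`, no poles have to be excluded for `1 / Γ`. -/
theorem inv_Gamma_eq_poch_mul (z : ℂ) (j : ℕ) :
    (Complex.Gamma z)⁻¹ = poch j z * (Complex.Gamma (z + j))⁻¹ := by
  induction j with
  | zero => simp [poch]
  | succ j ih =>
    rw [ih, one_div_Gamma_add_one (z + j), poch_eq_prod j, poch_eq_prod (j + 1),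
      Finset.prod_range_succ]
    push_cast
    ring_nf

theorem poch_neg (j : ℕ) (z : ℂ) : poch j (-z) = (-1) ^ j * poch j (z - j + 1) := by
  rw [poch, poch, ascPochhammer_eval_neg_eq_descPochhammer, descPochhammer_eval_eq_ascPochhammer]

/-- The normalizing factor `Γ(z + c + 1) / Γ(z + 1)` of the Jacobi and Laguerre functions. -/
def gammaRatio (c z : ℂ) : ℂ := Complex.Gamma (z + c + 1) / Complex.Gamma (z + 1)

end Normalization

section Chains

variable {k : ℝ}

/-- A chain of operators along a sequence of vectors, each of which is mapped to a multiple of the next. -/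
theorem upChain_apply {J : ℂ → Op k} {s : ℂ} {φ : ℕ → Smooth k} {c : ℕ → ℂ}
    (h : ∀ i : ℕ, J (s + i) (φ i) = c i • φ (i + 1)) (N : ℕ) :
    upChain J N s (φ 0) = (∏ i ∈ Finset.range N, c i) • φ N := by
  induction N with
  | zero => simp
  | succ N ih =>
    rw [upChain_succ, Module.End.mul_apply, ih, map_smul, h, smul_smul, Finset.prod_range_succ]

theorem jacobi_chain (hk : k ≠ 0) (a b n : ℂ) (N : ℕ) :
    upChain (jacobiUp (dX k) (cosTwo k) ((a ^ 2 - b ^ 2) / 2)) N (n + (a + b) / 2 + 1)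
        (angFn k a b n)
      = ((-2) ^ N * poch N (n + a + b + 1) * poch N (n + a + 1)) • angFn k a b (n + N) := by
  have h := upChain_apply (J := jacobiUp (dX k) (cosTwo k) ((a ^ 2 - b ^ 2) / 2))
    (s := n + (a + b) / 2 + 1) (φ := fun i => angFn k a b (n + i))
    (c := fun i => -2 * (n + a + b + 1 + i) * (n + a + 1 + i)) (fun i => ?_) N
  · simp only [Nat.cast_zero, add_zero] at h
    rw [h, Finset.prod_mul_distrib, Finset.prod_mul_distrib, Finset.prod_const, Finset.card_range,
      poch_eq_prod, poch_eq_prod]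
  · have := jacobiUp_angFn hk a b (n + i)
    have e1 : n + (a + b) / 2 + 1 + (i : ℂ) = n + i + (a + b) / 2 + 1 := by ring
    have e2 : -2 * (n + a + b + 1 + (i : ℂ)) * (n + a + 1 + i)
        = -2 * (n + i + a + b + 1) * (n + i + a + 1) := by ring
    have e3 : n + ((i + 1 : ℕ) : ℂ) = n + i + 1 := by push_cast; ring
    rw [e1, e2, e3]
    exact this

theorem jacobi_chain_lower (hk : k ≠ 0) (a b n : ℂ) (N : ℕ) :
    upChain (jacobiUp (dX k) (cosTwo k) ((a ^ 2 - b ^ 2) / 2)) N (-n - (a + b) / 2)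
        (angFn k a b n)
      = ((-2) ^ N * poch N (-n) * poch N (-n - b)) • angFn k a b (n - N) := by
  have h := jacobi_chain hk a b (-n - a - b - 1) N
  have e1 : -n - a - b - 1 + (a + b) / 2 + 1 = -n - (a + b) / 2 := by ring
  have e2 : -n - a - b - 1 + a + b + 1 = -n := by ring
  have e3 : -n - a - b - 1 + a + 1 = -n - b := by ring
  have e4 : -n - a - b - 1 + (N : ℂ) = -(n - N) - a - b - 1 := by ring
  rwa [angFn_reflect, e1, e2, e3, e4, angFn_reflect] at h

variable {ω : ℂ}

theorem laguerre_chain (hω : ω ≠ 0) (m A : ℂ) (N : ℕ) :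
    upChain (laguerreUp (dR k) (invR k ^ 2) (-ω * (2 * m + A + 1) / 2)) N ((A + 1) / 2)
        (radFn k ω m A)
      = ((-ω) ^ N * poch N (m - N + 1) * poch N (m + A + 1)) • radFn k ω (m - N) (A + 2 * N) := by
  have h := upChain_apply (J := laguerreUp (dR k) (invR k ^ 2) (-ω * (2 * m + A + 1) / 2))
    (s := (A + 1) / 2) (φ := fun i => radFn k ω (m - i) (A + 2 * i))
    (c := fun i => ω * (-m + i) * (m + A + 1 + i)) (fun i => ?_) N
  · simp only [Nat.cast_zero, mul_zero, add_zero, sub_zero] at h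
    rw [h, Finset.prod_mul_distrib, Finset.prod_mul_distrib, Finset.prod_const, Finset.card_range,
      ← poch_eq_prod, ← poch_eq_prod, poch_neg, ← mul_assoc, ← mul_pow, mul_neg_one]
  · have := laguerreUp_radFn (k := k) hω (m - i) (A + 2 * i)
    have e1 : (A + 1) / 2 + (i : ℂ) = (A + 2 * i + 1) / 2 := by ring
    have e2 : ω * (-m + (i : ℂ)) * (m + A + 1 + i)
        = -ω * ((m - i) * (m - i + (A + 2 * i) + 1)) := by ring
    have e3 : m - ((i + 1 : ℕ) : ℂ) = m - i - 1 := by push_cast; ring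
    have e4 : A + 2 * ((i + 1 : ℕ) : ℂ) = A + 2 * i + 2 := by push_cast; ring
    have e5 : -ω * (2 * m + A + 1) / 2 = -ω * (2 * (m - i) + (A + 2 * i) + 1) / 2 := by ring
    rw [e1, e2, e3, e4, e5]
    exact this

theorem laguerre_chain_lower (hω : ω ≠ 0) (m A : ℂ) (N : ℕ) :
    upChain (laguerreUp (dR k) (invR k ^ 2) (-ω * (2 * m + A + 1) / 2)) N ((-A + 1) / 2)
        (radFn k ω m A)
      = ((-ω) ^ N) • radFn k ω (m + N) (A - 2 * N) := by
  have h := upChain_apply (J := laguerreUp (dR k) (invR k ^ 2) (-ω * (2 * m + A + 1) / 2))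
    (s := (-A + 1) / 2) (φ := fun i => radFn k ω (m + i) (A - 2 * i))
    (c := fun _ => -ω) (fun i => ?_) N
  · simp only [Nat.cast_zero, mul_zero, add_zero, sub_zero] at h
    rw [h, Finset.prod_const, Finset.card_range]
  · have := laguerreUp_radFn_lower (k := k) hω (m + i) (A - 2 * i)
    have e1 : (-A + 1) / 2 + (i : ℂ) = 1 - (A - 2 * i + 1) / 2 := by ring
    have e3 : m + ((i + 1 : ℕ) : ℂ) = m + i + 1 := by push_cast; ring
    have e4 : A - 2 * ((i + 1 : ℕ) : ℂ) = A - 2 * i - 2 := by push_cast; ring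
    have e5 : -ω * (2 * m + A + 1) / 2 = -ω * (2 * (m + i) + (A - 2 * i) + 1) / 2 := by ring
    rw [e1, e3, e4, e5]
    exact this

theorem commute_upChain_left {J : ℂ → Op k} {T : Op k} (h : ∀ s, Commute (J s) T) (N : ℕ) (s : ℂ) :
    Commute (upChain J N s) T := (commute_upChain (fun s => (h s).symm) N s).symm

end Chains

section Values

variable {k : ℝ} (hk : k ≠ 0) (ω a b μ E : ℂ)

theorem atHom_upChain {J : Cen → OpPoly k} {J' : ℂ → Op k}
    (h : ∀ s, atHom k μ E (J s) = J' (valHom μ E s)) (N : ℕ) (s : Cen) :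
    atHom k μ E (upChain J N s) = upChain J' N (valHom μ E s) := by
  induction N with
  | zero => exact map_one _
  | succ N ih => rw [upChain_succ, map_mul, ih, h, map_add, map_natCast, upChain_succ]

theorem atHom_jLad (s : Cen) : atHom k μ E ((opModel k hk ω a b).jLad s)
    = jacobiUp (dX k) (cosTwo k) ((a ^ 2 - b ^ 2) / 2) (valHom μ E s) := by
  have e : (opModel k hk ω a b).jLad s = jacobiUp (constHom k (dX k)) (constHom k (cosTwo k))
    (cU ((a ^ 2 - b ^ 2) / 2)) s := rfl
  rw [e, jacobiUp, jacobiUp, map_sub, map_sub, atHom_smul, atHom_smul, atHom_smul, atHom_constHom,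
    atHom_constHom, map_one, valHom_cU, map_mul, map_mul, map_sub, map_mul, map_one, map_ofNat]

theorem atHom_kLad (s : Cen) : atHom k μ E ((opModel k hk ω a b).kLad s)
    = laguerreUp (dR k) (invR k ^ 2) (1 / 4 * E) (valHom μ E s) := by
  have e : (opModel k hk ω a b).kLad s = laguerreUp (constHom k (dR k))
    (constHom k (invR k ^ 2)) (cU (1 / 4) * eU) s := rfl
  rw [e, laguerreUp, laguerreUp, map_sub, map_sub, atHom_smul, atHom_smul, atHom_smul,
    atHom_constHom, atHom_constHom, map_one, map_mul _ (cU (1 / 4)), valHom_cU, valHom_eU, map_mul,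
    map_mul, map_sub, map_mul, map_one, map_ofNat]

theorem valHom_half (m : Cen) : valHom μ E (half m) = (valHom μ E m + 1) / 2 := by
  rw [half, cst_cen, map_mul, valHom_cU, map_add, map_one]; ring

variable {p q : ℕ} (hr : ratio p q ≠ 0)

theorem atHom_xi (m : Cen) {v : ℂ} (hv : valHom μ E m = v) :
    atHom _ μ E ((opModel (ratio p q) hr ω a b).xi p q m)
      = upChain (laguerreUp (dR _) (invR _ ^ 2) (1 / 4 * E)) p ((ratio p q * v + 1) / 2)
        * upChain (jacobiUp (dX _) (cosTwo _) ((a ^ 2 - b ^ 2) / 2)) q ((v + 1) / 2) := by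
  have e : cst Cen (opModel (ratio p q) hr ω a b).κ = cU (ratio p q) := rfl
  rw [LadderModel.xi, map_mul (atHom (ratio p q) μ E), atHom_upChain μ E (atHom_kLad hr ω a b μ E),
    atHom_upChain μ E (atHom_jLad hr ω a b μ E), valHom_half, valHom_half, e,
    map_mul (valHom μ E) (cU (ratio p q)), hv, valHom_cU]

/-- On a product of a radial and an angular function the two chains act separately. -/
theorem atHom_xi_mul (m : Cen) {v : ℂ} (hv : valHom μ E m = v) {F F' G G' : Smooth (ratio p q)}
    {c d : ℂ} (hF : dθ _ F = 0) (hG : dr _ G' = 0)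
    (h1 : upChain (laguerreUp (dR _) (invR _ ^ 2) (1 / 4 * E)) p ((ratio p q * v + 1) / 2) F
      = d • F')
    (h2 : upChain (jacobiUp (dX _) (cosTwo _) ((a ^ 2 - b ^ 2) / 2)) q ((v + 1) / 2) G = c • G') :
    atHom _ μ E ((opModel (ratio p q) hr ω a b).xi p q m) (F * G) = (d * c) • (F' * G') := by
  rw [atHom_xi ω a b μ E hr m hv, Module.End.mul_apply,
    apply_mul_of_commute (commute_upChain_left (fun s => commute_jacobiUp_mulOp _ s hF) _ _), h2,
    mul_smul_comm, map_smul, mul_comm F, apply_mul_of_commute (commute_upChain_left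
      (fun s => commute_laguerreUp_mulOp _ s hG) _ _), h1, mul_smul_comm, smul_smul, mul_comm G',
    mul_comm c]

end Values

section EigenBasis

variable {k : ℝ}

/-- The eigenfunction `Ψ_{n,m}` as a smooth function. -/
def eigenFn (k : ℝ) (ω a b n m : ℂ) : Smooth k :=
  (gammaRatio a n * gammaRatio (k * muVal a b n) m)
    • (radFn k ω m (k * muVal a b n) * angFn k a b n)

theorem cpow_eq_exp_log_abs {t : ℝ} (ht : t ≠ 0) (c : ℂ) :
    ((|t| : ℝ) : ℂ) ^ c = Complex.exp (c * (Real.log t : ℝ)) := by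
  rw [Complex.cpow_def_of_ne_zero (Complex.ofReal_ne_zero.2 (abs_ne_zero.2 ht)),
    ← Complex.ofReal_log (abs_nonneg t), Real.log_abs, mul_comm]

/-- The smooth function agrees with the formula for `Ψ_{n,m}`: powers of positive reals are exponentials
of real logarithms. -/
theorem eigenFn_apply {ω : ℂ} (hω : ω ≠ 0) (a b n m : ℂ) (x : domain k) :
    (eigenFn k ω a b n m).1 x = psiFn k ω a b n m x := by
  have e1 : (1 - ((Real.cos (2 * k * x.1.2) : ℝ) : ℂ)) / 2
      = ((Real.sin (k * x.1.2) : ℝ) : ℂ) ^ 2 := by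
    rw [← Complex.ofReal_pow, Real.sin_sq, mul_assoc 2, Real.cos_two_mul]; push_cast; ring
  have e2 : ∀ c : ℂ, (x.1.1 : ℂ) ^ c = Complex.exp (c * (Real.log x.1.1 : ℝ)) := fun c => by
    rw [← cpow_eq_exp_log_abs x.2.1.ne', abs_of_pos x.2.1]
  rw [eigenFn, smooth_smul_apply, smooth_mul_apply, radFn_apply, angFn_apply, radVal, angVal, psiFn,
    jacobiFn, laguerreFn, e1, e2, cpow_eq_exp_log_abs x.2.2.1, cpow_eq_exp_log_abs x.2.2.2,
    Complex.cpow_def_of_ne_zero hω, gammaRatio, gammaRatio, laguerreReg, jacobiReg, Complex.exp_sub,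
    Complex.exp_add, Complex.exp_add, neg_mul, Complex.exp_neg, div_eq_mul_inv (_ * _) (Complex.exp _),
    mul_comm (Complex.log ω)]
  ring

theorem isJointEigen_eigenFn (hk : k ≠ 0) {ω : ℂ} (hω : ω ≠ 0) (a b n m : ℂ) :
    IsJointEigen ω a b (muVal a b n) (energy k ω a b (m + k * n)) (eigenFn k ω a b n m) := by
  obtain ⟨h1, h2⟩ := isJointEigen_mul hk hω a b n m
  exact ⟨by rw [eigenFn, map_smul, h1, smul_comm], by rw [eigenFn, map_smul, h2, smul_comm]⟩

variable {p q : ℕ} (hr : ratio p q ≠ 0) {ω : ℂ} (hω : ω ≠ 0) (a b n m : ℂ)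

include hr hω

/-- The action of `Ξ₊` follows from the two chains and the change of the `Γ`-factors. The numerators are
finite by hypothesis; the denominators enter only through `1 / Γ`. -/
theorem xiPlus_eigenFn (h : Admissible (ratio p q) a b n m) :
    atValue (xiPlus p q a b) (muVal a b n) (energy (ratio p q) ω a b (m + ratio p q * n))
        (eigenFn (ratio p q) ω a b n m)
      = ((-2) ^ q * (-1) ^ p * ω ^ p * poch q (n + 1) * poch q (n + a + b + 1))
        • eigenFn (ratio p q) ω a b (n + q) (m - p) := by
  have hκ : (ratio p q : ℂ) * q = p := ratio_mul hr
  obtain ⟨A, hA⟩ : ∃ A, A = (ratio p q : ℂ) * muVal a b n := ⟨_, rfl⟩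
  have hA' : (ratio p q : ℂ) * muVal a b (n + q) = A + 2 * p := by
    rw [hA, muVal, muVal]
    linear_combination 2 * hκ
  have hE : 1 / 4 * energy (ratio p q) ω a b (m + ratio p q * n) = -ω * (2 * m + A + 1) / 2 := by
    rw [energy, hA, muVal]; ring
  have hs : (muVal a b n + 1) / 2 = n + (a + b) / 2 + 1 := by rw [muVal]; ring
  have key := atHom_xi_mul ω a b (muVal a b n) (energy (ratio p q) ω a b (m + ratio p q * n)) hr muU
    (valHom_muU _ _) (dθ_radFn ω m A) (dr_angFn a b (n + q))
    (by rw [hE, ← hA]; exact laguerre_chain hω m A p)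
    (by rw [hs]; exact jacobi_chain hr a b n q)
  rw [← xiPlus_eq ω a b hr, atHom_eq] at key
  rw [eigenFn, eigenFn, map_smul, ← hA, hA', key, smul_smul, smul_smul]
  congr 1
  have g1 := Gamma_mul_poch (z := n + a + 1) q fun i => (h i).1
  have g2 := inv_Gamma_eq_poch_mul (n + 1) q
  have g3 := Gamma_mul_poch (z := m + A + 1) p fun i => hA ▸ (h i).2
  have g4 := inv_Gamma_eq_poch_mul (m - p + 1) p
  have e1 : n + q + a + 1 = n + a + 1 + q := by ring
  have e2 : n + (q : ℂ) + 1 = n + 1 + q := by ring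
  have e3 : m - p + (A + 2 * p) + 1 = m + A + 1 + p := by ring
  have e4 : m - (p : ℂ) + 1 + p = m + 1 := by ring
  rw [e4] at g4
  rw [gammaRatio, gammaRatio, gammaRatio, gammaRatio, e1, e2, e3, ← g1, ← g3, div_eq_mul_inv,
    div_eq_mul_inv, div_eq_mul_inv, div_eq_mul_inv, g2, g4, neg_pow ω]
  ring

/-- The action of `Ξ₋`. The numerators of `Ψ_{n,m}` are expressed through those of `Ψ_{n-q,m+p}`, which
are finite by hypothesis. -/
theorem xiMinus_eigenFn (h : Admissible (ratio p q) a b (n - q) (m + p)) :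
    atValue (xiMinus p q a b) (muVal a b n) (energy (ratio p q) ω a b (m + ratio p q * n))
        (eigenFn (ratio p q) ω a b n m)
      = ((-2) ^ q * ω ^ p * poch q (-n - a) * poch q (-n - b) * poch p (m + 1)
          * poch p (-m - ratio p q * muVal a b n))
        • eigenFn (ratio p q) ω a b (n - q) (m + p) := by
  have hκ : (ratio p q : ℂ) * q = p := ratio_mul hr
  obtain ⟨A, hA⟩ : ∃ A, A = (ratio p q : ℂ) * muVal a b n := ⟨_, rfl⟩
  have hA' : (ratio p q : ℂ) * muVal a b (n - q) = A - 2 * p := by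
    rw [hA, muVal, muVal]
    linear_combination -2 * hκ
  have hE : 1 / 4 * energy (ratio p q) ω a b (m + ratio p q * n) = -ω * (2 * m + A + 1) / 2 := by
    rw [energy, hA, muVal]; ring
  have hs : (-muVal a b n + 1) / 2 = -n - (a + b) / 2 := by rw [muVal]; ring
  have key := atHom_xi_mul ω a b (muVal a b n) (energy (ratio p q) ω a b (m + ratio p q * n)) hr
    (-muU) (v := -muVal a b n) (by rw [map_neg, valHom_muU]) (dθ_radFn ω m A)
    (dr_angFn a b (n - q))
    (by rw [hE, mul_neg, ← hA]; exact laguerre_chain_lower hω m A p)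
    (by rw [hs]; exact jacobi_chain_lower hr a b n q)
  rw [← xiMinus_eq ω a b hr, atHom_eq] at key
  rw [eigenFn, eigenFn, map_smul, ← hA, hA', key, smul_smul, smul_smul]
  congr 1
  have g1 := Gamma_mul_poch (z := n - q + a + 1) q fun i => (h i).1
  have g2 := inv_Gamma_eq_poch_mul (n - q + 1) q
  have g3 := Gamma_mul_poch (z := m + p + (A - 2 * p) + 1) p fun i => hA' ▸ (h i).2
  have g4 := inv_Gamma_eq_poch_mul (m + 1) p
  have e1 : n - q + a + 1 + q = n + a + 1 := by ring
  have e2 : n - (q : ℂ) + 1 + q = n + 1 := by ring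
  have e3 : m + p + (A - 2 * p) + 1 + p = m + A + 1 := by ring
  have e4 : m + 1 + (p : ℂ) = m + p + 1 := by ring
  rw [e1] at g1
  rw [e2] at g2
  rw [e3] at g3
  rw [e4] at g4
  have n1 := poch_neg q n
  have n2 := poch_neg q (n + a)
  have n3 := poch_neg p (m + A)
  have f2 : n + a - (q : ℂ) + 1 = n - q + a + 1 := by ring
  have f3 : m + A - (p : ℂ) + 1 = m + p + (A - 2 * p) + 1 := by ring
  rw [neg_add', f2] at n2
  rw [neg_add', f3] at n3
  rw [gammaRatio, gammaRatio, gammaRatio, gammaRatio, ← g1, ← g3, div_eq_mul_inv,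
    div_eq_mul_inv, div_eq_mul_inv, div_eq_mul_inv, g2, g4, neg_pow ω, n1, n2, n3]
  ring

end EigenBasis

end TTW

end

noncomputable section

namespace TTW

/-! ### The quadratic structure equations -/

section StructureEquations

variable {p q : ℕ} (hr : ratio p q ≠ 0) (ω a b : ℂ)

include hr

theorem lie_L2_R : L2 (ratio p q) a b * R p q ω a b - R p q ω a b * L2 (ratio p q) a b
    = -((8 * (ratio p q : ℂ) ^ 2 * q ^ 2) • symm2 (L2 (ratio p q) a b) (L4 p q ω a b))
      - (16 * (ratio p q : ℂ) ^ 4 * q ^ 4) • L4 p q ω a b :=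
  (opQuantization hr ω a b).lie_L_R

theorem lie_L2_L4_eq_R :
    L2 (ratio p q) a b * L4 p q ω a b - L4 p q ω a b * L2 (ratio p q) a b = R p q ω a b :=
  (opQuantization hr ω a b).lie_L_L4

theorem lie_L4_R : L4 p q ω a b * R p q ω a b - R p q ω a b * L4 p q ω a b
    = (8 * (ratio p q : ℂ) ^ 2 * q ^ 2) • L4 p q ω a b ^ 2 + (8 * (ratio p q : ℂ) ^ 2 * q) •
      evalAtOps (polyMinus (ratio p q : ℂ) p q) (H (ratio p q) ω a b ^ 2) (L2 (ratio p q) a b)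
        (ω ^ 2) a b := by
  rw [pow_two (L4 p q ω a b)]
  exact (opQuantization hr ω a b).lie_L4_R

theorem R_sq (hq : (q : ℂ) ≠ 0) :
    (3 / (8 * (ratio p q : ℂ) ^ 2 * q ^ 2)) • R p q ω a b ^ 2
      = -((22 * (ratio p q : ℂ) ^ 2 * q ^ 2) • L4 p q ω a b ^ 2)
        - symm3 (L2 (ratio p q) a b) (L4 p q ω a b) (L4 p q ω a b)
        - (4 * (ratio p q : ℂ) ^ 2 * q) • evalAtOps (polyMinus (ratio p q : ℂ) p q)
          (H (ratio p q) ω a b ^ 2) (L2 (ratio p q) a b) (ω ^ 2) a b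
        + (12 * (ratio p q : ℂ) ^ 2) • evalAtOps (polyPlus (ratio p q : ℂ) p q)
          (H (ratio p q) ω a b ^ 2) (L2 (ratio p q) a b) (ω ^ 2) a b := by
  rw [pow_two (R p q ω a b), pow_two (L4 p q ω a b), symm3]
  exact (opQuantization hr ω a b).R_sq hq

variable {ω a b} {μ E : ℂ} {ψ : Smooth (ratio p q)} (hψ : IsJointEigen ω a b μ E ψ)

include hψ

theorem IsJointEigen.add_apply :
    atValue (TTW.xiMinus p q a b) (μ + 2 * q) E (atValue (TTW.xiPlus p q a b) μ E ψ)
      + atValue (TTW.xiPlus p q a b) (μ - 2 * q) E (atValue (TTW.xiMinus p q a b) μ E ψ)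
    = evalAtOps (polyPlus (ratio p q : ℂ) p q) (H (ratio p q) ω a b ^ 2) (L2 (ratio p q) a b)
      (ω ^ 2) a b ψ := by
  rw [hψ.xiMinus_xiPlus hr, hψ.xiPlus_xiMinus hr, hψ.polyPlus_apply hr, add_smul]

theorem IsJointEigen.sub_apply :
    atValue (TTW.xiMinus p q a b) (μ + 2 * q) E (atValue (TTW.xiPlus p q a b) μ E ψ)
      - atValue (TTW.xiPlus p q a b) (μ - 2 * q) E (atValue (TTW.xiMinus p q a b) μ E ψ)
    = μ • evalAtOps (polyMinus (ratio p q : ℂ) p q) (H (ratio p q) ω a b ^ 2)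
      (L2 (ratio p q) a b) (ω ^ 2) a b ψ := by
  rw [hψ.xiMinus_xiPlus hr, hψ.xiPlus_xiMinus hr, hψ.polyMinus_apply hr, sub_smul]

end StructureEquations

section LowerOrder

variable {p q : ℕ} (hr : ratio p q ≠ 0) {ω a b : ℂ} {T : Op (ratio p q)} (hT : T ∈ diffOps _)
  (h : lowerNum p q ω a b = T * shiftL2 p q a b)

include hr hT h

theorem lie_H_L5 : ⁅H (ratio p q) ω a b, (1 / (4 * q) : ℂ) • T⁆ = 0 := by
  rw [Ring.lie_def, mul_smul_comm, smul_mul_assoc, (lower_commute_H hr hT h).eq, sub_self]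

theorem lie_L2_L5 (hq : (q : ℂ) ≠ 0) :
    ⁅L2 (ratio p q) a b, (1 / (4 * q) : ℂ) • T⁆ = L4 p q ω a b := by
  rw [Ring.lie_def, mul_smul_comm, smul_mul_assoc, ← smul_sub, lower_lie_L2 hr hT h, smul_smul,
    one_div, inv_mul_cancel₀ (mul_ne_zero (by norm_num) hq), one_smul]

end LowerOrder

end TTW

end

set_option maxHeartbeats 800000 in
theorem mainTheorem2 (p q : ℕ) (hp : 0 < p) (hq : 0 < q) (hpq : Nat.Coprime p q) :
    ∃ Pp Pm : MvPolynomial (Fin 5) ℂ, ∀ ω a b : ℂ,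
      let k : ℝ := TTW.ratio p q
      let H : TTW.Op k := TTW.H k ω a b
      let L2 : TTW.Op k := TTW.L2 k a b
      let L3 : TTW.Op k := TTW.L3 p q ω a b
      let L4 : TTW.Op k := TTW.L4 p q ω a b
      let R : TTW.Op k := TTW.R p q ω a b
      let Xp : ℂ → ℂ → TTW.Op k := fun μ E => TTW.atValue (TTW.xiPlus p q a b) μ E
      let Xm : ℂ → ℂ → TTW.Op k := fun μ E => TTW.atValue (TTW.xiMinus p q a b) μ E
      let PpOp : TTW.Op k := TTW.evalAtOps Pp (H ^ 2) L2 (ω ^ 2) a b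
      let PmOp : TTW.Op k := TTW.evalAtOps Pm (H ^ 2) L2 (ω ^ 2) a b
      let Q : Polynomial ℂ := TTW.betaPoly p q ω a b
      -- action of the raising and lowering operators on Jacobi and Laguerre functions
      (ω ≠ 0 → ∃ Ψ : ℂ → ℂ → TTW.Smooth k,
        (∀ (n m : ℂ) (x : TTW.domain k), (Ψ n m).1 x = TTW.psiFn k ω a b n m x) ∧
        (∀ n m : ℂ, TTW.IsJointEigen ω a b (TTW.muVal a b n)
          (TTW.energy k ω a b (m + k * n)) (Ψ n m)) ∧
        (∀ n m : ℂ, TTW.Admissible k a b n m →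
          Xp (TTW.muVal a b n) (TTW.energy k ω a b (m + k * n)) (Ψ n m)
            = ((-2) ^ q * (-1) ^ p * ω ^ p * TTW.poch q (n + 1) * TTW.poch q (n + a + b + 1))
              • Ψ (n + q) (m - p)) ∧
        (∀ n m : ℂ, TTW.Admissible k a b (n - q) (m + p) →
          Xm (TTW.muVal a b n) (TTW.energy k ω a b (m + k * n)) (Ψ n m)
            = ((-2) ^ q * ω ^ p * TTW.poch q (-n - a) * TTW.poch q (-n - b)
                * TTW.poch p (m + 1) * TTW.poch p (-m - k * TTW.muVal a b n))
              • Ψ (n - q) (m + p))) ∧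
      -- parity in `μ`
      (∀ i j : ℕ, Odd i → TTW.coeffOp (TTW.xiPlus p q a b + TTW.xiMinus p q a b) i j = 0) ∧
      (∀ i j : ℕ, Even i → TTW.coeffOp (TTW.xiPlus p q a b - TTW.xiMinus p q a b) i j = 0) ∧
      -- action on all joint eigenfunctions
      (∀ (μ E : ℂ) (ψ : TTW.Smooth k), TTW.IsJointEigen ω a b μ E ψ →
        TTW.IsJointEigen ω a b (μ + 2 * q) E (Xp μ E ψ) ∧
        TTW.IsJointEigen ω a b (μ - 2 * q) E (Xm μ E ψ) ∧
        L3 ψ = Xp μ E ψ + Xm μ E ψ ∧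
        μ • L4 ψ = Xp μ E ψ - Xm μ E ψ ∧
        Xm (μ + 2 * q) E (Xp μ E ψ) + Xp (μ - 2 * q) E (Xm μ E ψ) = PpOp ψ ∧
        Xm (μ + 2 * q) E (Xp μ E ψ) - Xp (μ - 2 * q) E (Xm μ E ψ) = μ • PmOp ψ) ∧
      -- the structure polynomials
      (∀ n u : ℂ,
        MvPolynomial.eval ![TTW.energy k ω a b u ^ 2, -((k : ℂ) ^ 2 * TTW.muVal a b n ^ 2),
            ω ^ 2, a, b] Pp
          = TTW.xiScalar p q ω a b n u + TTW.etaScalar p q ω a b n u ∧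
        TTW.muVal a b n *
          MvPolynomial.eval ![TTW.energy k ω a b u ^ 2, -((k : ℂ) ^ 2 * TTW.muVal a b n ^ 2),
            ω ^ 2, a, b] Pm
          = TTW.xiScalar p q ω a b n u - TTW.etaScalar p q ω a b n u) ∧
      -- differential symmetry operators
      TTW.IsDiffOp L3 ∧ TTW.IsDiffOp L4 ∧
      ⁅H, L2⁆ = 0 ∧ ⁅H, L3⁆ = 0 ∧ ⁅H, L4⁆ = 0 ∧
      -- structure equations
      ⁅L2, L4⁆ = R ∧
      ⁅L2, R⁆ = -((8 * (k : ℂ) ^ 2 * q ^ 2) • TTW.symm2 L2 L4) - (16 * (k : ℂ) ^ 4 * q ^ 4) • L4 ∧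
      ⁅L4, R⁆ = (8 * (k : ℂ) ^ 2 * q ^ 2) • L4 ^ 2 + (8 * (k : ℂ) ^ 2 * q) • PmOp ∧
      (3 / (8 * (k : ℂ) ^ 2 * q ^ 2)) • R ^ 2
        = -((22 * (k : ℂ) ^ 2 * q ^ 2) • L4 ^ 2) - TTW.symm3 L2 L4 L4
          - (4 * (k : ℂ) ^ 2 * q) • PmOp + (12 * (k : ℂ) ^ 2) • PpOp ∧
      -- the generator of lower order
      ∃ L5 : TTW.Op k,
        (∃ N : ℕ, TTW.OrderLE N L5 ∧ ¬ TTW.OrderLE N L4) ∧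
        ⁅H, L5⁆ = 0 ∧ ⁅L2, L5⁆ = L4 ∧
        L5 * ((1 / (k : ℂ) ^ 2) • L2 + ((q : ℂ) ^ 2) • (1 : TTW.Op k))
          = (1 / (4 * q * (k : ℂ) ^ 2)) • (L3 - (q : ℂ) • L4 + Polynomial.aeval H Q) ∧
        (∀ (μ E : ℂ) (ψ : TTW.Smooth k), TTW.IsJointEigen ω a b μ E ψ →
          μ ≠ 0 → μ ≠ q → μ ≠ -q →
          L5 ψ = (-(1 / (4 * q * (k : ℂ) ^ 2))) •
            ((1 / ((μ + q) * μ)) • Xp μ E ψ + (1 / ((μ - q) * μ)) • Xm μ E ψ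
              + (Q.eval E / (μ ^ 2 - q ^ 2)) • ψ)) := by
  have hp' : (p : ℝ) ≠ 0 := Nat.cast_ne_zero.2 hp.ne'
  have hq' : (q : ℝ) ≠ 0 := Nat.cast_ne_zero.2 hq.ne'
  have hqc : (q : ℂ) ≠ 0 := Nat.cast_ne_zero.2 hq.ne'
  have hr : TTW.ratio p q ≠ 0 := div_ne_zero hp' hq'
  refine ⟨TTW.polyPlus (TTW.ratio p q : ℂ) p q, TTW.polyMinus (TTW.ratio p q : ℂ) p q, ?_⟩
  intro ω a b k H L2 L3 L4 R Xp Xm PpOp PmOp Q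
  obtain ⟨T, hT, hTe⟩ := TTW.exists_lowerNum_eq hr ω a b
  refine ⟨fun hω => ⟨TTW.eigenFn k ω a b, TTW.eigenFn_apply hω a b,
    TTW.isJointEigen_eigenFn hr hω a b, TTW.xiPlus_eigenFn hr hω a b, TTW.xiMinus_eigenFn hr hω a b⟩,
    TTW.coeffOp_xi_add hr a b, TTW.coeffOp_xi_sub hr a b, fun μ E ψ hψ => ⟨hψ.xiPlus hr,
    hψ.xiMinus hr, hψ.L3_apply hr, hψ.L4_apply hr, hψ.add_apply hr, hψ.sub_apply hr⟩,
    fun n u => ⟨TTW.eval_polyPlus ω a b n u hr, TTW.eval_polyMinus ω a b n u hr⟩,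
    TTW.L3_mem ω a b hr, TTW.L4_mem ω a b hr, ?_, TTW.lie_H_L3 hr ω a b, TTW.lie_H_L4 hr ω a b,
    TTW.lie_L2_L4_eq_R hr ω a b, TTW.lie_L2_R hr ω a b, TTW.lie_L4_R hr ω a b,
    TTW.R_sq hr ω a b hqc,
    (1 / (4 * q) : ℂ) • T, ⟨2 * p + 2 * q - 2, (TTW.orderLE_lower hr ω a b hp hq hT hTe).smul _,
      TTW.not_orderLE_L4 hr ω a b hp hq⟩, TTW.lie_H_L5 hr hT hTe, TTW.lie_L2_L5 hr hT hTe hqc,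
    TTW.L5_mul hr hTe, fun μ E ψ hψ h0 h1 h2 => hψ.L5_apply hr hTe h0 h1 h2⟩
  rw [Ring.lie_def, (TTW.commute_H_L2 ω a b).eq, sub_self]
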